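/- **Theorem 1 (lower tail).** Let $\mathcal X,\mathcal Y$ be finite alphabets, $W(y|x)$ a discrete memoryless channel from $\mathcal X$ to $\mathcal Y$, $R>0$ a rate, $g$ a continuous real-valued function on the probability distributions on $\mathcal X\times\mathcal Y$, and $Q_X$ a distribution on $\mathcal X$ that is the empirical distribution of some sequence of positive finite length. For each $n$ for which the type class $\mathcal T(Q_X)\subseteq\mathcal X^n$ (the sequences with empirical distribution exactly $Q_X$) is non-empty, draw $M=\lceil e^{nR}\rceil$ codewords $\boldsymbol x_0,\dots,\boldsymbol x_{M-1}$ independently and uniformly from $\mathcal T(Q_X)$; call the resulting random code $\mathcal C_n$. Messages are equiprobable, and the generalized likelihood decoder decides on $m$, given $\boldsymbol y$, with probability proportional to $\exp\{n g(\hat P_{\boldsymbol x_m\boldsymbol y})\}$, where $\hat P_{\boldsymbol x\boldsymbol y}$ is the joint empirical distribution. The error probability of the code is $$P_e(\mathcal C_n)=\frac1M\sum_{m}\sum_{m'\ne m}\sum_{\boldsymbol y\in\mathcal Y^n}\prod_{t=1}^nW(y_t|x_{m,t})\,\frac{\exp\{ng(\hat P_{\boldsymbol x_{m'}\boldsymbol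 y})\}}{\sum_{\tilde m}\exp\{ng(\hat P_{\boldsymbol x_{\tilde m}\boldsymbol y})\}},$$ and $\mathsf E(\mathcal C_n)=-\frac1n\log P_e(\mathcal C_n)$. Logarithms are natural, and $[t]_+=\max\{0,t\}$. Let $\mathcal Q(Q_X)$ be the set of joint distributions $Q_{XX'}$ on $\mathcal X\times\mathcal X$ with both marginals equal to $Q_X$. Let $I_Q(\cdot;\cdot)$ and $I_Q(\cdot;\cdot|\cdot)$ denote mutual and conditional mutual information and let $D(Q_{Y|X}\|W|Q_X)=\sum_xQ_X(x)\sum_yQ_{Y|X}(y|x)\log\frac{Q_{Y|X}(y|x)}{W(y|x)}\in[0,\infty]$. Define $$\alpha(R,Q_Y)=\max_{Q_{\tilde X|Y}:\,Q_{\tilde X}=Q_X,\ I_Q(\tilde X;Y)\le R}\{g(Q_{\tilde XY})-I_Q(\tilde X;Y)\}+R,$$ $$\beta(R,Q_Y)=\max_{Q_{\tilde X|Y}:\,Q_{\tilde X}=Q_X}\{g(Q_{\tilde XY})+[R-I_Q(\tilde X;Y)]_+\},$$ $$\Gamma(Q_{XX'},R)=\min_{Q_{Y|XX'}}\{D(Q_{Y|X}\|W|Q_X)+I_Q(X';Y|X)+[\max\{g(Q_{XY}),\alpha(R,Q_Y)\}-g(Q_{X'Y})]_+\},$$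 $$\Lambda(Q_{XX'},R)=\min_{Q_{Y|XX'}}\{D(Q_{Y|X}\|W|Q_X)+I_Q(X';Y|X)+\beta(R,Q_Y)-g(Q_{X'Y})\},$$ and, for $E_0\in\mathbb R$, $$\mathcal L(R,E_0)=\{Q_{XX'}\in\mathcal Q(Q_X):[2R-I_Q(X;X')]_+\ge\Gamma(Q_{XX'},R)+R-E_0\},$$ $$\mathcal M(R,E_0)=\{Q_{XX'}\in\mathcal Q(Q_X):[2R-I_Q(X;X')]_+\ge\Lambda(Q_{XX'},R)+R-E_0\},$$ $$E_{lt}^{ub}(R,E_0)=\min_{Q_{XX'}\in\mathcal L(R,E_0)}[I_Q(X;X')-2R]_+,\qquad E_{lt}^{lb}(R,E_0)=\min_{Q_{XX'}\in\mathcal M(R,E_0)}[I_Q(X;X')-2R]_+,$$ the minimum over an empty set being $\infty$. Then, for every $E_0\in\mathbb R$, as $n\to\infty$ through the block lengths for which $\mathcal T(Q_X)$ is non-empty: 1. $\displaystyle\limsup_{n\to\infty}\tfrac1n\log\mathbb P\{\mathsf E(\mathcal C_n)\le E_0\}\le-E_{lt}^{ub}(R,E_0)$; 2. $\displaystyle\liminf_{n\to\infty}\tfrac1n\log\mathbb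 P\{\mathsf E(\mathcal C_n)\le E_0\}\ge-E_{lt}^{lb}(R,E_1)$ for every $E_1<E_0$; and consequently $\displaystyle\liminf_{n\to\infty}\tfrac1n\log\mathbb P\{\mathsf E(\mathcal C_n)\le E_0\}\ge-E_{lt}^{lb}(R,E_0)$ whenever the (non-increasing) function $E\mapsto E_{lt}^{lb}(R,E)$ is left-continuous at $E_0$, hence for all but at most countably many $E_0$. -/

import Mathlib

open Filter MeasureTheory ProbabilityTheory

namespace LowerTail

noncomputable section

/-! ### Finite distributions and information measures (natural logarithm) -/

/-- First marginal of a joint distribution. -/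
def marg₁ {A B : Type*} [Fintype B] (Q : A × B → ℝ) (a : A) : ℝ := ∑ b, Q (a, b)

/-- Second marginal of a joint distribution. -/
def marg₂ {A B : Type*} [Fintype A] (Q : A × B → ℝ) (b : B) : ℝ := ∑ a, Q (a, b)

/-- The `(X, X')`-marginal of a distribution of `(X, X', Y)`. -/
def margXX' {X Y : Type*} [Fintype Y] (Q : X × X × Y → ℝ) (p : X × X) : ℝ :=
  ∑ y, Q (p.1, p.2, y)

/-- The `(X, Y)`-marginal of a distribution of `(X, X', Y)`. -/
def margXY {X Y : Type*} [Fintype X] (Q : X × X × Y → ℝ) (p : X × Y) : ℝ :=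
  ∑ x', Q (p.1, x', p.2)

/-- The `(X', Y)`-marginal of a distribution of `(X, X', Y)`. -/
def margX'Y {X Y : Type*} [Fintype X] (Q : X × X × Y → ℝ) (p : X × Y) : ℝ :=
  ∑ x, Q (x, p.1, p.2)

/-- Mutual information `I_Q(A;B)`; terms with `Q (a, b) = 0` vanish. -/
def mutualInfo {A B : Type*} [Fintype A] [Fintype B] (Q : A × B → ℝ) : ℝ :=
  ∑ a, ∑ b, Q (a, b) * Real.log (Q (a, b) / (marg₁ Q a * marg₂ Q b))

/-- Conditional mutual information `I_Q(X';Y|X)`; terms with `Q (x, x', y) = 0` vanish. -/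
def condMutualInfo {X Y : Type*} [Fintype X] [Fintype Y] (Q : X × X × Y → ℝ) : ℝ :=
  ∑ x, ∑ x', ∑ y, Q (x, x', y) *
    Real.log (Q (x, x', y) * marg₁ (margXX' Q) x / (margXX' Q (x, x') * margXY Q (x, y)))

open Classical in
/-- Conditional divergence `D(Q_{Y|X} ‖ W | Q_X)` of a distribution `Q` of `(X, Y)`. It is `+∞`
unless `Q_{XY}(x,y) = 0` whenever `W(y|x) = 0`. Here `Q_{Y|X}(y|x) = Q(x,y) / Q_X(x)`. -/
def condDiv {X Y : Type*} [Fintype X] [Fintype Y] (Q : X × Y → ℝ) (W : X → Y → ℝ) : EReal :=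
  if ∀ x y, W x y = 0 → Q (x, y) = 0 then
    ((∑ x, marg₁ Q x * ∑ y, Q (x, y) / marg₁ Q x *
      Real.log (Q (x, y) / marg₁ Q x / W x y) : ℝ) : EReal)
  else ⊤

/-! ### Types, the decoder and its error probability -/

/-- Empirical distribution of a sequence. -/
def empirical {A : Type*} [DecidableEq A] {n : ℕ} (s : Fin n → A) (a : A) : ℝ :=
  ((Finset.univ.filter fun t => s t = a).card : ℝ) / n

/-- Joint empirical distribution of a pair of sequences. -/
def jointEmpirical {A B : Type*} [DecidableEq A] [DecidableEq B] {n : ℕ}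
    (x : Fin n → A) (y : Fin n → B) : A × B → ℝ :=
  empirical fun t => (x t, y t)

/-- The type class of `QX` at block length `n`. -/
def typeClass {X : Type*} [DecidableEq X] (n : ℕ) (QX : X → ℝ) : Set (Fin n → X) :=
  {x | empirical x = QX}

/-- The number of codewords at rate `R` (nats per channel use) and block length `n`. -/
def numCodewords (R : ℝ) (n : ℕ) : ℕ := ⌈Real.exp (n * R)⌉₊

/-- A codebook with `M` codewords of block length `n`. -/
abbrev Codebook (X : Type*) (M n : ℕ) : Type _ := Fin M → Fin n → X

/-- The generalized likelihood decoder: the probability of deciding on message `m` given `y`. -/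
def gld {X Y : Type*} [DecidableEq X] [DecidableEq Y] (g : (X × Y → ℝ) → ℝ) {M n : ℕ}
    (C : Codebook X M n) (y : Fin n → Y) (m : Fin M) : ℝ :=
  Real.exp (n * g (jointEmpirical (C m) y)) /
    ∑ k, Real.exp (n * g (jointEmpirical (C k) y))

/-- Probability of error of a codebook over the memoryless channel `W` (`W x y = W(y|x)`),
equiprobable messages, generalized likelihood decoder with metric `g`. -/
def errorProb {X Y : Type*} [DecidableEq X] [DecidableEq Y] [Fintype Y] (W : X → Y → ℝ)
    (g : (X × Y → ℝ) → ℝ) {M n : ℕ} (C : Codebook X M n) : ℝ :=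
  (1 / M : ℝ) * ∑ m : Fin M, ∑ m' ∈ Finset.univ.filter (fun m' => m' ≠ m),
    ∑ y : Fin n → Y, (∏ t, W (C m t) (y t)) * gld g C y m'

/-- The error exponent `-(1/n) log P_e(C)` of a codebook (`+∞` if the error probability is `0`). -/
def errorExponent {X Y : Type*} [DecidableEq X] [DecidableEq Y] [Fintype Y] (W : X → Y → ℝ)
    (g : (X × Y → ℝ) → ℝ) {M n : ℕ} (C : Codebook X M n) : EReal :=
  -(ENNReal.log (ENNReal.ofReal (errorProb W g C)) / (n : EReal))

/-- The constant composition ensemble: `M` codewords drawn independently and uniformly from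
the type class of `QX`. -/
def ensemble {X : Type*} [DecidableEq X] [MeasurableSpace X] (QX : X → ℝ) (M n : ℕ) :
    Measure (Codebook X M n) :=
  Measure.pi fun _ : Fin M => uniformOn (typeClass n QX)

/-- The lower-tail probability `P{E(C_n) ≤ E₀}` of the rate-`R` ensemble. -/
def lowerTailProb {X Y : Type*} [DecidableEq X] [MeasurableSpace X] [DecidableEq Y] [Fintype Y]
    (W : X → Y → ℝ) (g : (X × Y → ℝ) → ℝ) (QX : X → ℝ) (R E₀ : ℝ) (n : ℕ) : ENNReal :=
  ensemble QX (numCodewords R n) n {C | errorExponent W g C ≤ (E₀ : EReal)}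

/-- `n → ∞` along the block lengths at which the type class of `QX` is not empty. -/
def blockLengths {X : Type*} [DecidableEq X] (QX : X → ℝ) : Filter ℕ :=
  atTop ⊓ 𝓟 {n | (typeClass n QX).Nonempty}

/-- `a n ≤ exp(-n E)` on the exponential scale along `l` (super-exponential decay if `E = ∞`). -/
def ExpScaleLE (l : Filter ℕ) (a : ℕ → ENNReal) (E : EReal) : Prop :=
  limsup (fun n => ENNReal.log (a n) / (n : EReal)) l ≤ -E

/-- `a n ≥ exp(-n E)` on the exponential scale along `l`. -/
def ExpScaleGE (l : Filter ℕ) (a : ℕ → ENNReal) (E : EReal) : Prop :=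
  -E ≤ liminf (fun n => ENNReal.log (a n) / (n : EReal)) l

/-! ### The exponents -/

section Exponents

variable {X Y : Type*} [Fintype X] [Fintype Y]

/-- Joint distributions with marginals `P₁` and `P₂`. -/
def couplings {A B : Type*} [Fintype A] [Fintype B] (P₁ : A → ℝ) (P₂ : B → ℝ) :
    Set (A × B → ℝ) :=
  {Q | Q ∈ stdSimplex ℝ (A × B) ∧ marg₁ Q = P₁ ∧ marg₂ Q = P₂}

/-- Distributions of `(X, X', Y)` whose `(X, X')`-marginal is `QXX`, that is, all the choices
of a conditional distribution `Q_{Y|XX'}`. -/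
def extensions (Y : Type*) [Fintype Y] (QXX : X × X → ℝ) : Set (X × X × Y → ℝ) :=
  {Q | Q ∈ stdSimplex ℝ (X × X × Y) ∧ margXX' Q = QXX}

/-- `α(R, Q_Y)`. -/
def alpha (g : (X × Y → ℝ) → ℝ) (QX : X → ℝ) (R : ℝ) (QY : Y → ℝ) : ℝ :=
  sSup ((fun Q => g Q - mutualInfo Q) '' {Q | Q ∈ couplings QX QY ∧ mutualInfo Q ≤ R}) + R

/-- `β(R, Q_Y)`. -/
def beta (g : (X × Y → ℝ) → ℝ) (QX : X → ℝ) (R : ℝ) (QY : Y → ℝ) : ℝ :=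
  sSup ((fun Q => g Q + max 0 (R - mutualInfo Q)) '' couplings QX QY)

/-- `Γ(Q_{XX'}, R)`. -/
def Gam (W : X → Y → ℝ) (g : (X × Y → ℝ) → ℝ) (QX : X → ℝ) (R : ℝ) (QXX : X × X → ℝ) : EReal :=
  ⨅ Q ∈ extensions Y QXX, condDiv (margXY Q) W +
    ((condMutualInfo Q + max 0 (max (g (margXY Q)) (alpha g QX R (marg₂ (margXY Q)))
      - g (margX'Y Q)) : ℝ) : EReal)

/-- `Λ(Q_{XX'}, R)`. -/
def Lam (W : X → Y → ℝ) (g : (X × Y → ℝ) → ℝ) (QX : X → ℝ) (R : ℝ) (QXX : X × X → ℝ) : EReal :=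
  ⨅ Q ∈ extensions Y QXX, condDiv (margXY Q) W +
    ((condMutualInfo Q + beta g QX R (marg₂ (margXY Q)) - g (margX'Y Q) : ℝ) : EReal)

/-- `Ψ(R, E₀, Q_{XX'})`. -/
def Psi (W : X → Y → ℝ) (g : (X × Y → ℝ) → ℝ) (QX : X → ℝ) (R E₀ : ℝ) (QXX : X × X → ℝ) :
    EReal :=
  Gam W g QX R QXX + (R : EReal) - (E₀ : EReal)

/-- `Ξ(R, E₀, Q_{XX'})`. -/
def Xi (W : X → Y → ℝ) (g : (X × Y → ℝ) → ℝ) (QX : X → ℝ) (R E₀ : ℝ) (QXX : X × X → ℝ) :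
    EReal :=
  Lam W g QX R QXX + (R : EReal) - (E₀ : EReal)

/-- The set `L(R, E₀)`. -/
def setL (W : X → Y → ℝ) (g : (X × Y → ℝ) → ℝ) (QX : X → ℝ) (R E₀ : ℝ) : Set (X × X → ℝ) :=
  {Q | Q ∈ couplings QX QX ∧
    Psi W g QX R E₀ Q ≤ ((max 0 (2 * R - mutualInfo Q) : ℝ) : EReal)}

/-- The set `M(R, E₀)`. -/
def setM (W : X → Y → ℝ) (g : (X × Y → ℝ) → ℝ) (QX : X → ℝ) (R E₀ : ℝ) : Set (X × X → ℝ) :=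
  {Q | Q ∈ couplings QX QX ∧
    Xi W g QX R E₀ Q ≤ ((max 0 (2 * R - mutualInfo Q) : ℝ) : EReal)}

/-- `E_lt^ub(R, E₀)`: minimum of `[I_Q(X;X') - 2R]₊` over `L(R, E₀)`, `∞` if the set is empty. -/
def EltUB (W : X → Y → ℝ) (g : (X × Y → ℝ) → ℝ) (QX : X → ℝ) (R E₀ : ℝ) : EReal :=
  ⨅ Q ∈ setL W g QX R E₀, ((max 0 (mutualInfo Q - 2 * R) : ℝ) : EReal)

/-- `E_lt^lb(R, E₀)`: minimum of `[I_Q(X;X') - 2R]₊` over `M(R, E₀)`, `∞` if the set is empty. -/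
def EltLB (W : X → Y → ℝ) (g : (X × Y → ℝ) → ℝ) (QX : X → ℝ) (R E₀ : ℝ) : EReal :=
  ⨅ Q ∈ setM W g QX R E₀, ((max 0 (mutualInfo Q - 2 * R) : ℝ) : EReal)

end Exponents

end

end LowerTail

open LowerTail

/-!
The error probability of a codebook is a sum over pairs of codewords, and by the method of types
the contribution of a pair depends, to first order in the exponent, on its joint type alone. So the
lower tail is decided by the type enumerators `typePairs Q`, the numbers of pairs of codewords of
joint type `Q`, and by the normalization `decoderSum` of the decoder.

*Normalization.* For a fixed output `y` the number of codewords of a given joint type with `y` is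
binomial with mean about `exp (n (R - I))`. Outside an event of doubly exponentially small
probability, it is at least about its mean for all `y` and all types with `I < R`
(`eventually_pr_count_lt`), and never much above `exp (n [R - I]₊)` (`eventually_pr_count_gt`).
Hence the normalization lies between `exp (n α)` and `exp (n β)`, so that a pair of joint type `Q`
contributes at most `exp (-n Γ(Q))` and at least `exp (-n Λ(Q))` to the sum over pairs.

*Pair enumerators.* The enumerator of `Q` exceeds `exp (n [2R - I]₊)` only with superexponentially
small probability (`eventually_pr_typePairs_gt`). The indicators of the pairs are dependent, but no
codeword has more than about `exp (n [R - I]₊)` partners, and if the codewords are exposed one after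
the other, the capped number of partners of each has a small conditional mean whatever the others
are; this controls an exponential moment (`expect_exp_capped_le`). Conversely, the indicators are
pairwise independent, so the Paley–Zygmund inequality gives about `exp (n [2R - I]₊)` pairs with
probability at least about `exp (-n [I - 2R]₊)` (`eventually_le_pr_typePairs`).

*Upper bound.* On a typical codebook without pairs of types in `setL` for a slightly larger
threshold, all terms are too small for the lower tail event (`exists_errorProb_lt`). A pair of a
type in `setL` exists with probability at most about `exp (-n [I - 2R]₊)`. The slack in the
threshold is removed by compactness and lower semicontinuity of the objective function of `Gam`
(`exists_le_of_lt_EltUB`), where `α` is continuous because `R > 0`.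

*Lower bound.* A near-optimal joint distribution for a member of `setM` at the threshold `E₁ < E₀`
is rounded to a joint type with the exact marginals (`exists_tripleEmpirical_dist_le`); if there are
as many pairs of that type as the second-moment bound provides, the error probability is at least
`exp (-n E₀)` (`eventually_le_errorProb`).
-/

open scoped Topology
set_option linter.unusedSectionVars false

namespace LowerTail

/-! ### Entropy formulas for the information measures -/

/-- Shannon entropy (in nats) of a function on a finite set. -/
noncomputable def ent {A : Type*} [Fintype A] (P : A → ℝ) : ℝ := ∑ a, Real.negMulLog (P a)

section Info

variable {A B X Y : Type*} [Fintype A] [Fintype B] [Fintype X] [Fintype Y]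

lemma continuous_ent : Continuous (ent : (A → ℝ) → ℝ) :=
  continuous_finsetSum _ fun a _ => Real.continuous_negMulLog.comp (continuous_apply a)

lemma continuous_marg₁ : Continuous (marg₁ : (A × B → ℝ) → A → ℝ) :=
  continuous_pi fun _ => continuous_finsetSum _ fun _ _ => continuous_apply _

lemma continuous_marg₂ : Continuous (marg₂ : (A × B → ℝ) → B → ℝ) :=
  continuous_pi fun _ => continuous_finsetSum _ fun _ _ => continuous_apply _

lemma continuous_margXX' : Continuous (margXX' : (X × X × Y → ℝ) → X × X → ℝ) :=
  continuous_pi fun _ => continuous_finsetSum _ fun _ _ => continuous_apply _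

lemma continuous_margXY : Continuous (margXY : (X × X × Y → ℝ) → X × Y → ℝ) :=
  continuous_pi fun _ => continuous_finsetSum _ fun _ _ => continuous_apply _

lemma continuous_margX'Y : Continuous (margX'Y : (X × X × Y → ℝ) → X × Y → ℝ) :=
  continuous_pi fun _ => continuous_finsetSum _ fun _ _ => continuous_apply _

lemma sum_marg₁ (Q : A × B → ℝ) : ∑ a, marg₁ Q a = ∑ p, Q p := by
  simp only [marg₁, Fintype.sum_prod_type]

lemma sum_marg₂ (Q : A × B → ℝ) : ∑ b, marg₂ Q b = ∑ p, Q p := by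
  simp only [marg₂, Fintype.sum_prod_type]
  exact Finset.sum_comm

lemma marg₁_mem {Q : A × B → ℝ} (hQ : Q ∈ stdSimplex ℝ (A × B)) :
    marg₁ Q ∈ stdSimplex ℝ A :=
  ⟨fun _ => Finset.sum_nonneg fun _ _ => hQ.1 _, by rw [sum_marg₁, hQ.2]⟩

lemma marg₂_mem {Q : A × B → ℝ} (hQ : Q ∈ stdSimplex ℝ (A × B)) :
    marg₂ Q ∈ stdSimplex ℝ B :=
  ⟨fun _ => Finset.sum_nonneg fun _ _ => hQ.1 _, by rw [sum_marg₂, hQ.2]⟩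

lemma margXX'_mem {Q : X × X × Y → ℝ} (hQ : Q ∈ stdSimplex ℝ (X × X × Y)) :
    margXX' Q ∈ stdSimplex ℝ (X × X) := by
  refine ⟨fun _ => Finset.sum_nonneg fun _ _ => hQ.1 _, ?_⟩
  rw [← hQ.2]
  simp only [margXX', Fintype.sum_prod_type]

lemma margXY_mem {Q : X × X × Y → ℝ} (hQ : Q ∈ stdSimplex ℝ (X × X × Y)) :
    margXY Q ∈ stdSimplex ℝ (X × Y) := by
  refine ⟨fun _ => Finset.sum_nonneg fun _ _ => hQ.1 _, ?_⟩
  rw [← hQ.2]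
  simp only [margXY, Fintype.sum_prod_type]
  exact Finset.sum_congr rfl fun _ _ => Finset.sum_comm

lemma margX'Y_mem {Q : X × X × Y → ℝ} (hQ : Q ∈ stdSimplex ℝ (X × X × Y)) :
    margX'Y Q ∈ stdSimplex ℝ (X × Y) := by
  refine ⟨fun _ => Finset.sum_nonneg fun _ _ => hQ.1 _, ?_⟩
  rw [← hQ.2]
  simp only [margX'Y, Fintype.sum_prod_type]
  rw [Finset.sum_comm_cycle]

lemma marg₁_margXY (Q : X × X × Y → ℝ) : marg₁ (margXY Q) = marg₁ (margXX' Q) := by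
  funext x
  simp only [marg₁, margXY, margXX']
  exact Finset.sum_comm

lemma le_marg₁ {Q : A × B → ℝ} (hQ : ∀ p, 0 ≤ Q p) (a : A) (b : B) : Q (a, b) ≤ marg₁ Q a :=
  Finset.single_le_sum (f := fun b => Q (a, b)) (fun _ _ => hQ _) (Finset.mem_univ b)

lemma le_marg₂ {Q : A × B → ℝ} (hQ : ∀ p, 0 ≤ Q p) (a : A) (b : B) : Q (a, b) ≤ marg₂ Q b :=
  Finset.single_le_sum (f := fun a => Q (a, b)) (fun _ _ => hQ _) (Finset.mem_univ a)

lemma le_margXX' {Q : X × X × Y → ℝ} (hQ : ∀ p, 0 ≤ Q p) (x x' : X) (y : Y) :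
    Q (x, x', y) ≤ margXX' Q (x, x') :=
  Finset.single_le_sum (f := fun y => Q (x, x', y)) (fun _ _ => hQ _) (Finset.mem_univ y)

lemma le_margXY {Q : X × X × Y → ℝ} (hQ : ∀ p, 0 ≤ Q p) (x x' : X) (y : Y) :
    Q (x, x', y) ≤ margXY Q (x, y) :=
  Finset.single_le_sum (f := fun x' => Q (x, x', y)) (fun _ _ => hQ _) (Finset.mem_univ x')

lemma ent_marg₁ (Q : A × B → ℝ) :
    ent (marg₁ Q) = -∑ a, ∑ b, Q (a, b) * Real.log (marg₁ Q a) := by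
  simp only [ent, Real.negMulLog, ← Finset.sum_mul, neg_mul, Finset.sum_neg_distrib]
  rfl

lemma ent_marg₂ (Q : A × B → ℝ) :
    ent (marg₂ Q) = -∑ a, ∑ b, Q (a, b) * Real.log (marg₂ Q b) := by
  rw [Finset.sum_comm]
  simp only [ent, Real.negMulLog, ← Finset.sum_mul, neg_mul, Finset.sum_neg_distrib]
  rfl

lemma ent_prod (Q : A × B → ℝ) :
    ent Q = -∑ a, ∑ b, Q (a, b) * Real.log (Q (a, b)) := by
  simp only [ent, Real.negMulLog, neg_mul, Finset.sum_neg_distrib, Fintype.sum_prod_type]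

lemma mutualInfo_eq {Q : A × B → ℝ} (hQ : ∀ p, 0 ≤ Q p) :
    mutualInfo Q = ent (marg₁ Q) + ent (marg₂ Q) - ent Q := by
  rw [ent_marg₁, ent_marg₂, ent_prod, mutualInfo, ← sub_eq_zero]
  simp only [← Finset.sum_neg_distrib, ← Finset.sum_add_distrib, ← Finset.sum_sub_distrib]
  refine Finset.sum_eq_zero fun a _ => Finset.sum_eq_zero fun b _ => ?_
  rcases (hQ (a, b)).eq_or_lt with h | h
  · simp [← h]
  · have h1 := h.trans_le (le_marg₁ hQ a b)
    have h2 := h.trans_le (le_marg₂ hQ a b)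
    rw [Real.log_div h.ne' (mul_pos h1 h2).ne', Real.log_mul h1.ne' h2.ne']
    ring

lemma condMutualInfo_eq {Q : X × X × Y → ℝ} (hQ : ∀ p, 0 ≤ Q p) :
    condMutualInfo Q = ent (margXX' Q) + ent (margXY Q) - ent (marg₁ (margXX' Q)) - ent Q := by
  have e1 : ent (margXX' Q) = -∑ x, ∑ x', ∑ y, Q (x, x', y) * Real.log (margXX' Q (x, x')) := by
    rw [ent_prod]; simp only [← Finset.sum_mul]; rfl
  have e2 : ent (margXY Q) = -∑ x, ∑ x', ∑ y, Q (x, x', y) * Real.log (margXY Q (x, y)) := by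
    rw [ent_prod]
    congr 1
    refine Finset.sum_congr rfl fun x _ => ?_
    rw [Finset.sum_comm]; simp only [← Finset.sum_mul]; rfl
  have e3 : ent (marg₁ (margXX' Q)) =
      -∑ x, ∑ x', ∑ y, Q (x, x', y) * Real.log (marg₁ (margXX' Q) x) := by
    rw [ent_marg₁]; simp only [← Finset.sum_mul]; rfl
  have e4 : ent Q = -∑ x, ∑ x', ∑ y, Q (x, x', y) * Real.log (Q (x, x', y)) := by
    rw [ent_prod]; simp only [Fintype.sum_prod_type]
  rw [e1, e2, e3, e4, condMutualInfo, ← sub_eq_zero]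
  simp only [← Finset.sum_neg_distrib, ← Finset.sum_add_distrib, ← Finset.sum_sub_distrib]
  refine Finset.sum_eq_zero fun x _ => Finset.sum_eq_zero fun x' _ =>
    Finset.sum_eq_zero fun y _ => ?_
  rcases (hQ (x, x', y)).eq_or_lt with h | h
  · simp [← h]
  · have h1 := h.trans_le (le_margXX' hQ x x' y)
    have h2 := h.trans_le (le_margXY hQ x x' y)
    have h3 : 0 < marg₁ (margXX' Q) x :=
      h1.trans_le (le_marg₁ (Q := margXX' Q) (fun _ => Finset.sum_nonneg fun _ _ => hQ _) x x')
    rw [Real.log_div (mul_pos h h3).ne' (mul_pos h1 h2).ne', Real.log_mul h1.ne' h2.ne',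
      Real.log_mul h.ne' h3.ne']
    ring

/-- `Q` puts no mass on transitions that the channel `W` forbids, so that the conditional
divergence from `W` is finite. -/
def ChannelAC (W : X → Y → ℝ) (Q : X × Y → ℝ) : Prop := ∀ x y, W x y = 0 → Q (x, y) = 0

lemma condDiv_eq {W : X → Y → ℝ} {Q : X × Y → ℝ} (hQ : ∀ p, 0 ≤ Q p) (hac : ChannelAC W Q) :
    condDiv Q W = ((ent (marg₁ Q) - ent Q - ∑ x, ∑ y, Q (x, y) * Real.log (W x y) : ℝ) :
      EReal) := by
  rw [condDiv, if_pos (by exact hac), EReal.coe_eq_coe_iff, ent_marg₁, ent_prod, ← sub_eq_zero]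
  simp only [Finset.mul_sum]
  simp only [← Finset.sum_neg_distrib, ← Finset.sum_sub_distrib]
  refine Finset.sum_eq_zero fun x _ => Finset.sum_eq_zero fun y _ => ?_
  rcases (hQ (x, y)).eq_or_lt with h | h
  · simp [← h]
  · have h1 := h.trans_le (le_marg₁ hQ x y)
    have h2 : W x y ≠ 0 := fun h0 => h.ne' (hac x y h0)
    rw [Real.log_div (div_pos h h1).ne' h2, Real.log_div h.ne' h1.ne']
    field_simp
    ring

lemma condDiv_of_not_ac {W : X → Y → ℝ} {Q : X × Y → ℝ} (hac : ¬ ChannelAC W Q) :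
    condDiv Q W = ⊤ := if_neg hac

/-- The part `D(Q_{Y|X} ‖ W | Q_X) + I_Q(X';Y|X)` of the objective functions, in the closed form
it takes when `Q` is compatible with the channel; unlike the original it is continuous in `Q`. -/
noncomputable def transCost (W : X → Y → ℝ) (Q : X × X × Y → ℝ) : ℝ :=
  ent (margXX' Q) - ent Q - ∑ x, ∑ y, margXY Q (x, y) * Real.log (W x y)

lemma continuous_transCost (W : X → Y → ℝ) : Continuous (transCost W) := by
  unfold transCost
  refine ((continuous_ent.comp continuous_margXX').sub continuous_ent).sub
    (continuous_finsetSum _ fun x _ => continuous_finsetSum _ fun y _ => ?_)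
  exact ((continuous_apply (x, y)).comp continuous_margXY).mul continuous_const

lemma condDiv_add_eq {W : X → Y → ℝ} {Q : X × X × Y → ℝ} (hQ : ∀ p, 0 ≤ Q p)
    (hac : ChannelAC W (margXY Q)) (r : ℝ) :
    condDiv (margXY Q) W + ((condMutualInfo Q + r : ℝ) : EReal) =
      ((transCost W Q + r : ℝ) : EReal) := by
  rw [condDiv_eq (Q := margXY Q) (fun _ => Finset.sum_nonneg fun _ _ => hQ _) hac, ← EReal.coe_add,
    condMutualInfo_eq hQ, marg₁_margXY, transCost]
  congr 1
  ring

lemma isClosed_channelAC (W : X → Y → ℝ) : IsClosed {Q : X × Y → ℝ | ChannelAC W Q} := by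
  simp only [ChannelAC, Set.ofPred_forall]
  exact isClosed_iInter fun x => isClosed_iInter fun y => isClosed_iInter fun _ =>
    isClosed_eq (continuous_apply _) continuous_const

/-! ### Mutual information over couplings -/

lemma continuousOn_mutualInfo :
    ContinuousOn (mutualInfo : (A × B → ℝ) → ℝ) (stdSimplex ℝ (A × B)) := by
  refine ContinuousOn.congr (f := fun Q => ent (marg₁ Q) + ent (marg₂ Q) - ent Q) ?_
    fun Q hQ => mutualInfo_eq hQ.1
  exact (((continuous_ent.comp continuous_marg₁).add
    (continuous_ent.comp continuous_marg₂)).sub continuous_ent).continuousOn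

/-- The independent coupling. -/
def prodDist (P : A → ℝ) (q : B → ℝ) : A × B → ℝ := fun p => P p.1 * q p.2

lemma prodDist_mem {P : A → ℝ} {q : B → ℝ} (hP : P ∈ stdSimplex ℝ A) (hq : q ∈ stdSimplex ℝ B) :
    prodDist P q ∈ couplings P q := by
  refine ⟨⟨fun p => mul_nonneg (hP.1 _) (hq.1 _), ?_⟩, ?_, ?_⟩
  · simp only [prodDist, Fintype.sum_prod_type, ← Finset.mul_sum, hq.2, mul_one, hP.2]
  · funext a; simp only [marg₁, prodDist, ← Finset.mul_sum, hq.2, mul_one]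
  · funext a; simp only [marg₂, prodDist, ← Finset.sum_mul, hP.2, one_mul]

lemma mutualInfo_nonneg {Q : A × B → ℝ} (hQ : Q ∈ stdSimplex ℝ (A × B)) : 0 ≤ mutualInfo Q := by
  have key : ∀ a b, Q (a, b) - marg₁ Q a * marg₂ Q b ≤
      Q (a, b) * Real.log (Q (a, b) / (marg₁ Q a * marg₂ Q b)) := by
    intro a b
    rcases (hQ.1 (a, b)).eq_or_lt with h | h
    · rw [← h]
      simpa using mul_nonneg ((marg₁_mem hQ).1 a) ((marg₂_mem hQ).1 b)
    · have h1 := h.trans_le (le_marg₁ hQ.1 a b)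
      have h2 := h.trans_le (le_marg₂ hQ.1 a b)
      have h3 := mul_pos h1 h2
      have := Real.one_sub_inv_le_log_of_pos (div_pos h h3)
      have := mul_le_mul_of_nonneg_left this h.le
      refine le_trans (le_of_eq ?_) this
      field_simp
  calc (0 : ℝ) = ∑ a, ∑ b, (Q (a, b) - marg₁ Q a * marg₂ Q b) := by
        simp only [Finset.sum_sub_distrib, ← Finset.mul_sum, ← Finset.sum_mul, sum_marg₂, hQ.2,
          sum_marg₁]
        rw [← Fintype.sum_prod_type', hQ.2]; norm_num
    _ ≤ _ := Finset.sum_le_sum fun a _ => Finset.sum_le_sum fun b _ => key a b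

lemma mutualInfo_prodDist {P : A → ℝ} {q : B → ℝ} (hP : P ∈ stdSimplex ℝ A)
    (hq : q ∈ stdSimplex ℝ B) : mutualInfo (prodDist P q) = 0 := by
  obtain ⟨-, h1, h2⟩ := prodDist_mem hP hq
  rw [mutualInfo, h1, h2]
  refine Finset.sum_eq_zero fun a _ => Finset.sum_eq_zero fun b _ => ?_
  rcases eq_or_ne (P a * q b) 0 with h | h
  · simp [prodDist, h]
  · simp [prodDist, div_self h]

lemma isCompact_couplings (P : A → ℝ) (q : B → ℝ) : IsCompact (couplings P q) := by
  refine (isCompact_stdSimplex ℝ (A × B)).of_isClosed_subset ?_ fun Q hQ => hQ.1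
  exact (isClosed_stdSimplex ℝ (A × B)).inter ((isClosed_eq continuous_marg₁ continuous_const).inter
    (isClosed_eq continuous_marg₂ continuous_const))

/-- Mutual information is convex along couplings of two fixed distributions: mixing a coupling
with the independent one scales it down. -/
lemma mix_mem_and_mutualInfo_le {P : A → ℝ} {q : B → ℝ} {Q : A × B → ℝ} (hQ : Q ∈ couplings P q)
    {s : ℝ} (hs : 0 ≤ s) (hs1 : s ≤ 1) :
    (1 - s) • Q + s • prodDist P q ∈ couplings P q ∧
      mutualInfo ((1 - s) • Q + s • prodDist P q) ≤ (1 - s) * mutualInfo Q := by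
  have hP : P ∈ stdSimplex ℝ A := hQ.2.1 ▸ marg₁_mem hQ.1
  have hq : q ∈ stdSimplex ℝ B := hQ.2.2 ▸ marg₂_mem hQ.1
  have hpd := prodDist_mem hP hq
  have hmem : (1 - s) • Q + s • prodDist P q ∈ couplings P q := by
    refine ⟨convex_stdSimplex ℝ _ hQ.1 hpd.1 (by linarith) hs (by ring), ?_, ?_⟩
    · funext a
      have e1 := congrFun hQ.2.1 a
      have e2 := congrFun hpd.2.1 a
      simp only [marg₁, Pi.add_apply, Pi.smul_apply, smul_eq_mul, Finset.sum_add_distrib,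
        ← Finset.mul_sum] at e1 e2 ⊢
      rw [e1, e2]; ring
    · funext a
      have e1 := congrFun hQ.2.2 a
      have e2 := congrFun hpd.2.2 a
      simp only [marg₂, Pi.add_apply, Pi.smul_apply, smul_eq_mul, Finset.sum_add_distrib,
        ← Finset.mul_sum] at e1 e2 ⊢
      rw [e1, e2]; ring
  refine ⟨hmem, ?_⟩
  have hI := mutualInfo_prodDist hP hq
  rw [mutualInfo_eq hpd.1.1, hpd.2.1, hpd.2.2] at hI
  rw [mutualInfo_eq hmem.1.1, mutualInfo_eq hQ.1.1, hmem.2.1, hmem.2.2, hQ.2.1, hQ.2.2]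
  have hc : (1 - s) * ent Q + s * ent (prodDist P q) ≤ ent ((1 - s) • Q + s • prodDist P q) := by
    simp only [ent, Finset.mul_sum, ← Finset.sum_add_distrib]
    refine Finset.sum_le_sum fun p _ => ?_
    simpa using Real.concaveOn_negMulLog.2 (Set.mem_Ici.2 (hQ.1.1 p)) (Set.mem_Ici.2 (hpd.1.1 p))
      (by linarith : (0 : ℝ) ≤ 1 - s) hs (by ring)
  nlinarith

end Info

/-! ### Stability of the exponents under perturbation -/

section Stability

variable {A B X Y : Type*} [Fintype A] [Fintype B] [Fintype X] [Fintype Y]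

/-- Couplings depend on their second marginal in a Lipschitz way: shrink each column to the
smaller of the two marginals and distribute the missing mass independently. -/
lemma exists_coupling_dist_le {P : A → ℝ} {q q' : B → ℝ} {Q : A × B → ℝ} (hQ : Q ∈ couplings P q)
    (hq' : q' ∈ stdSimplex ℝ B) : ∃ Q' ∈ couplings P q', dist Q Q' ≤ dist q q' := by
  have hP : P ∈ stdSimplex ℝ A := hQ.2.1 ▸ marg₁_mem hQ.1
  have hq : q ∈ stdSimplex ℝ B := hQ.2.2 ▸ marg₂_mem hQ.1
  set m : B → ℝ := fun b => min (q b) (q' b) with hm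
  have hm0 : ∀ b, 0 ≤ m b := fun b => le_min (hq.1 b) (hq'.1 b)
  have hmq : ∀ b, m b ≤ q b := fun b => min_le_left _ _
  have hmq' : ∀ b, m b ≤ q' b := fun b => min_le_right _ _
  set Q₁ : A × B → ℝ := fun p => Q p * (m p.2 / q p.2) with hQ₁
  have hr0 : ∀ b, 0 ≤ m b / q b := fun b => div_nonneg (hm0 b) (hq.1 b)
  have hr1 : ∀ b, m b / q b ≤ 1 := fun b => div_le_one_of_le₀ (hmq b) (hq.1 b)
  have hQ₁0 : ∀ p, 0 ≤ Q₁ p := fun p => mul_nonneg (hQ.1.1 p) (hr0 _)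
  have hQ₁Q : ∀ p, Q₁ p ≤ Q p := fun p => mul_le_of_le_one_right (hQ.1.1 p) (hr1 _)
  have hcol : ∀ b, ∑ a, Q (a, b) = q b := fun b => congrFun hQ.2.2 b
  have hrow : ∀ a, ∑ b, Q (a, b) = P a := fun b => congrFun hQ.2.1 b
  have hm₂ : ∀ b, ∑ a, Q₁ (a, b) = m b := by
    intro b
    simp only [hQ₁, ← Finset.sum_mul, hcol]
    rcases eq_or_ne (q b) 0 with h | h
    · rw [h, zero_mul]; exact le_antisymm (hm0 b) (h ▸ hmq b)
    · field_simp
  set s : A → ℝ := fun a => ∑ b, Q₁ (a, b) with hs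
  have hsP : ∀ a, s a ≤ P a := fun a => by
    rw [← hrow a]; exact Finset.sum_le_sum fun b _ => hQ₁Q _
  have hsm : ∑ a, s a = ∑ b, m b := by
    simp only [hs]; rw [Finset.sum_comm]; exact Finset.sum_congr rfl fun b _ => hm₂ b
  set d : ℝ := 1 - ∑ b, m b with hd
  have hd1 : ∑ a, (P a - s a) = d := by rw [Finset.sum_sub_distrib, hP.2, hsm]
  have hd2 : ∑ b, (q' b - m b) = d := by rw [Finset.sum_sub_distrib, hq'.2]
  have hd0 : 0 ≤ d := hd2 ▸ Finset.sum_nonneg fun b _ => sub_nonneg.2 (hmq' b)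
  have hPs : ∀ a, P a - s a ≤ d := fun a => hd1 ▸
    Finset.single_le_sum (f := fun a => P a - s a) (fun a _ => sub_nonneg.2 (hsP a))
      (Finset.mem_univ a)
  have hmd : ∀ b, q' b - m b ≤ d := fun b => hd2 ▸
    Finset.single_le_sum (f := fun b => q' b - m b) (fun a _ => sub_nonneg.2 (hmq' a))
      (Finset.mem_univ b)
  set Q' : A × B → ℝ := fun p => Q₁ p + (P p.1 - s p.1) / d * (q' p.2 - m p.2) with hQ'
  have hc0 : ∀ a, 0 ≤ (P a - s a) / d := fun a => div_nonneg (sub_nonneg.2 (hsP a)) hd0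
  have hc1 : ∀ a, (P a - s a) / d ≤ 1 := fun a => div_le_one_of_le₀ (hPs a) hd0
  have hQ'0 : ∀ p, 0 ≤ Q' p := fun p =>
    add_nonneg (hQ₁0 p) (mul_nonneg (hc0 _) (sub_nonneg.2 (hmq' _)))
  have h1 : marg₁ Q' = P := by
    funext a
    simp only [marg₁, hQ', Finset.sum_add_distrib, ← Finset.mul_sum, hd2]
    change s a + _ = _
    rcases hd0.eq_or_lt with h | h
    · have := hPs a; have := hsP a; rw [← h]; simp; linarith
    · field_simp; ring
  have h2 : marg₂ Q' = q' := by
    funext b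
    simp only [marg₂, hQ', Finset.sum_add_distrib, ← Finset.sum_mul, hm₂, ← Finset.sum_div, hd1]
    rcases hd0.eq_or_lt with h | h
    · have := hmd b; have := hmq' b; rw [← h]; simp; linarith
    · rw [div_self h.ne']; ring
  refine ⟨Q', ⟨⟨hQ'0, ?_⟩, h1, h2⟩, ?_⟩
  · rw [← sum_marg₁, h1, hP.2]
  · refine (dist_pi_le_iff dist_nonneg).2 fun p => ?_
    refine le_trans ?_ (dist_le_pi_dist q q' p.2)
    rw [Real.dist_eq, Real.dist_eq]
    have e1 : Q p - Q₁ p ≤ q p.2 - m p.2 := by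
      have hle : Q p ≤ q p.2 := by rw [← hcol]; exact le_marg₂ hQ.1.1 p.1 p.2
      rcases (hq.1 p.2).eq_or_lt with h | h
      · have := hQ.1.1 p; have := hQ₁0 p; have := hmq p.2; linarith
      · have : q p.2 * (m p.2 / q p.2) = m p.2 := by field_simp
        have h3 : Q p * (1 - m p.2 / q p.2) ≤ q p.2 * (1 - m p.2 / q p.2) :=
          mul_le_mul_of_nonneg_right hle (sub_nonneg.2 (hr1 _))
        simp only [hQ₁]; nlinarith
    have e2 : 0 ≤ Q p - Q₁ p := sub_nonneg.2 (hQ₁Q p)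
    have e3 : 0 ≤ (P p.1 - s p.1) / d * (q' p.2 - m p.2) :=
      mul_nonneg (hc0 _) (sub_nonneg.2 (hmq' _))
    have e4 : (P p.1 - s p.1) / d * (q' p.2 - m p.2) ≤ q' p.2 - m p.2 :=
      mul_le_of_le_one_left (sub_nonneg.2 (hmq' _)) (hc1 _)
    have e5 : q p.2 - m p.2 ≤ |q p.2 - q' p.2| := by
      simp only [hm]; rcases min_cases (q p.2) (q' p.2) with h | h <;> rw [h.1]
      · simp
      · exact le_abs_self _
    have e6 : q' p.2 - m p.2 ≤ |q p.2 - q' p.2| := by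
      simp only [hm]; rcases min_cases (q p.2) (q' p.2) with h | h <;> rw [h.1]
      · rw [abs_sub_comm]; exact le_abs_self _
      · simp
    simp only [hQ']
    rw [abs_le]; constructor <;> linarith

lemma exists_delta_of_continuousOn {f : (A → ℝ) → ℝ} (hf : ContinuousOn f (stdSimplex ℝ A))
    {ε : ℝ} (hε : 0 < ε) : ∃ δ > 0, ∀ P ∈ stdSimplex ℝ A, ∀ Q ∈ stdSimplex ℝ A,
      dist P Q < δ → |f P - f Q| < ε := by
  obtain ⟨δ, hδ, h⟩ := Metric.uniformContinuousOn_iff.1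
    ((isCompact_stdSimplex ℝ A).uniformContinuousOn_of_continuous hf) ε hε
  exact ⟨δ, hδ, fun P hP Q hQ hd => by simpa [Real.dist_eq] using h P hP Q hQ hd⟩

variable {g : (X × Y → ℝ) → ℝ} {QX : X → ℝ} {R : ℝ}

lemma continuousOn_sub_mutualInfo (hg : ContinuousOn g (stdSimplex ℝ (X × Y))) :
    ContinuousOn (fun Q => g Q - mutualInfo Q) (stdSimplex ℝ (X × Y)) :=
  hg.sub continuousOn_mutualInfo

lemma continuousOn_add_max (hg : ContinuousOn g (stdSimplex ℝ (X × Y))) (R : ℝ) :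
    ContinuousOn (fun Q => g Q + max 0 (R - mutualInfo Q)) (stdSimplex ℝ (X × Y)) :=
  hg.add (ContinuousOn.sup continuousOn_const (continuousOn_const.sub continuousOn_mutualInfo))

lemma bddAbove_alpha (hg : ContinuousOn g (stdSimplex ℝ (X × Y))) (q : Y → ℝ) :
    BddAbove ((fun Q => g Q - mutualInfo Q) '' {Q | Q ∈ couplings QX q ∧ mutualInfo Q ≤ R}) :=
  ((isCompact_stdSimplex ℝ _).bddAbove_image (continuousOn_sub_mutualInfo hg)).mono
    (Set.image_mono fun _ hQ => hQ.1.1)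

lemma bddAbove_beta (hg : ContinuousOn g (stdSimplex ℝ (X × Y))) (q : Y → ℝ) :
    BddAbove ((fun Q => g Q + max 0 (R - mutualInfo Q)) '' couplings QX q) :=
  ((isCompact_stdSimplex ℝ _).bddAbove_image (continuousOn_add_max hg R)).mono
    (Set.image_mono fun _ hQ => hQ.1)

lemma le_alpha (hg : ContinuousOn g (stdSimplex ℝ (X × Y))) {q : Y → ℝ} {Q : X × Y → ℝ}
    (hQ : Q ∈ couplings QX q) (hI : mutualInfo Q ≤ R) :
    g Q - mutualInfo Q + R ≤ alpha g QX R q :=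
  add_le_add_left (le_csSup (bddAbove_alpha hg q) ⟨Q, ⟨hQ, hI⟩, rfl⟩) R

lemma le_beta (hg : ContinuousOn g (stdSimplex ℝ (X × Y))) {q : Y → ℝ} {Q : X × Y → ℝ}
    (hQ : Q ∈ couplings QX q) :
    g Q + max 0 (R - mutualInfo Q) ≤ beta g QX R q :=
  le_csSup (bddAbove_beta hg q) ⟨Q, hQ, rfl⟩

/-- The maximum defining `alpha` is nearly attained with a rate constraint that holds with a
margin uniform in the output distribution. This is where `R > 0` enters: mixing with the
independent coupling lowers the mutual information by a positive fraction of `R`. -/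
lemma exists_near_alpha (hg : ContinuousOn g (stdSimplex ℝ (X × Y)))
    (hQX : QX ∈ stdSimplex ℝ X) (hR : 0 < R) {ε : ℝ} (hε : 0 < ε) :
    ∃ η > 0, ∀ q ∈ stdSimplex ℝ Y, ∃ Q ∈ couplings QX q, mutualInfo Q ≤ R - η ∧
      alpha g QX R q - ε ≤ g Q - mutualInfo Q + R := by
  obtain ⟨δ, hδ, h⟩ := exists_delta_of_continuousOn hg (half_pos hε)
  have hs : 0 < min 1 (δ / 2) := lt_min one_pos (half_pos hδ)
  refine ⟨min 1 (δ / 2) * R, mul_pos hs hR, fun q hq => ?_⟩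
  have hne : ((fun Q => g Q - mutualInfo Q) ''
      {Q | Q ∈ couplings QX q ∧ mutualInfo Q ≤ R}).Nonempty :=
    ⟨_, _, ⟨prodDist_mem hQX hq, (mutualInfo_prodDist hQX hq).le.trans hR.le⟩, rfl⟩
  obtain ⟨-, ⟨Q, ⟨hQ, hI⟩, rfl⟩, hlt⟩ := exists_lt_of_lt_csSup hne (sub_lt_self _ (half_pos hε))
  obtain ⟨hmem, hle⟩ := mix_mem_and_mutualInfo_le hQ hs.le (min_le_left _ _)
  have hI0 := mutualInfo_nonneg hQ.1
  have hs1 : min 1 (δ / 2) ≤ 1 := min_le_left _ _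
  have hs2 : min 1 (δ / 2) ≤ δ / 2 := min_le_right _ _
  set s := min 1 (δ / 2)
  refine ⟨_, hmem, ?_, ?_⟩
  · nlinarith
  · have hd : dist ((1 - s) • Q + s • prodDist QX q) Q < δ := by
      refine lt_of_le_of_lt ((dist_pi_le_iff hs.le).2 fun p => ?_) (by linarith : s < δ)
      have h1 : prodDist QX q p ∈ Set.Icc (0 : ℝ) 1 :=
        stdSimplex_subset_Icc ℝ (prodDist_mem hQX hq).1 |> fun h => ⟨h.1 p, h.2 p⟩
      have h2 : Q p ∈ Set.Icc (0 : ℝ) 1 := stdSimplex_subset_Icc ℝ hQ.1 |> fun h => ⟨h.1 p, h.2 p⟩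
      rw [Real.dist_eq]
      simp only [Pi.add_apply, Pi.smul_apply, smul_eq_mul]
      rw [abs_le]; constructor <;> nlinarith [h1.1, h1.2, h2.1, h2.2]
    have := abs_lt.1 (h _ hmem.1 _ hQ.1 hd)
    simp only at hlt
    unfold alpha
    nlinarith [this.1]

lemma alpha_le_add (hg : ContinuousOn g (stdSimplex ℝ (X × Y)))
    (hQX : QX ∈ stdSimplex ℝ X) (hR : 0 < R) {ε : ℝ} (hε : 0 < ε) :
    ∃ δ > 0, ∀ q ∈ stdSimplex ℝ Y, ∀ q' ∈ stdSimplex ℝ Y, dist q q' < δ →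
      alpha g QX R q ≤ alpha g QX R q' + ε := by
  obtain ⟨η, hη, h⟩ := exists_near_alpha hg hQX hR (half_pos hε)
  obtain ⟨δ₁, hδ₁, h₁⟩ := exists_delta_of_continuousOn (A := X × Y) continuousOn_mutualInfo hη
  obtain ⟨δ₂, hδ₂, h₂⟩ := exists_delta_of_continuousOn (continuousOn_sub_mutualInfo hg)
    (half_pos hε)
  refine ⟨min δ₁ δ₂, lt_min hδ₁ hδ₂, fun q hq q' hq' hd => ?_⟩
  obtain ⟨Q, hQ, hI, hα⟩ := h q hq
  obtain ⟨Q', hQ', hQQ'⟩ := exists_coupling_dist_le hQ hq'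
  have hd' := hQQ'.trans_lt hd
  have e1 := abs_lt.1 (h₁ Q hQ.1 Q' hQ'.1 (hd'.trans_le (min_le_left _ _)))
  have e2 := abs_lt.1 (h₂ Q hQ.1 Q' hQ'.1 (hd'.trans_le (min_le_right _ _)))
  have e3 := le_alpha hg hQ' (by linarith [e1.1] : mutualInfo Q' ≤ R)
  linarith [e2.1, e2.2]

lemma beta_le_add (hg : ContinuousOn g (stdSimplex ℝ (X × Y)))
    (hQX : QX ∈ stdSimplex ℝ X) {ε : ℝ} (hε : 0 < ε) :
    ∃ δ > 0, ∀ q ∈ stdSimplex ℝ Y, ∀ q' ∈ stdSimplex ℝ Y, dist q q' < δ →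
      beta g QX R q ≤ beta g QX R q' + ε := by
  obtain ⟨δ, hδ, h⟩ := exists_delta_of_continuousOn (continuousOn_add_max hg R) hε
  refine ⟨δ, hδ, fun q hq q' hq' hd => ?_⟩
  refine csSup_le ⟨_, _, prodDist_mem hQX hq, rfl⟩ ?_
  rintro - ⟨Q, hQ, rfl⟩
  obtain ⟨Q', hQ', hQQ'⟩ := exists_coupling_dist_le hQ hq'
  have e := abs_lt.1 (h Q hQ.1 Q' hQ'.1 (hQQ'.trans_lt hd))
  have e3 := le_beta (R := R) hg hQ'
  linarith [e.1, e.2]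

/-! ### Right-continuity of the exponent `EltUB` in the error exponent threshold -/

/-- The correction term in `Gam`. -/
noncomputable def gamPenalty (g : (X × Y → ℝ) → ℝ) (QX : X → ℝ) (R : ℝ) (Q : X × X × Y → ℝ) : ℝ :=
  max 0 (max (g (margXY Q)) (alpha g QX R (marg₂ (margXY Q))) - g (margX'Y Q))

lemma Gam_le_of_ac {W : X → Y → ℝ} {QXX : X × X → ℝ} {Q : X × X × Y → ℝ}
    (hQ : Q ∈ extensions Y QXX) (hac : ChannelAC W (margXY Q)) :
    Gam W g QX R QXX ≤ ((transCost W Q + gamPenalty g QX R Q : ℝ) : EReal) := by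
  rw [← condDiv_add_eq hQ.1.1 hac]
  exact iInf₂_le Q hQ

lemma exists_of_Gam_lt {W : X → Y → ℝ} {QXX : X × X → ℝ} {c : ℝ}
    (h : Gam W g QX R QXX < (c : EReal)) : ∃ Q ∈ extensions Y QXX, ChannelAC W (margXY Q) ∧
      transCost W Q + gamPenalty g QX R Q < c := by
  unfold Gam at h
  simp only [iInf_lt_iff] at h
  obtain ⟨Q, hQ, hlt⟩ := h
  by_cases hac : ChannelAC W (margXY Q)
  · rw [condDiv_add_eq hQ.1.1 hac, EReal.coe_lt_coe_iff] at hlt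
    exact ⟨Q, hQ, hac, hlt⟩
  · rw [condDiv_of_not_ac hac, EReal.top_add_coe] at hlt
    exact absurd hlt not_top_lt

lemma exists_of_Lam_lt {W : X → Y → ℝ} {QXX : X × X → ℝ} {c : ℝ}
    (h : Lam W g QX R QXX < (c : EReal)) : ∃ Q ∈ extensions Y QXX, ChannelAC W (margXY Q) ∧
      transCost W Q + beta g QX R (marg₂ (margXY Q)) - g (margX'Y Q) < c := by
  unfold Lam at h
  simp only [iInf_lt_iff] at h
  obtain ⟨Q, hQ, hlt⟩ := h
  by_cases hac : ChannelAC W (margXY Q)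
  · rw [add_sub_assoc, condDiv_add_eq hQ.1.1 hac, EReal.coe_lt_coe_iff] at hlt
    exact ⟨Q, hQ, hac, by linarith⟩
  · rw [condDiv_of_not_ac hac, EReal.top_add_coe] at hlt
    exact absurd hlt not_top_lt

lemma gamPenalty_lsc (hg : ContinuousOn g (stdSimplex ℝ (X × Y))) (hQX : QX ∈ stdSimplex ℝ X)
    (hR : 0 < R) {P : ℕ → X × X × Y → ℝ} {P₀ : X × X × Y → ℝ}
    (hP : ∀ k, P k ∈ stdSimplex ℝ (X × X × Y)) (hP₀ : P₀ ∈ stdSimplex ℝ (X × X × Y))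
    (h : Tendsto P atTop (𝓝 P₀)) {ε : ℝ} (hε : 0 < ε) :
    ∀ᶠ k in atTop, gamPenalty g QX R P₀ ≤ gamPenalty g QX R (P k) + ε := by
  obtain ⟨δ, hδ, hα⟩ := alpha_le_add hg hQX hR (half_pos hε)
  obtain ⟨δ', hδ', hg'⟩ := exists_delta_of_continuousOn hg (half_pos hε)
  have t1 := (((continuous_marg₂.comp continuous_margXY).tendsto P₀).comp h)
  have t2 := ((continuous_margXY.tendsto P₀).comp h)
  have t3 := ((continuous_margX'Y.tendsto P₀).comp h)
  filter_upwards [Metric.tendsto_nhds.1 t1 δ hδ, Metric.tendsto_nhds.1 t2 δ' hδ',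
    Metric.tendsto_nhds.1 t3 δ' hδ'] with k h1 h2 h3
  have e1 := hα _ (marg₂_mem (margXY_mem hP₀)) _ (marg₂_mem (margXY_mem (hP k)))
    (by rw [dist_comm]; exact h1)
  have e2 := abs_lt.1 (hg' _ (margXY_mem (hP k)) _ (margXY_mem hP₀) h2)
  have e3 := abs_lt.1 (hg' _ (margX'Y_mem (hP k)) _ (margX'Y_mem hP₀) h3)
  unfold gamPenalty
  have k1 := le_max_left (g (margXY (P k))) (alpha g QX R (marg₂ (margXY (P k))))
  have k2 := le_max_right (g (margXY (P k))) (alpha g QX R (marg₂ (margXY (P k))))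
  have k3 := le_max_right 0 (max (g (margXY (P k))) (alpha g QX R (marg₂ (margXY (P k))))
    - g (margX'Y (P k)))
  have k4 := le_max_left 0 (max (g (margXY (P k))) (alpha g QX R (marg₂ (margXY (P k))))
    - g (margX'Y (P k)))
  refine max_le (by linarith) ?_
  rw [sub_le_iff_le_add]
  exact max_le (by linarith [e2.1, e3.2]) (by linarith [e2.1, e3.2])

lemma Psi_le_coe_iff {W : X → Y → ℝ} {QXX : X × X → ℝ} {E c : ℝ} :
    Psi W g QX R E QXX ≤ (c : EReal) ↔ Gam W g QX R QXX ≤ ((c - R + E : ℝ) : EReal) := by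
  unfold Psi
  induction Gam W g QX R QXX using EReal.rec with
  | bot => simp
  | coe x => norm_cast; constructor <;> intro h <;> linarith
  | top =>
    rw [EReal.top_add_coe, EReal.top_sub_coe, top_le_iff, top_le_iff]
    exact ⟨fun h => absurd h (EReal.coe_ne_top _), fun h => absurd h (EReal.coe_ne_top _)⟩

lemma Xi_le_coe_iff {W : X → Y → ℝ} {QXX : X × X → ℝ} {E c : ℝ} :
    Xi W g QX R E QXX ≤ (c : EReal) ↔ Lam W g QX R QXX ≤ ((c - R + E : ℝ) : EReal) := by
  unfold Xi
  induction Lam W g QX R QXX using EReal.rec with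
  | bot => simp
  | coe x => norm_cast; constructor <;> intro h <;> linarith
  | top =>
    rw [EReal.top_add_coe, EReal.top_sub_coe, top_le_iff, top_le_iff]
    exact ⟨fun h => absurd h (EReal.coe_ne_top _), fun h => absurd h (EReal.coe_ne_top _)⟩

/-- `EltUB` is right-continuous in its threshold, because the sets `setL` are compact and
decrease to `setL W g QX R E₀`. -/
lemma exists_le_of_lt_EltUB {W : X → Y → ℝ} (hg : ContinuousOn g (stdSimplex ℝ (X × Y)))
    (hQX : QX ∈ stdSimplex ℝ X) (hR : 0 < R) {E₀ t : ℝ} (ht : (t : EReal) < EltUB W g QX R E₀) :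
    ∃ δ > 0, ∀ Q ∈ setL W g QX R (E₀ + δ), t ≤ max 0 (mutualInfo Q - 2 * R) := by
  by_contra! hcon
  have hpos : ∀ k : ℕ, (0 : ℝ) < 1 / (k + 1) := fun k => by positivity
  have hex : ∀ k : ℕ, ∃ P ∈ stdSimplex ℝ (X × X × Y), margXX' P ∈ couplings QX QX ∧
      ChannelAC W (margXY P) ∧ max 0 (mutualInfo (margXX' P) - 2 * R) < t ∧
      transCost W P + gamPenalty g QX R P <
        max 0 (2 * R - mutualInfo (margXX' P)) - R + E₀ + 2 * (1 / (k + 1)) := by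
    intro k
    obtain ⟨Q, hQ, hlt⟩ := hcon _ (hpos k)
    have h1 := Psi_le_coe_iff.1 hQ.2
    have h2 := h1.trans_lt (EReal.coe_lt_coe_iff.2 (lt_add_of_pos_right _ (hpos k)))
    obtain ⟨P, hP, hac, hPlt⟩ := exists_of_Gam_lt h2
    refine ⟨P, hP.1, hP.2.symm ▸ hQ.1, hac, hP.2.symm ▸ hlt, ?_⟩
    rw [hP.2]; linarith
  choose P hP hPc hPac hPt hPlt using hex
  obtain ⟨P₀, hP₀, φ, hφ, hlim⟩ := (isCompact_stdSimplex ℝ (X × X × Y)).tendsto_subseq hP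
  have hc0 : margXX' P₀ ∈ couplings QX QX :=
    (isCompact_couplings QX QX).isClosed.mem_of_tendsto
      ((continuous_margXX'.tendsto P₀).comp hlim) (Eventually.of_forall fun k => hPc (φ k))
  have hac0 : ChannelAC W (margXY P₀) :=
    (isClosed_channelAC W).mem_of_tendsto
      ((continuous_margXY.tendsto P₀).comp hlim) (Eventually.of_forall fun k => hPac (φ k))
  have tI : Tendsto (fun k => mutualInfo (margXX' (P (φ k)))) atTop
      (𝓝 (mutualInfo (margXX' P₀))) := by
    have hcw := (continuousOn_mutualInfo (A := X) (B := X)) _ hc0.1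
    refine hcw.tendsto.comp (tendsto_nhdsWithin_iff.2 ⟨(continuous_margXX'.tendsto P₀).comp hlim,
      Eventually.of_forall fun k => (hPc (φ k)).1⟩)
  have hle : transCost W P₀ + gamPenalty g QX R P₀ ≤
      max 0 (2 * R - mutualInfo (margXX' P₀)) - R + E₀ := by
    refine le_of_forall_pos_le_add fun ε hε => ?_
    have t1 : Tendsto (fun k => max 0 (2 * R - mutualInfo (margXX' (P (φ k)))) - R + E₀ +
        2 * (1 / ((φ k : ℝ) + 1)) - transCost W (P (φ k)) + ε) atTop
        (𝓝 (max 0 (2 * R - mutualInfo (margXX' P₀)) - R + E₀ + 2 * 0 - transCost W P₀ + ε)) := by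
      refine Tendsto.add_const _ (Tendsto.sub (Tendsto.add (Tendsto.add_const _ (Tendsto.sub_const
        (Tendsto.max tendsto_const_nhds (Tendsto.sub tendsto_const_nhds tI)) _)) ?_) ?_)
      · exact (tendsto_one_div_add_atTop_nhds_zero_nat.comp hφ.tendsto_atTop).const_mul 2
      · exact ((continuous_transCost W).tendsto P₀).comp hlim
    have := ge_of_tendsto t1 (b := gamPenalty g QX R P₀) ?_
    · linarith
    · filter_upwards [gamPenalty_lsc hg hQX hR (fun k => hP (φ k)) hP₀ hlim hε] with k hk
      have := hPlt (φ k)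
      linarith
  have hmem : margXX' P₀ ∈ setL W g QX R E₀ := by
    refine ⟨hc0, Psi_le_coe_iff.2 ?_⟩
    exact (Gam_le_of_ac ⟨hP₀, rfl⟩ hac0).trans (EReal.coe_le_coe_iff.2 hle)
  have hmax : max 0 (mutualInfo (margXX' P₀) - 2 * R) ≤ t :=
    le_of_tendsto (Tendsto.max tendsto_const_nhds (tI.sub_const _))
      (Eventually.of_forall fun k => (hPt (φ k)).le)
  have : EltUB W g QX R E₀ ≤ (t : EReal) :=
    (iInf₂_le _ hmem).trans (EReal.coe_le_coe_iff.2 hmax)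
  exact absurd ht this.not_gt

end Stability

/-! ### The method of types -/

section Types

open scoped Classical in
/-- The sequences with the same empirical distribution as `s`. -/
noncomputable def typeOf {A : Type*} [Fintype A] [DecidableEq A] {n : ℕ} (s : Fin n → A) :
    Finset (Fin n → A) :=
  Finset.univ.filter fun s' => empirical s' = empirical s

variable {A B : Type*} [Fintype A] [Fintype B] [DecidableEq A] [DecidableEq B] {n : ℕ}

lemma mem_typeOf {s s' : Fin n → A} : s' ∈ typeOf s ↔ empirical s' = empirical s := by
  simp [typeOf]

lemma self_mem_typeOf (s : Fin n → A) : s ∈ typeOf s := mem_typeOf.2 rfl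

lemma card_typeOf_pos (s : Fin n → A) : 0 < (typeOf s).card :=
  Finset.card_pos.2 ⟨s, self_mem_typeOf s⟩

lemma empirical_eq_iff {s s' : Fin n → A} : empirical s = empirical s' ↔
    ∀ a, (Finset.univ.filter fun t => s t = a).card =
      (Finset.univ.filter fun t => s' t = a).card := by
  rw [funext_iff]
  refine forall_congr' fun a => ?_
  rcases Nat.eq_zero_or_pos n with h | h
  · subst h; simp [empirical]
  · have : (n : ℝ) ≠ 0 := by positivity
    rw [empirical, empirical, div_left_inj' this, Nat.cast_inj]

lemma empirical_comp_perm (s : Fin n → A) (σ : Equiv.Perm (Fin n)) :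
    empirical (s ∘ σ) = empirical s := by
  rw [empirical_eq_iff]
  intro a
  refine Finset.card_bij (fun t _ => σ t) (by simp) (by simp)
    fun t ht => ⟨σ.symm t, by simpa using ht, by simp⟩

lemma exists_perm_of_empirical_eq {s s' : Fin n → A} (h : empirical s' = empirical s) :
    ∃ σ : Equiv.Perm (Fin n), s' = s ∘ σ := by
  have e : ∀ a, {t // s' t = a} ≃ {t // s t = a} := fun a => by
    refine Fintype.equivOfCardEq ?_
    rw [Fintype.card_subtype, Fintype.card_subtype]
    exact empirical_eq_iff.1 h a
  refine ⟨(Equiv.sigmaFiberEquiv s').symm.trans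
    ((Equiv.sigmaCongrRight e).trans (Equiv.sigmaFiberEquiv s)), ?_⟩
  funext t
  simp only [Equiv.sigmaFiberEquiv]
  exact ((e (s' t) ⟨t, rfl⟩).2).symm

lemma sum_count (s : Fin n → A) :
    ∑ a, (Finset.univ.filter fun t => s t = a).card = n := by
  have := Finset.card_eq_sum_card_fiberwise (f := s) (s := Finset.univ) (t := Finset.univ) (by simp)
  simpa using this.symm

lemma empirical_mem (hn : 0 < n) (s : Fin n → A) : empirical s ∈ stdSimplex ℝ A := by
  refine ⟨fun a => by unfold empirical; positivity, ?_⟩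
  have h := sum_count s
  simp only [empirical, ← Finset.sum_div]
  rw [← Nat.cast_sum, h, div_self (by positivity)]

/-- The type class of `s` has the multinomial cardinality, by the orbit-stabilizer theorem for
the permutations of the positions. -/
lemma card_typeOf_mul (s : Fin n → A) :
    (typeOf s).card * ∏ a, (Finset.univ.filter fun t => s t = a).card.factorial =
      n.factorial := by
  have h1 : Fintype.card (Equiv.Perm (Fin n)) = n.factorial := by
    rw [Fintype.card_perm, Fintype.card_fin]
  have h2 := Finset.card_eq_sum_card_fiberwise (f := fun σ : Equiv.Perm (Fin n) => s ∘ σ)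
    (s := Finset.univ) (t := typeOf s)
    (fun σ _ => by simpa using mem_typeOf.2 (empirical_comp_perm s σ))
  rw [Finset.card_univ, h1] at h2
  rw [h2, ← smul_eq_mul, ← Finset.sum_const]
  refine Finset.sum_congr rfl fun s' hs' => ?_
  obtain ⟨σ₀, rfl⟩ := exists_perm_of_empirical_eq (mem_typeOf.1 hs')
  have h3 := DomMulAct.stabilizer_card s
  simp only [Fintype.card_subtype] at h3
  rw [← h3]
  refine Finset.card_bij (fun τ _ => σ₀.trans τ) ?_ ?_ ?_
  · intro τ hτ
    simp only [Finset.mem_filter, Finset.mem_univ, true_and] at hτ ⊢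
    funext t
    exact congrFun hτ (σ₀ t)
  · intro τ _ τ' _ h
    ext t
    have := Equiv.congr_fun h (σ₀.symm t)
    simpa using congrArg Fin.val this
  · intro τ hτ
    refine ⟨σ₀.symm.trans τ, ?_, by ext; simp⟩
    simp only [Finset.mem_filter, Finset.mem_univ, true_and] at hτ ⊢
    funext t
    simpa using congrFun hτ (σ₀.symm t)

lemma le_log_factorial (k : ℕ) : (k : ℝ) * Real.log k - k ≤ Real.log k.factorial := by
  rcases Nat.eq_zero_or_pos k with rfl | hk
  · simp
  have hk' : (0 : ℝ) < k := by exact_mod_cast hk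
  have h := Real.pow_div_factorial_le_exp (k : ℝ) hk'.le k
  have hf : (0 : ℝ) < k.factorial := by exact_mod_cast k.factorial_pos
  have := Real.log_le_log (by positivity) h
  rw [Real.log_exp, Real.log_div (by positivity) hf.ne', Real.log_pow] at this
  linarith

lemma log_factorial_le (k : ℕ) :
    Real.log k.factorial ≤ (k : ℝ) * Real.log k - k + (1 + Real.log (k + 1)) := by
  suffices h : ∀ k : ℕ, Real.log (k + 1).factorial ≤
      ((k + 1 : ℕ) : ℝ) * Real.log (k + 1 : ℕ) - (k + 1 : ℕ) + (1 + Real.log (k + 1 : ℕ)) by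
    rcases k with _ | k
    · simp
    · refine (h k).trans (by gcongr; simp)
  intro k
  induction k with
  | zero => simp
  | succ k ih =>
    rw [Nat.factorial_succ, Nat.cast_mul, Real.log_mul (by positivity)
      (by exact_mod_cast (Nat.factorial_pos _).ne')]
    have h1 : (0 : ℝ) < (k + 1 : ℕ) := by positivity
    have h2 : (0 : ℝ) < (k + 1 + 1 : ℕ) := by positivity
    have h3 := Real.one_sub_inv_le_log_of_pos (div_pos h2 h1)
    rw [Real.log_div h2.ne' h1.ne', inv_div] at h3
    have h4 : 1 - ((k + 1 : ℕ) : ℝ) / (k + 1 + 1 : ℕ) = 1 / (k + 1 + 1 : ℕ) := by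
      push_cast; field_simp; ring
    rw [h4] at h3
    have h5 := mul_le_mul_of_nonneg_left h3 h2.le
    rw [mul_one_div_cancel h2.ne'] at h5
    push_cast at *
    nlinarith

/-- The subexponential factor by which the size of a type class may miss the exponential of the
entropy. -/
noncomputable def typeSlack (A : Type*) [Fintype A] (n : ℕ) : ℝ :=
  (Fintype.card A + 1) * (1 + Real.log (n + 1))

lemma abs_log_card_typeOf_sub_le (hn : 0 < n) (s : Fin n → A) :
    |Real.log (typeOf s).card - n * ent (empirical s)| ≤ typeSlack A n := by
  have hn' : (0 : ℝ) < n := by exact_mod_cast hn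
  set k : A → ℕ := fun a => (Finset.univ.filter fun t => s t = a).card with hk
  have hkn : ∀ a, k a ≤ n := fun a => by
    simpa using Finset.card_le_univ (Finset.univ.filter fun t => s t = a)
  have hsum : ∑ a, (k a : ℝ) = n := by exact_mod_cast sum_count s
  have hlog : Real.log (typeOf s).card = Real.log n.factorial -
      ∑ a, Real.log (k a).factorial := by
    rw [← card_typeOf_mul s, Nat.cast_mul, Real.log_mul, Nat.cast_prod, Real.log_prod]
    · ring
    · exact fun a _ => by exact_mod_cast (Nat.factorial_pos _).ne'
    · exact_mod_cast (card_typeOf_pos s).ne'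
    · exact_mod_cast (Finset.prod_pos fun a _ => Nat.factorial_pos _).ne'
  have hent : n * ent (empirical s) = n * Real.log n - ∑ a, (k a : ℝ) * Real.log (k a) := by
    rw [ent, Finset.mul_sum, ← hsum, Finset.sum_mul, ← Finset.sum_sub_distrib, hsum]
    refine Finset.sum_congr rfl fun a _ => ?_
    change (n : ℝ) * Real.negMulLog ((k a : ℝ) / n) = _
    rcases Nat.eq_zero_or_pos (k a) with h | h
    · simp [h]
    · have : (0 : ℝ) < k a := by exact_mod_cast h
      rw [Real.negMulLog, Real.log_div this.ne' hn'.ne']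
      field_simp
      ring
  have hc0 : 0 ≤ 1 + Real.log ((n : ℝ) + 1) :=
    add_nonneg zero_le_one (Real.log_nonneg (by linarith))
  have hl : ∑ a, ((k a : ℝ) * Real.log (k a) - k a) ≤ ∑ a, Real.log (k a).factorial :=
    Finset.sum_le_sum fun a _ => le_log_factorial _
  have hu : ∑ a, Real.log (k a).factorial ≤
      ∑ a, ((k a : ℝ) * Real.log (k a) - k a + (1 + Real.log (n + 1))) := by
    refine Finset.sum_le_sum fun a _ => (log_factorial_le _).trans ?_
    have := Real.log_le_log (by positivity) (by exact_mod_cast Nat.succ_le_succ (hkn a) :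
      ((k a : ℝ) + 1) ≤ n + 1)
    linarith
  simp only [Finset.sum_add_distrib, Finset.sum_sub_distrib, hsum, Finset.sum_const,
    Finset.card_univ, nsmul_eq_mul] at hl hu
  have h1 := le_log_factorial n
  have h2 := log_factorial_le n
  have hA : (0 : ℝ) ≤ Fintype.card A := by positivity
  rw [hlog, hent, typeSlack, abs_le]
  constructor <;> nlinarith

lemma eventually_typeSlack_le (A : Type*) [Fintype A] {ε : ℝ} (hε : 0 < ε) :
    ∀ᶠ n : ℕ in atTop, typeSlack A n ≤ ε * n := by
  have h1 : Tendsto (fun n : ℕ => Real.log ((n : ℝ) + 1) / ((n : ℝ) + 1)) atTop (𝓝 0) := by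
    have h := Real.isLittleO_log_id_atTop.tendsto_div_nhds_zero
    exact h.comp (tendsto_atTop_add_const_right _ 1 tendsto_natCast_atTop_atTop)
  have h2 : Tendsto (fun n : ℕ => 1 / ((n : ℝ) + 1)) atTop (𝓝 0) :=
    tendsto_one_div_add_atTop_nhds_zero_nat
  have h3 := ((h2.add h1).const_mul ((Fintype.card A : ℝ) + 1))
  rw [add_zero, mul_zero] at h3
  filter_upwards [h3.eventually (gt_mem_nhds (half_pos hε)), eventually_ge_atTop 1] with n hn hn1
  have hn1' : (1 : ℝ) ≤ n := by exact_mod_cast hn1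
  have e : typeSlack A n = ((Fintype.card A : ℝ) + 1) *
      (1 / ((n : ℝ) + 1) + Real.log ((n : ℝ) + 1) / ((n : ℝ) + 1)) * (n + 1) := by
    unfold typeSlack; field_simp
  rw [e]
  nlinarith

lemma eventually_abs_log_card_typeOf (A : Type*) [Fintype A] [DecidableEq A] {ε : ℝ}
    (hε : 0 < ε) : ∀ᶠ n : ℕ in atTop, ∀ s : Fin n → A,
      |Real.log (typeOf s).card - n * ent (empirical s)| ≤ ε * n := by
  filter_upwards [eventually_typeSlack_le A hε, eventually_gt_atTop 0] with n hn hn0 s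
  exact (abs_log_card_typeOf_sub_le hn0 s).trans hn

lemma marg₁_jointEmpirical (x : Fin n → A) (y : Fin n → B) :
    marg₁ (jointEmpirical x y) = empirical x := by
  funext a
  simp only [marg₁, jointEmpirical, empirical, ← Finset.sum_div]
  rw [← Nat.cast_sum, Finset.card_eq_sum_card_fiberwise (f := y) (t := Finset.univ) (by simp)]
  simp only [Finset.filter_filter, Prod.mk.injEq]

lemma marg₂_jointEmpirical (x : Fin n → A) (y : Fin n → B) :
    marg₂ (jointEmpirical x y) = empirical y := by
  funext b
  simp only [marg₂, jointEmpirical, empirical, ← Finset.sum_div]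
  rw [← Nat.cast_sum, Finset.card_eq_sum_card_fiberwise (f := x) (t := Finset.univ) (by simp)]
  simp only [Finset.filter_filter, Prod.mk.injEq, and_comm]

lemma jointEmpirical_mem (hn : 0 < n) (x : Fin n → A) (y : Fin n → B) :
    jointEmpirical x y ∈ stdSimplex ℝ (A × B) := empirical_mem hn _

lemma jointEmpirical_mem_couplings (hn : 0 < n) (x : Fin n → A) (y : Fin n → B) :
    jointEmpirical x y ∈ couplings (empirical x) (empirical y) :=
  ⟨jointEmpirical_mem hn x y, marg₁_jointEmpirical x y, marg₂_jointEmpirical x y⟩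

open scoped Classical in
/-- All sequences `y` of a given type see the same number of sequences `x` in a given joint type
with them. -/
lemma card_filter_jointEmpirical_mul (x₀ : Fin n → A) (y₀ : Fin n → B) :
    (Finset.univ.filter fun x => jointEmpirical x y₀ = jointEmpirical x₀ y₀).card *
      (typeOf y₀).card = (typeOf fun t => (x₀ t, y₀ t)).card := by
  rw [Finset.card_eq_sum_card_fiberwise (f := fun s : Fin n → A × B => fun t => (s t).2)
    (t := typeOf y₀), mul_comm, ← smul_eq_mul, ← Finset.sum_const]
  · refine Finset.sum_congr rfl fun y hy => ?_
    obtain ⟨σ, rfl⟩ := exists_perm_of_empirical_eq (mem_typeOf.1 hy)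
    refine Finset.card_bij (fun x _ t => (x (σ t), y₀ (σ t))) ?_ ?_ ?_
    · intro x hx
      simp only [Finset.mem_filter, Finset.mem_univ, true_and, mem_typeOf] at hx ⊢
      refine ⟨?_, rfl⟩
      rw [← show _ = empirical fun t => (x₀ t, y₀ t) from hx]
      exact empirical_comp_perm (fun t => (x t, y₀ t)) σ
    · intro x _ x' _ h
      funext t
      have := congrFun h (σ.symm t)
      simpa using this
    · intro s hs
      simp only [Finset.mem_filter, mem_typeOf] at hs
      have hs2 : ∀ t, (s t).2 = y₀ (σ t) := fun t => congrFun hs.2 t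
      refine ⟨fun t => (s (σ.symm t)).1, ?_, ?_⟩
      · simp only [Finset.mem_filter, Finset.mem_univ, true_and]
        change empirical _ = empirical _
        rw [← hs.1, ← empirical_comp_perm s σ.symm]
        congr 1
        funext t
        simp [Prod.ext_iff, hs2]
      · funext t
        simp [Prod.ext_iff, hs2]
  · intro s hs
    have hs' := mem_typeOf.1 (Finset.mem_coe.1 hs)
    refine Finset.mem_coe.2 (mem_typeOf.2 ?_)
    have h1 := marg₂_jointEmpirical (fun t => (s t).1) (fun t => (s t).2)
    have h2 := marg₂_jointEmpirical x₀ y₀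
    rw [← h1, ← h2]
    exact congrArg marg₂ hs'

open scoped Classical in
/-- The size of a conditional type class is, to first order in the exponent, the exponential of
the conditional entropy. -/
lemma eventually_abs_log_card_cond (A B : Type*) [Fintype A] [Fintype B] [DecidableEq A]
    [DecidableEq B] {ε : ℝ} (hε : 0 < ε) : ∀ᶠ n : ℕ in atTop,
      ∀ (x₀ : Fin n → A) (y₀ : Fin n → B),
      |Real.log (Finset.univ.filter fun x => jointEmpirical x y₀ = jointEmpirical x₀ y₀).card -
        n * (ent (jointEmpirical x₀ y₀) - ent (empirical y₀))| ≤ ε * n := by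
  filter_upwards [eventually_abs_log_card_typeOf (A × B) (half_pos hε),
    eventually_abs_log_card_typeOf B (half_pos hε)] with n h1 h2 x₀ y₀
  have h := card_filter_jointEmpirical_mul x₀ y₀
  have hpos : 0 < (Finset.univ.filter fun x => jointEmpirical x y₀ = jointEmpirical x₀ y₀).card :=
    Finset.card_pos.2 ⟨x₀, by simp⟩
  have hlog : Real.log (typeOf fun t => (x₀ t, y₀ t)).card =
      Real.log (Finset.univ.filter fun x => jointEmpirical x y₀ = jointEmpirical x₀ y₀).card +
        Real.log (typeOf y₀).card := by
    rw [← h, Nat.cast_mul, Real.log_mul (by exact_mod_cast hpos.ne')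
      (by exact_mod_cast (card_typeOf_pos y₀).ne')]
  have e1 := abs_le.1 (h1 fun t => (x₀ t, y₀ t))
  have e2 := abs_le.1 (h2 y₀)
  rw [hlog] at e1
  change _ ≤ _ - n * ent (jointEmpirical x₀ y₀) ∧ _ - n * ent (jointEmpirical x₀ y₀) ≤ _ at e1
  rw [abs_le]
  constructor <;> linarith [e1.1, e1.2, e2.1, e2.2]

open scoped Classical in
/-- The finitely many empirical distributions of sequences of length `n`. -/
noncomputable def allTypes (A : Type*) [Fintype A] [DecidableEq A] (n : ℕ) : Finset (A → ℝ) :=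
  Finset.univ.image (empirical : (Fin n → A) → A → ℝ)

lemma empirical_mem_allTypes (s : Fin n → A) : empirical s ∈ allTypes A n := by
  simp [allTypes]

lemma mem_allTypes {P : A → ℝ} : P ∈ allTypes A n ↔ ∃ s : Fin n → A, empirical s = P := by
  simp [allTypes]

lemma card_allTypes_le (A : Type*) [Fintype A] [DecidableEq A] (n : ℕ) :
    (allTypes A n).card ≤ (n + 1) ^ Fintype.card A := by
  classical
  have : allTypes A n ⊆ Finset.univ.image
      (fun k : A → Fin (n + 1) => fun a => ((k a : ℕ) : ℝ) / n) := by
    intro P hP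
    obtain ⟨s, rfl⟩ := mem_allTypes.1 hP
    refine Finset.mem_image.2 ⟨fun a => ⟨(Finset.univ.filter fun t => s t = a).card, ?_⟩,
      Finset.mem_univ _, rfl⟩
    exact Nat.lt_succ_of_le
      (by simpa using Finset.card_le_univ (Finset.univ.filter fun t => s t = a))
  refine (Finset.card_le_card this).trans (Finset.card_image_le.trans ?_)
  simp

lemma eventually_card_allTypes_le (A : Type*) [Fintype A] [DecidableEq A] {ε : ℝ} (hε : 0 < ε) :
    ∀ᶠ n : ℕ in atTop, ((allTypes A n).card : ℝ) ≤ Real.exp (ε * n) := by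
  filter_upwards [eventually_typeSlack_le A hε] with n hn
  refine le_trans ?_ (Real.exp_le_exp.2 hn)
  have h1 : ((allTypes A n).card : ℝ) ≤ ((n : ℝ) + 1) ^ Fintype.card A := by
    exact_mod_cast card_allTypes_le A n
  refine h1.trans ?_
  have hn0 : (0 : ℝ) < (n : ℝ) + 1 := by positivity
  rw [← Real.exp_log (pow_pos hn0 _), Real.log_pow, Real.exp_le_exp, typeSlack]
  have : 0 ≤ Real.log ((n : ℝ) + 1) := Real.log_nonneg (by linarith [n.cast_nonneg (α := ℝ)])
  nlinarith [(Fintype.card A).cast_nonneg (α := ℝ)]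

/-- Averages over positions are expectations under the empirical distribution. -/
lemma sum_comp_eq_mul_sum_empirical (s : Fin n → A) (f : A → ℝ) :
    ∑ t, f (s t) = n * ∑ a, empirical s a * f a := by
  rcases Nat.eq_zero_or_pos n with h | h
  · subst h; simp
  have hn' : (n : ℝ) ≠ 0 := by positivity
  rw [← Finset.sum_fiberwise Finset.univ s, Finset.mul_sum]
  refine Finset.sum_congr rfl fun a _ => ?_
  rw [Finset.sum_congr rfl (g := fun _ => f a) (fun t ht => by rw [(Finset.mem_filter.1 ht).2]),
    Finset.sum_const, nsmul_eq_mul, empirical]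
  field_simp

lemma prod_channel_eq_exp {W : A → B → ℝ} (hW : ∀ a b, 0 ≤ W a b) (x : Fin n → A) (y : Fin n → B)
    (hac : ChannelAC W (jointEmpirical x y)) (hn : 0 < n) :
    ∏ t, W (x t) (y t) =
      Real.exp (n * ∑ a, ∑ b, jointEmpirical x y (a, b) * Real.log (W a b)) := by
  have hpos : ∀ t, 0 < W (x t) (y t) := fun t => by
    refine lt_of_le_of_ne (hW _ _) fun h => ?_
    have h0 := hac _ _ h.symm
    have hn' : (n : ℝ) ≠ 0 := by positivity
    rw [jointEmpirical, empirical, div_eq_zero_iff, or_iff_left hn', Nat.cast_eq_zero,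
      Finset.card_eq_zero] at h0
    exact Finset.filter_eq_empty_iff.1 h0 (Finset.mem_univ t) rfl
  rw [← Real.exp_log (Finset.prod_pos fun t _ => hpos t), Real.log_prod fun t _ => (hpos t).ne']
  congr 1
  rw [← Fintype.sum_prod_type' (f := fun a b => jointEmpirical x y (a, b) * Real.log (W a b))]
  exact sum_comp_eq_mul_sum_empirical (fun t => (x t, y t)) fun p => Real.log (W p.1 p.2)

lemma prod_channel_eq_zero {W : A → B → ℝ} {x : Fin n → A} {y : Fin n → B}
    (hac : ¬ ChannelAC W (jointEmpirical x y)) : ∏ t, W (x t) (y t) = 0 := by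
  simp only [ChannelAC, not_forall] at hac
  obtain ⟨a, b, h0, h⟩ := hac
  by_contra hne
  rw [Finset.prod_eq_zero_iff] at hne
  push Not at hne
  refine h ?_
  rw [jointEmpirical, empirical, Finset.card_eq_zero.2, Nat.cast_zero, zero_div]
  refine Finset.filter_eq_empty_iff.2 fun t ht heq => hne t ht ?_
  obtain ⟨h1, h2⟩ := Prod.mk.inj heq
  rw [h1, h2, h0]

end Types

/-! ### Rounding distributions to empirical distributions -/

section Rounding

variable {A B S X Y : Type*} [Fintype A] [Fintype B] [Fintype S] [DecidableEq A] [DecidableEq B]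
  [DecidableEq S] [Fintype X] [Fintype Y] [DecidableEq X] [DecidableEq Y]

lemma exists_nat_matrix_of_marginals (r : A → ℕ) (c : B → ℕ) (h : ∑ a, r a = ∑ b, c b) :
    ∃ K : A → B → ℕ, (∀ a, ∑ b, K a b = r a) ∧ ∀ b, ∑ a, K a b = c b := by
  have hcard : Fintype.card (Σ a, Fin (r a)) = Fintype.card (Σ b, Fin (c b)) := by simpa using h
  obtain ⟨e⟩ := Fintype.card_eq.1 hcard
  refine ⟨fun a b => (Finset.univ.filter fun i : Fin (r a) => (e ⟨a, i⟩).1 = b).card, ?_, ?_⟩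
  · intro a
    rw [← Finset.card_eq_sum_card_fiberwise (f := fun i : Fin (r a) => (e ⟨a, i⟩).1)
      (t := Finset.univ) (by simp)]
    simp
  · intro b
    have h1 : (Finset.univ.filter fun p : Σ a, Fin (r a) => (e p).1 = b).card = c b := by
      have h2 : (Finset.univ.filter fun p : Σ a, Fin (r a) => (e p).1 = b).card =
          (Finset.univ.filter fun q : Σ b, Fin (c b) => q.1 = b).card :=
        Finset.card_bij (fun p _ => e p) (by simp) (by simp)
          fun q hq => ⟨e.symm q, by simpa using hq, by simp⟩
      rw [h2]
      simp only [Finset.card_filter, Fintype.sum_sigma]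
      simp [apply_ite Finset.card]
    rw [← h1]
    simp only [Finset.card_filter, Fintype.sum_sigma]

/-- Rounding with prescribed marginals. A nonnegative function on `S` whose pushforwards under
`π₁` and `π₂` are integral is within `card S` of an integer-valued one with the same pushforwards.
The defects left by rounding down are placed on the chosen points `sec a b`, so that the support
grows by these points only. -/
lemma exists_nat_rounding (π₁ : S → A) (π₂ : S → B) (sec : A → B → S)
    (h₁ : ∀ a b, π₁ (sec a b) = a) (h₂ : ∀ a b, π₂ (sec a b) = b) (P : S → ℝ) (hP : ∀ s, 0 ≤ P s)
    (r : A → ℕ) (c : B → ℕ) (hr : ∀ a, ∑ s with π₁ s = a, P s = r a)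
    (hc : ∀ b, ∑ s with π₂ s = b, P s = c b) :
    ∃ K : S → ℕ, (∀ a, ∑ s with π₁ s = a, K s = r a) ∧ (∀ b, ∑ s with π₂ s = b, K s = c b) ∧
      (∀ s, |(K s : ℝ) - P s| ≤ Fintype.card S) ∧
      ∀ s, K s ≠ 0 → 0 < P s ∨ ∃ a b, s = sec a b := by
  set F : S → ℕ := fun s => ⌊P s⌋₊ with hF
  have hFP : ∀ s, (F s : ℝ) ≤ P s := fun s => Nat.floor_le (hP s)
  have hPF : ∀ s, P s < F s + 1 := fun s => Nat.lt_floor_add_one _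
  have hFr : ∀ a, ∑ s with π₁ s = a, F s ≤ r a := fun a => by
    have : ((∑ s with π₁ s = a, F s : ℕ) : ℝ) ≤ r a := by
      rw [← hr a]; push_cast; exact Finset.sum_le_sum fun s _ => hFP s
    exact_mod_cast this
  have hFc : ∀ b, ∑ s with π₂ s = b, F s ≤ c b := fun b => by
    have : ((∑ s with π₂ s = b, F s : ℕ) : ℝ) ≤ c b := by
      rw [← hc b]; push_cast; exact Finset.sum_le_sum fun s _ => hFP s
    exact_mod_cast this
  have hrc : ∑ a, r a = ∑ b, c b := by
    have : ((∑ a, r a : ℕ) : ℝ) = ((∑ b, c b : ℕ) : ℝ) := by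
      push_cast
      simp only [← hr, ← hc]
      rw [Finset.sum_fiberwise, Finset.sum_fiberwise]
    exact_mod_cast this
  obtain ⟨D, hD₁, hD₂⟩ := exists_nat_matrix_of_marginals
    (fun a => r a - ∑ s with π₁ s = a, F s) (fun b => c b - ∑ s with π₂ s = b, F s) (by
      have e1 : ∑ a, (r a - ∑ s with π₁ s = a, F s) + ∑ s, F s = ∑ a, r a := by
        rw [← Finset.sum_fiberwise Finset.univ π₁ F, ← Finset.sum_add_distrib]
        exact Finset.sum_congr rfl fun a _ => Nat.sub_add_cancel (hFr a)
      have e2 : ∑ b, (c b - ∑ s with π₂ s = b, F s) + ∑ s, F s = ∑ b, c b := by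
        rw [← Finset.sum_fiberwise Finset.univ π₂ F, ← Finset.sum_add_distrib]
        exact Finset.sum_congr rfl fun a _ => Nat.sub_add_cancel (hFc a)
      omega)
  set G : S → ℕ := fun s => if sec (π₁ s) (π₂ s) = s then D (π₁ s) (π₂ s) else 0 with hG
  have hG₁ : ∀ a, ∑ s with π₁ s = a, G s = r a - ∑ s with π₁ s = a, F s := by
    intro a
    rw [← hD₁ a, hG, ← Finset.sum_filter, Finset.filter_filter]
    refine Finset.sum_bij' (fun s _ => π₂ s) (fun b _ => sec a b) ?_ ?_ ?_ ?_ ?_ <;>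
      simp +contextual [h₁, h₂]
  have hG₂ : ∀ b, ∑ s with π₂ s = b, G s = c b - ∑ s with π₂ s = b, F s := by
    intro b
    rw [← hD₂ b, hG, ← Finset.sum_filter, Finset.filter_filter]
    refine Finset.sum_bij' (fun s _ => π₁ s) (fun a _ => sec a b) ?_ ?_ ?_ ?_ ?_ <;>
      simp +contextual [h₁, h₂]
  refine ⟨fun s => F s + G s, ?_, ?_, ?_, ?_⟩
  · intro a
    rw [Finset.sum_add_distrib, hG₁]; exact Nat.add_sub_cancel' (hFr a)
  · intro b
    rw [Finset.sum_add_distrib, hG₂]; exact Nat.add_sub_cancel' (hFc b)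
  · intro s
    have hS : (1 : ℝ) ≤ Fintype.card S := by
      exact_mod_cast Fintype.card_pos_iff.2 ⟨s⟩
    have hGs : (G s : ℝ) ≤ Fintype.card S := by
      have e1 : G s ≤ ∑ s' with π₁ s' = π₁ s, G s' :=
        Finset.single_le_sum (f := G) (fun _ _ => Nat.zero_le _) (by simp)
      have e2 : ((∑ s' with π₁ s' = π₁ s, G s' : ℕ) : ℝ) =
          ∑ s' with π₁ s' = π₁ s, (P s' - F s') := by
        rw [hG₁, Nat.cast_sub (hFr _), Finset.sum_sub_distrib, hr]; push_cast; rfl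
      have e3 : ∑ s' with π₁ s' = π₁ s, (P s' - F s') ≤ Fintype.card S := by
        refine (Finset.sum_le_sum (g := fun _ => (1 : ℝ))
          fun s' _ => by linarith [hPF s']).trans ?_
        simp only [Finset.sum_const, nsmul_eq_mul, mul_one, Nat.cast_le]
        exact Finset.card_le_univ _
      calc (G s : ℝ) ≤ ((∑ s' with π₁ s' = π₁ s, G s' : ℕ) : ℝ) := by exact_mod_cast e1
        _ ≤ _ := e2.trans_le e3
    have hG0 : (0 : ℝ) ≤ G s := by positivity
    push_cast
    rw [abs_le]
    constructor <;> linarith [hFP s, hPF s]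
  · intro s hs
    by_cases hF0 : F s = 0
    · right
      refine ⟨π₁ s, π₂ s, ?_⟩
      by_contra hne
      exact hs (by simp only [hF0, hG, zero_add]; rw [if_neg fun h => hne h.symm])
    · left
      exact lt_of_lt_of_le (by exact_mod_cast Nat.pos_of_ne_zero hF0) (hFP s)

lemma exists_seq_of_counts {n : ℕ} (K : S → ℕ) (hK : ∑ s, K s = n) :
    ∃ u : Fin n → S, ∀ s, (Finset.univ.filter fun t => u t = s).card = K s := by
  have hcard : Fintype.card (Fin n) = Fintype.card (Σ s, Fin (K s)) := by simp [hK]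
  obtain ⟨e⟩ := Fintype.card_eq.1 hcard
  refine ⟨fun t => (e t).1, fun s => ?_⟩
  have h2 : (Finset.univ.filter fun t => (e t).1 = s).card =
      (Finset.univ.filter fun q : Σ s, Fin (K s) => q.1 = s).card :=
    Finset.card_bij (fun p _ => e p) (by simp) (by simp)
      fun q hq => ⟨e.symm q, by simpa using hq, by simp⟩
  rw [h2]
  simp only [Finset.card_filter, Fintype.sum_sigma]
  simp [apply_ite Finset.card]

/-- A distribution on `S` whose pushforwards under `π₁` and `π₂` are empirical distributions of
sequences of length `n` is within `card S / n` of an empirical distribution of a sequence that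
maps to sequences of the same types. -/
lemma exists_seq_dist_le {n : ℕ} (hn : 0 < n) (π₁ : S → A) (π₂ : S → B) (sec : A → B → S)
    (h₁ : ∀ a b, π₁ (sec a b) = a) (h₂ : ∀ a b, π₂ (sec a b) = b) {P : S → ℝ}
    (hP : ∀ s, 0 ≤ P s) (x : Fin n → A) (x' : Fin n → B)
    (hr : ∀ a, ∑ s with π₁ s = a, P s = empirical x a)
    (hc : ∀ b, ∑ s with π₂ s = b, P s = empirical x' b) :
    ∃ u : Fin n → S, empirical (π₁ ∘ u) = empirical x ∧ empirical (π₂ ∘ u) = empirical x' ∧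
      dist (empirical u) P ≤ Fintype.card S / n ∧
      ∀ t, 0 < P (u t) ∨ ∃ a b, u t = sec a b := by
  have hn' : (0 : ℝ) < n := by exact_mod_cast hn
  obtain ⟨K, hK₁, hK₂, hKP, hKs⟩ := exists_nat_rounding π₁ π₂ sec h₁ h₂ (fun s => n * P s)
    (fun s => mul_nonneg hn'.le (hP s)) (fun a => (Finset.univ.filter fun t => x t = a).card)
    (fun b => (Finset.univ.filter fun t => x' t = b).card)
    (fun a => by rw [← Finset.mul_sum, hr, empirical]; field_simp)
    (fun b => by rw [← Finset.mul_sum, hc, empirical]; field_simp)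
  obtain ⟨u, hu⟩ := exists_seq_of_counts (n := n) K (by
    rw [← Finset.sum_fiberwise Finset.univ π₁ K, ← sum_count x]
    exact Finset.sum_congr rfl fun a _ => hK₁ a)
  refine ⟨u, ?_, ?_, ?_, ?_⟩
  · rw [empirical_eq_iff]
    intro a
    rw [← hK₁ a, Finset.card_eq_sum_card_fiberwise (f := u)
      (t := Finset.univ.filter fun s => π₁ s = a) (by intro t ht; simpa using ht)]
    refine Finset.sum_congr rfl fun s hs => ?_
    rw [← hu s, Finset.filter_filter]
    congr 1
    ext t
    simp only [Finset.mem_filter, Finset.mem_univ, true_and, Function.comp_apply] at hs ⊢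
    exact ⟨fun h => h.2, fun h => ⟨h ▸ hs, h⟩⟩
  · rw [empirical_eq_iff]
    intro a
    rw [← hK₂ a, Finset.card_eq_sum_card_fiberwise (f := u)
      (t := Finset.univ.filter fun s => π₂ s = a) (by intro t ht; simpa using ht)]
    refine Finset.sum_congr rfl fun s hs => ?_
    rw [← hu s, Finset.filter_filter]
    congr 1
    ext t
    simp only [Finset.mem_filter, Finset.mem_univ, true_and, Function.comp_apply] at hs ⊢
    exact ⟨fun h => h.2, fun h => ⟨h ▸ hs, h⟩⟩
  · refine (dist_pi_le_iff (by positivity)).2 fun s => ?_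
    rw [Real.dist_eq, empirical, hu, le_div_iff₀ hn']
    have := hKP s
    have e : ((K s : ℝ) / n - P s) = (K s - n * P s) / n := by field_simp
    rw [e, abs_div, abs_of_pos hn', div_mul_cancel₀ _ hn'.ne']
    exact this
  · intro t
    rcases hKs (u t) (by
      rw [← hu]
      exact Finset.card_ne_zero.2 ⟨t, by simp⟩) with h | h
    · exact Or.inl (pos_of_mul_pos_right h hn'.le)
    · exact Or.inr h

/-- Couplings of two empirical distributions are approximated by joint empirical distributions,
where the second sequence may be prescribed. -/
lemma exists_jointEmpirical_dist_le {n : ℕ} (hn : 0 < n) (x₀ : Fin n → A) (y : Fin n → B)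
    {Q : A × B → ℝ} (hQ : Q ∈ couplings (empirical x₀) (empirical y)) :
    ∃ x : Fin n → A, empirical x = empirical x₀ ∧
      dist (jointEmpirical x y) Q ≤ Fintype.card (A × B) / n := by
  obtain ⟨u, hu₁, hu₂, hd, -⟩ := exists_seq_dist_le hn Prod.fst Prod.snd (fun a b => (a, b))
    (fun _ _ => rfl) (fun _ _ => rfl) hQ.1.1 x₀ y
    (fun a => by
      rw [← hQ.2.1, marg₁, Finset.sum_filter, Fintype.sum_prod_type, Finset.sum_comm]
      simp)
    (fun b => by
      rw [← hQ.2.2, marg₂, Finset.sum_filter, Fintype.sum_prod_type]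
      simp)
  obtain ⟨σ, hσ⟩ := exists_perm_of_empirical_eq hu₂.symm
  refine ⟨Prod.fst ∘ u ∘ σ, ?_, ?_⟩
  · rw [← hu₁]; exact empirical_comp_perm (Prod.fst ∘ u) σ
  · have e : jointEmpirical (Prod.fst ∘ u ∘ σ) y = empirical u := by
      rw [hσ]; exact empirical_comp_perm u σ
    rw [e]; exact hd

/-- The joint empirical distribution of three sequences. -/
noncomputable def tripleEmpirical {n : ℕ} (x x' : Fin n → X) (y : Fin n → Y) : X × X × Y → ℝ :=
  empirical fun t => (x t, x' t, y t)

lemma margXX'_tripleEmpirical {n : ℕ} (x x' : Fin n → X) (y : Fin n → Y) :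
    margXX' (tripleEmpirical x x' y) = jointEmpirical x x' := by
  funext p
  simp only [margXX', tripleEmpirical, jointEmpirical, empirical, ← Finset.sum_div]
  rw [← Nat.cast_sum, Finset.card_eq_sum_card_fiberwise (f := y) (t := Finset.univ) (by simp)]
  simp only [Finset.filter_filter, Prod.ext_iff, and_assoc]

lemma margXY_tripleEmpirical {n : ℕ} (x x' : Fin n → X) (y : Fin n → Y) :
    margXY (tripleEmpirical x x' y) = jointEmpirical x y := by
  funext p
  simp only [margXY, tripleEmpirical, jointEmpirical, empirical, ← Finset.sum_div]
  rw [← Nat.cast_sum, Finset.card_eq_sum_card_fiberwise (f := x') (t := Finset.univ) (by simp)]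
  simp only [Finset.filter_filter, Prod.ext_iff, and_comm, and_left_comm]

lemma margX'Y_tripleEmpirical {n : ℕ} (x x' : Fin n → X) (y : Fin n → Y) :
    margX'Y (tripleEmpirical x x' y) = jointEmpirical x' y := by
  funext p
  simp only [margX'Y, tripleEmpirical, jointEmpirical, empirical, ← Finset.sum_div]
  rw [← Nat.cast_sum, Finset.card_eq_sum_card_fiberwise (f := x) (t := Finset.univ) (by simp)]
  simp only [Finset.filter_filter, Prod.ext_iff, and_comm]

lemma tripleEmpirical_mem {n : ℕ} (hn : 0 < n) (x x' : Fin n → X) (y : Fin n → Y) :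
    tripleEmpirical x x' y ∈ stdSimplex ℝ (X × X × Y) := empirical_mem hn _

/-- A joint distribution of `(X, X', Y)` that is compatible with the channel is approximated by
empirical distributions compatible with the channel, with the exact `X`- and `X'`-marginals. -/
lemma exists_tripleEmpirical_dist_le {n : ℕ} (hn : 0 < n) {W : X → Y → ℝ}
    (hW : ∀ x, W x ∈ stdSimplex ℝ Y) (x₀ : Fin n → X) {P : X × X × Y → ℝ}
    (hP : P ∈ stdSimplex ℝ (X × X × Y))
    (hP' : margXX' P ∈ couplings (empirical x₀) (empirical x₀)) (hac : ChannelAC W (margXY P)) :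
    ∃ (x x' : Fin n → X) (y : Fin n → Y), empirical x = empirical x₀ ∧
      empirical x' = empirical x₀ ∧ ChannelAC W (jointEmpirical x y) ∧
      dist (tripleEmpirical x x' y) P ≤ Fintype.card (X × X × Y) / n := by
  have hex : ∀ x, ∃ y, W x y ≠ 0 := by
    intro x
    by_contra! h
    have := (hW x).2
    simp [h] at this
  choose y₀ hy₀ using hex
  obtain ⟨u, hu₁, hu₂, hd, hs⟩ := exists_seq_dist_le hn (S := X × X × Y) (fun p => p.1)
    (fun p => p.2.1) (fun a b => (a, b, y₀ a)) (fun _ _ => rfl) (fun _ _ => rfl) hP.1 x₀ x₀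
    (fun a => by
      rw [← hP'.2.1, marg₁, Finset.sum_filter, Fintype.sum_prod_type, Finset.sum_eq_single a]
      · simp [Fintype.sum_prod_type, margXX']
      · simp +contextual
      · simp)
    (fun b => by
      rw [← hP'.2.2, marg₂, Finset.sum_filter, Fintype.sum_prod_type]
      refine Finset.sum_congr rfl fun a _ => ?_
      rw [Fintype.sum_prod_type, Finset.sum_eq_single b]
      · simp [margXX']
      · simp +contextual
      · simp)
  refine ⟨fun t => (u t).1, fun t => (u t).2.1, fun t => (u t).2.2, hu₁, hu₂, ?_, hd⟩
  intro a b hab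
  rw [jointEmpirical, empirical, Finset.card_eq_zero.2, Nat.cast_zero, zero_div]
  refine Finset.filter_eq_empty_iff.2 fun t _ heq => ?_
  obtain ⟨e1, e2⟩ := Prod.mk.inj heq
  rcases hs t with h | ⟨a', b', h⟩
  · have h1 := hac a b hab
    have h2 := le_margXY hP.1 (u t).1 (u t).2.1 (u t).2.2
    rw [e1, e2, h1] at h2
    have h3 : P (u t) = P (a, (u t).2.1, b) := by rw [← e1, ← e2]
    linarith
  · rw [h] at e1 e2
    simp only at e1 e2
    exact hy₀ a' (by rw [e2, e1]; exact hab)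

lemma ent_comp_equiv (e : A ≃ B) (P : B → ℝ) : ent (P ∘ e) = ent P :=
  e.sum_comp fun b => Real.negMulLog (P b)

lemma empirical_equiv_comp {n : ℕ} (e : A ≃ B) (s : Fin n → A) :
    empirical s = empirical (e ∘ s) ∘ e := by
  funext a
  simp [empirical]

open scoped Classical in
/-- The number of outputs `y` in a given joint type with a pair of inputs, to first order in the
exponent. -/
lemma eventually_abs_log_card_triple (X Y : Type*) [Fintype X] [Fintype Y] [DecidableEq X]
    [DecidableEq Y] {ε : ℝ} (hε : 0 < ε) : ∀ᶠ n : ℕ in atTop,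
      ∀ (x x' : Fin n → X) (y₀ : Fin n → Y),
      |Real.log (Finset.univ.filter fun y =>
          tripleEmpirical x x' y = tripleEmpirical x x' y₀).card -
        n * (ent (tripleEmpirical x x' y₀) - ent (jointEmpirical x x'))| ≤ ε * n := by
  filter_upwards [eventually_abs_log_card_cond Y (X × X) hε] with n h x x' y₀
  have h := h y₀ fun t => (x t, x' t)
  set e : Y × (X × X) ≃ X × X × Y := (Equiv.prodComm _ _).trans (Equiv.prodAssoc _ _ _) with he
  have h1 : ∀ y, jointEmpirical y (fun t => (x t, x' t)) = tripleEmpirical x x' y ∘ e := fun y =>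
    empirical_equiv_comp e fun t => (y t, (x t, x' t))
  have h2 : ∀ y, (jointEmpirical y (fun t => (x t, x' t)) =
      jointEmpirical y₀ (fun t => (x t, x' t))) ↔
      tripleEmpirical x x' y = tripleEmpirical x x' y₀ := fun y => by
    rw [h1, h1]
    exact e.surjective.injective_comp_right.eq_iff
  simp only [h2] at h
  rw [h1, ent_comp_equiv] at h
  exact h

end Rounding

/-! ### Uniform expectations over random codebooks -/

section Prob

open scoped BigOperators Classical

/-- The probability of an event under the uniform distribution on a finite type. -/
noncomputable def pr {Ω : Type*} [Fintype Ω] (S : Ω → Prop) : ℝ :=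
  𝔼 ω, if S ω then (1 : ℝ) else 0

section Basic

variable {Ω : Type*} [Fintype Ω]

lemma pr_nonneg (S : Ω → Prop) : 0 ≤ pr S :=
  Finset.expect_nonneg fun _ _ => by split_ifs <;> norm_num

lemma pr_le_expect {S : Ω → Prop} {f : Ω → ℝ} (h0 : ∀ ω, 0 ≤ f ω) (h1 : ∀ ω, S ω → 1 ≤ f ω) :
    pr S ≤ 𝔼 ω, f ω :=
  Finset.expect_le_expect fun ω _ => by
    split_ifs with h
    · exact h1 ω h
    · exact h0 ω

lemma pr_mono {S S' : Ω → Prop} (h : ∀ ω, S ω → S' ω) : pr S ≤ pr S' :=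
  pr_le_expect (fun _ => by split_ifs <;> norm_num) fun ω hω => by rw [if_pos (h ω hω)]

lemma pr_le_one [Nonempty Ω] (S : Ω → Prop) : pr S ≤ 1 :=
  (pr_le_expect (f := fun _ => (1 : ℝ)) (fun _ => zero_le_one) fun _ _ => le_rfl).trans
    (Fintype.expect_const _).le

lemma pr_or_le (S S' : Ω → Prop) : pr (fun ω => S ω ∨ S' ω) ≤ pr S + pr S' := by
  unfold pr
  rw [← Finset.expect_add_distrib]
  refine Finset.expect_le_expect fun ω _ => ?_
  by_cases h : S ω <;> by_cases h' : S' ω <;> simp [h, h']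

/-- The union bound. -/
lemma pr_exists_le {ι : Type*} (I : Finset ι) (S : ι → Ω → Prop) :
    pr (fun ω => ∃ i ∈ I, S i ω) ≤ ∑ i ∈ I, pr (S i) := by
  unfold pr
  rw [← Finset.expect_sum_comm]
  refine Finset.expect_le_expect fun ω _ => ?_
  split_ifs with h
  · obtain ⟨i, hi, hS⟩ := h
    refine le_trans (by rw [if_pos hS]) (Finset.single_le_sum
      (f := fun i => if S i ω then (1 : ℝ) else 0) (fun i _ => ?_) hi)
    split_ifs <;> norm_num
  · exact Finset.sum_nonneg fun i _ => by split_ifs <;> norm_num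

lemma pr_eq_card_div (S : Ω → Prop) :
    pr S = ((Finset.univ.filter S).card : ℝ) / Fintype.card Ω := by
  unfold pr
  rw [Fintype.expect_eq_sum_div_card, Finset.sum_boole]

end Basic

variable {Ω : Type*} [Fintype Ω] {M : ℕ}

/-- Exposing the first codeword. -/
lemma expect_cons (f : (Fin (M + 1) → Ω) → ℝ) :
    𝔼 C, f C = 𝔼 u, 𝔼 C : Fin M → Ω, f (Fin.cons u C) := by
  rw [Fintype.expect_equiv (Fin.consEquiv fun _ : Fin (M + 1) => Ω).symm f
    (fun p => f (Fin.cons p.1 p.2)) (fun C => by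
      exact congrArg f ((Fin.consEquiv fun _ : Fin (M + 1) => Ω).apply_symm_apply C).symm)]
  exact Finset.expect_product _ _ _

/-- The number of codewords with a given property. -/
noncomputable def count (S : Ω → Prop) (C : Fin M → Ω) : ℝ := ∑ k, if S (C k) then 1 else 0

lemma count_eq_card (S : Ω → Prop) (C : Fin M → Ω) :
    count S C = ((Finset.univ.filter fun k => S (C k)).card : ℝ) := by
  rw [count, Finset.sum_boole]

lemma count_nonneg (S : Ω → Prop) (C : Fin M → Ω) : 0 ≤ count S C := by
  rw [count_eq_card]; positivity

lemma count_cons (S : Ω → Prop) (u : Ω) (C : Fin M → Ω) :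
    count S (Fin.cons u C : Fin (M + 1) → Ω) = (if S u then 1 else 0) + count S C := by
  rw [count, Fin.sum_univ_succ]
  simp only [Fin.cons_zero, Fin.cons_succ, count]

lemma expect_exp_count_le [Nonempty Ω] (S : Ω → Prop) (θ : ℝ) :
    𝔼 C : Fin M → Ω, Real.exp (θ * count S C) ≤ Real.exp ((Real.exp θ - 1) * (pr S * M)) := by
  induction M with
  | zero => simp [count]
  | succ M ih =>
    rw [expect_cons]
    have h1 : 𝔼 u, Real.exp (θ * if S u then 1 else 0) = 1 + (Real.exp θ - 1) * pr S := by
      rw [pr, Finset.mul_expect, ← Fintype.expect_const (ι := Ω) (1 : ℝ),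
        ← Finset.expect_add_distrib]
      refine Finset.expect_congr rfl fun u _ => ?_
      rw [Fintype.expect_const]
      split_ifs <;> simp
    calc 𝔼 u, 𝔼 C : Fin M → Ω, Real.exp (θ * count S (Fin.cons u C : Fin (M + 1) → Ω))
        = (𝔼 u, Real.exp (θ * if S u then 1 else 0)) *
            𝔼 C : Fin M → Ω, Real.exp (θ * count S C) := by
          rw [Finset.expect_mul]
          refine Finset.expect_congr rfl fun u _ => ?_
          rw [Finset.mul_expect]
          refine Finset.expect_congr rfl fun C _ => ?_
          rw [count_cons, mul_add, Real.exp_add]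
      _ ≤ Real.exp ((Real.exp θ - 1) * pr S) * Real.exp ((Real.exp θ - 1) * (pr S * M)) := by
          refine mul_le_mul ?_ ih (Finset.expect_nonneg fun _ _ => (Real.exp_pos _).le)
            (Real.exp_pos _).le
          rw [h1, add_comm]
          exact Real.add_one_le_exp _
      _ = _ := by rw [← Real.exp_add]; congr 1; push_cast; ring

lemma pr_le_count [Nonempty Ω] (S : Ω → Prop) (d : ℝ) :
    pr (fun C : Fin M → Ω => d ≤ count S C) ≤ Real.exp (2 * (pr S * M) - d) := by
  refine (pr_le_expect (f := fun C => Real.exp (-d) * Real.exp (1 * count S C))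
    (fun C => by positivity) fun C hC => ?_).trans ?_
  · rw [← Real.exp_add]; exact Real.one_le_exp (by linarith)
  · rw [← Finset.mul_expect, sub_eq_add_neg, add_comm, Real.exp_add]
    refine mul_le_mul_of_nonneg_left ((expect_exp_count_le S 1).trans ?_) (Real.exp_pos _).le
    have h1 := Real.exp_one_lt_d9
    have h2 : 0 ≤ pr S * M := mul_nonneg (pr_nonneg S) (Nat.cast_nonneg _)
    exact Real.exp_le_exp.2 (by nlinarith)

lemma pr_count_le [Nonempty Ω] (S : Ω → Prop) :
    pr (fun C : Fin M → Ω => count S C ≤ pr S * M / 4) ≤ Real.exp (-(pr S * M / 4)) := by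
  refine (pr_le_expect (f := fun C => Real.exp (pr S * M / 4) * Real.exp (-1 * count S C))
    (fun C => by positivity) fun C hC => ?_).trans ?_
  · rw [← Real.exp_add]; exact Real.one_le_exp (by linarith)
  · rw [← Finset.mul_expect]
    refine (mul_le_mul_of_nonneg_left (expect_exp_count_le S (-1)) (Real.exp_pos _).le).trans ?_
    rw [← Real.exp_add]
    have h1 := Real.exp_neg_one_lt_d9
    have h2 : 0 ≤ pr S * M := mul_nonneg (pr_nonneg S) (Nat.cast_nonneg _)
    exact Real.exp_le_exp.2 (by nlinarith)

/-! ### Pairs of codewords in a given relation -/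

/-- The number of codewords after the `i`-th one that are related to it. -/
noncomputable def laterCount (rel : Ω → Ω → Prop) (C : Fin M → Ω) (i : Fin M) : ℝ :=
  ∑ j, if i < j ∧ rel (C i) (C j) then 1 else 0

/-- The number of related pairs of codewords, in the order of their indices. -/
noncomputable def pairCount (rel : Ω → Ω → Prop) (C : Fin M → Ω) : ℝ :=
  ∑ i, laterCount rel C i

lemma laterCount_nonneg (rel : Ω → Ω → Prop) (C : Fin M → Ω) (i : Fin M) :
    0 ≤ laterCount rel C i :=
  Finset.sum_nonneg fun _ _ => by split_ifs <;> norm_num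

lemma pairCount_nonneg (rel : Ω → Ω → Prop) (C : Fin M → Ω) : 0 ≤ pairCount rel C :=
  Finset.sum_nonneg fun _ _ => laterCount_nonneg _ _ _

lemma laterCount_le_count (rel : Ω → Ω → Prop) (C : Fin M → Ω) (i : Fin M) :
    laterCount rel C i ≤ count (rel (C i)) C :=
  Finset.sum_le_sum fun j _ => by
    by_cases h : rel (C i) (C j)
    · simp only [h, and_true, if_true]; split_ifs <;> norm_num
    · simp [h]

lemma laterCount_cons_zero (rel : Ω → Ω → Prop) (u : Ω) (C : Fin M → Ω) :
    laterCount rel (Fin.cons u C : Fin (M + 1) → Ω) 0 = count (rel u) C := by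
  rw [laterCount, Fin.sum_univ_succ]
  simp [count, -Finset.sum_boole]

lemma laterCount_cons_succ (rel : Ω → Ω → Prop) (u : Ω) (C : Fin M → Ω) (i : Fin M) :
    laterCount rel (Fin.cons u C : Fin (M + 1) → Ω) i.succ = laterCount rel C i := by
  rw [laterCount, Fin.sum_univ_succ]
  simp [laterCount, -Finset.sum_boole]

lemma pairCount_cons (rel : Ω → Ω → Prop) (u : Ω) (C : Fin M → Ω) :
    pairCount rel (Fin.cons u C : Fin (M + 1) → Ω) = count (rel u) C + pairCount rel C := by
  rw [pairCount, Fin.sum_univ_succ, laterCount_cons_zero]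
  simp only [laterCount_cons_succ]
  rfl

lemma exp_le_one_add_two_mul {x : ℝ} (h0 : 0 ≤ x) (h1 : x ≤ 1) : Real.exp x ≤ 1 + 2 * x := by
  have h := convexOn_exp.2 (Set.mem_univ 0) (Set.mem_univ 1) (sub_nonneg.2 h1) h0 (by ring)
  simp only [smul_eq_mul, mul_zero, mul_one, zero_add, Real.exp_zero] at h
  have := Real.exp_one_lt_d9
  nlinarith

lemma expect_count_swap (rel : Ω → Ω → Prop) {p : ℝ} (hp : ∀ v, pr (fun u => rel u v) = p)
    (C : Fin M → Ω) : 𝔼 u, count (rel u) C = p * M := by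
  simp only [count]
  rw [Finset.expect_sum_comm]
  refine (Finset.sum_congr rfl fun k _ => hp (C k)).trans ?_
  simp [mul_comm]

/-- Exponential moment of the number of related pairs with the contribution of each codeword
capped at `D`. Codewords are exposed one after the other; given the later ones, the capped
contribution of a codeword has a small conditional mean. -/
lemma expect_exp_capped_le [Nonempty Ω] (rel : Ω → Ω → Prop) {p D : ℝ} (hD : 0 < D)
    (hp : ∀ v, pr (fun u => rel u v) = p) :
    𝔼 C : Fin M → Ω, Real.exp (∑ i, min 1 (laterCount rel C i / D)) ≤
      Real.exp (2 * (p * M ^ 2 / D)) := by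
  have hp0 : 0 ≤ p := hp (Classical.arbitrary Ω) ▸ pr_nonneg _
  induction M with
  | zero => simp
  | succ M ih =>
    rw [expect_cons, Finset.expect_comm]
    calc 𝔼 C : Fin M → Ω, 𝔼 u, Real.exp (∑ i, min 1
          (laterCount rel (Fin.cons u C : Fin (M + 1) → Ω) i / D))
        = 𝔼 C : Fin M → Ω, (𝔼 u, Real.exp (min 1 (count (rel u) C / D))) *
            Real.exp (∑ i, min 1 (laterCount rel C i / D)) := by
          refine Finset.expect_congr rfl fun C _ => ?_
          rw [Finset.expect_mul]
          refine Finset.expect_congr rfl fun u _ => ?_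
          rw [Fin.sum_univ_succ, laterCount_cons_zero, Real.exp_add]
          simp only [laterCount_cons_succ]
      _ ≤ 𝔼 C : Fin M → Ω, Real.exp (2 * (p * M / D)) *
            Real.exp (∑ i, min 1 (laterCount rel C i / D)) := by
          refine Finset.expect_le_expect fun C _ =>
            mul_le_mul_of_nonneg_right ?_ (Real.exp_pos _).le
          have h1 : 𝔼 u, Real.exp (min 1 (count (rel u) C / D)) ≤
              𝔼 u, (1 + 2 * (count (rel u) C / D)) := by
            refine Finset.expect_le_expect fun u _ => ?_
            have h0 : 0 ≤ count (rel u) C / D := div_nonneg (count_nonneg _ _) hD.le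
            refine (exp_le_one_add_two_mul (le_min zero_le_one h0) (min_le_left _ _)).trans ?_
            linarith [min_le_right 1 (count (rel u) C / D)]
          refine h1.trans ?_
          rw [Finset.expect_add_distrib, Fintype.expect_const, ← Finset.mul_expect,
            ← Finset.expect_div, expect_count_swap rel hp, add_comm]
          exact Real.add_one_le_exp _
      _ ≤ Real.exp (2 * (p * M / D)) * Real.exp (2 * (p * M ^ 2 / D)) := by
          rw [← Finset.mul_expect]
          exact mul_le_mul_of_nonneg_left ih (Real.exp_pos _).le
      _ ≤ _ := by
          rw [← Real.exp_add, Real.exp_le_exp, ← mul_add, ← add_div]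
          have : p * M + p * (M : ℝ) ^ 2 ≤ p * ((M + 1 : ℕ) : ℝ) ^ 2 := by
            push_cast
            nlinarith [mul_nonneg hp0 (Nat.cast_nonneg (α := ℝ) M)]
          gcongr

/-- Many related pairs are superexponentially unlikely unless some codeword has many partners. -/
lemma pr_pairCount_le [Nonempty Ω] (rel : Ω → Ω → Prop) {p D : ℝ} (hD : 0 < D)
    (hp : ∀ v, pr (fun u => rel u v) = p) (L : ℝ) :
    pr (fun C : Fin M → Ω => (∀ u, count (rel u) C ≤ D) ∧ L ≤ pairCount rel C) ≤
      Real.exp ((2 * (p * M ^ 2) - L) / D) := by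
  refine (pr_le_expect (f := fun C => Real.exp (-(L / D)) *
    Real.exp (∑ i, min 1 (laterCount rel C i / D))) (fun C => by positivity) ?_).trans ?_
  · rintro C ⟨hC, hL⟩
    rw [← Real.exp_add]
    refine Real.one_le_exp ?_
    have : ∑ i, min 1 (laterCount rel C i / D) = pairCount rel C / D := by
      rw [pairCount, Finset.sum_div]
      refine Finset.sum_congr rfl fun i _ => min_eq_right ?_
      exact div_le_one_of_le₀ ((laterCount_le_count rel C i).trans (hC _)) hD.le
    rw [this]
    have := div_le_div_of_nonneg_right hL hD.le
    linarith
  · rw [← Finset.mul_expect]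
    refine (mul_le_mul_of_nonneg_left (expect_exp_capped_le rel hD hp) (Real.exp_pos _).le).trans ?_
    rw [← Real.exp_add]
    exact Real.exp_le_exp.2 (le_of_eq (by ring))

lemma expect_pairCount [Nonempty Ω] (rel : Ω → Ω → Prop) {p : ℝ} (hp : ∀ v, pr (fun u => rel u v) = p) :
    𝔼 C : Fin M → Ω, pairCount rel C = p * (M * (M - 1) / 2) := by
  induction M with
  | zero => simp [pairCount]
  | succ M ih =>
    rw [expect_cons, Finset.expect_comm]
    simp only [pairCount_cons, Finset.expect_add_distrib, expect_count_swap rel hp,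
      Fintype.expect_const, ih]
    push_cast; ring

lemma expect_count [Nonempty Ω] (S : Ω → Prop) : 𝔼 C : Fin M → Ω, count S C = pr S * M := by
  induction M with
  | zero => simp [count]
  | succ M ih =>
    rw [expect_cons]
    simp only [count_cons, Finset.expect_add_distrib, Fintype.expect_const, ih]
    rw [← pr]; push_cast; ring

lemma expect_count_sq_le [Nonempty Ω] (S : Ω → Prop) :
    𝔼 C : Fin M → Ω, count S C ^ 2 ≤ (pr S * M) ^ 2 + pr S * M := by
  induction M with
  | zero => simp [count]
  | succ M ih =>
    have h : ∀ u, 𝔼 C : Fin M → Ω, count S (Fin.cons u C : Fin (M + 1) → Ω) ^ 2 =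
        (if S u then 1 else 0) * (1 + 2 * (pr S * M)) + 𝔼 C : Fin M → Ω, count S C ^ 2 := by
      intro u
      rw [← expect_count S, Finset.mul_expect, ← Fintype.expect_const (ι := Fin M → Ω) (1 : ℝ),
        ← Finset.expect_add_distrib, Finset.mul_expect, ← Finset.expect_add_distrib]
      refine Finset.expect_congr rfl fun C _ => ?_
      rw [count_cons, Fintype.expect_const]
      split_ifs <;> ring
    rw [expect_cons]
    simp only [h, Finset.expect_add_distrib, Fintype.expect_const]
    rw [← Finset.expect_mul, ← pr]
    push_cast
    nlinarith [sq_nonneg (pr S)]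

/-- Second moment of the number of related pairs, by pairwise independence. -/
lemma expect_pairCount_sq_le [Nonempty Ω] (rel : Ω → Ω → Prop) {p : ℝ}
    (hp : ∀ v, pr (fun u => rel u v) = p) (hp' : ∀ u, pr (rel u) = p) :
    𝔼 C : Fin M → Ω, pairCount rel C ^ 2 ≤
      (p * (M * (M - 1) / 2)) ^ 2 + p * (M * (M - 1) / 2) := by
  induction M with
  | zero => simp [pairCount]
  | succ M ih =>
    have h : 𝔼 u, 𝔼 C : Fin M → Ω, pairCount rel (Fin.cons u C : Fin (M + 1) → Ω) ^ 2 =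
        (𝔼 u, 𝔼 C : Fin M → Ω, count (rel u) C ^ 2) +
          2 * (p * M) * (𝔼 C : Fin M → Ω, pairCount rel C) +
          𝔼 C : Fin M → Ω, pairCount rel C ^ 2 := by
      have h1 : 𝔼 u, 𝔼 C : Fin M → Ω, 2 * (count (rel u) C * pairCount rel C) =
          2 * (p * M) * 𝔼 C : Fin M → Ω, pairCount rel C := by
        rw [Finset.expect_comm, Finset.mul_expect]
        refine Finset.expect_congr rfl fun C _ => ?_
        rw [← Finset.mul_expect, ← Finset.expect_mul, expect_count_swap rel hp]
        ring
      rw [← h1, ← Fintype.expect_const (ι := Ω) (𝔼 C : Fin M → Ω, pairCount rel C ^ 2),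
        ← Finset.expect_add_distrib, ← Finset.expect_add_distrib]
      refine Finset.expect_congr rfl fun u _ => ?_
      rw [← Finset.expect_add_distrib, ← Finset.expect_add_distrib]
      refine Finset.expect_congr rfl fun C _ => ?_
      rw [pairCount_cons]; ring
    rw [expect_cons, h, expect_pairCount rel hp]
    have h2 : 𝔼 u, 𝔼 C : Fin M → Ω, count (rel u) C ^ 2 ≤ (p * M) ^ 2 + p * M := by
      refine (Finset.expect_le_expect fun u _ => expect_count_sq_le (rel u)).trans ?_
      simp only [hp', Fintype.expect_const, le_refl]
    push_cast
    nlinarith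

/-- The Paley–Zygmund inequality for the number of related pairs. -/
lemma le_pr_le_pairCount [Nonempty Ω] (rel : Ω → Ω → Prop) {p μ : ℝ}
    (hp : ∀ v, pr (fun u => rel u v) = p) (hp' : ∀ u, pr (rel u) = p)
    (hμ : μ = p * (M * (M - 1) / 2)) (hμ0 : 0 < μ) :
    μ / (4 * (1 + μ)) ≤ pr (fun C : Fin M → Ω => μ / 2 ≤ pairCount rel C) := by
  set a : ℝ := 1 / (2 * (1 + μ)) with ha
  have ha0 : 0 < a := by positivity
  have h1 : 𝔼 C : Fin M → Ω, pairCount rel C ≤ 𝔼 C : Fin M → Ω, (μ / 2 +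
      (a / 2 * pairCount rel C ^ 2 +
        1 / (2 * a) * if μ / 2 ≤ pairCount rel C then (1 : ℝ) else 0)) := by
    refine Finset.expect_le_expect fun C _ => ?_
    have hN := pairCount_nonneg rel C
    split_ifs with h
    · have : 0 ≤ (a * pairCount rel C - 1) ^ 2 / (2 * a) := by positivity
      have e : (a * pairCount rel C - 1) ^ 2 / (2 * a) =
          a / 2 * pairCount rel C ^ 2 + 1 / (2 * a) * 1 - pairCount rel C := by
        field_simp; ring
      linarith
    · push Not at h
      have : 0 ≤ a / 2 * pairCount rel C ^ 2 := by positivity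
      linarith
  simp only [Finset.expect_add_distrib, Fintype.expect_const, ← Finset.mul_expect] at h1
  rw [← pr, expect_pairCount rel hp, ← hμ] at h1
  have h2 := expect_pairCount_sq_le (M := M) rel hp hp'
  rw [← hμ] at h2
  have h3 := mul_le_mul_of_nonneg_left h2 (half_pos ha0).le
  have e1 : a / 2 * (μ ^ 2 + μ) = μ / 4 := by rw [ha]; field_simp; ring
  have e2 : 1 / (2 * a) = 1 + μ := by rw [ha]; field_simp
  rw [e1] at h3
  rw [e2] at h1
  rw [div_le_iff₀ (by positivity)]
  nlinarith

/-- A related pair occurs with probability at most the number of ordered pairs times the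
probability of each. -/
lemma pr_exists_pair_le [Nonempty Ω] (rel : Ω → Ω → Prop) {p : ℝ}
    (hp : ∀ v, pr (fun u => rel u v) = p) (hp' : ∀ u, pr (rel u) = p) :
    pr (fun C : Fin M → Ω => ∃ i j, i ≠ j ∧ rel (C i) (C j)) ≤ p * M ^ 2 := by
  have hp0 : 0 ≤ p := hp (Classical.arbitrary Ω) ▸ pr_nonneg _
  refine (pr_le_expect (f := fun C => pairCount rel C + pairCount (fun u v => rel v u) C)
    (fun C => add_nonneg (pairCount_nonneg _ _) (pairCount_nonneg _ _)) ?_).trans ?_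
  · have key : ∀ (r : Ω → Ω → Prop) (C : Fin M → Ω) (i j : Fin M), i < j → r (C i) (C j) →
        1 ≤ pairCount r C := by
      intro r C i j hij hr
      have e1 : (1 : ℝ) ≤ laterCount r C i := by
        refine le_trans ?_ (Finset.single_le_sum
          (f := fun j => if i < j ∧ r (C i) (C j) then (1 : ℝ) else 0)
          (fun _ _ => by split_ifs <;> norm_num) (Finset.mem_univ j))
        rw [if_pos ⟨hij, hr⟩]
      exact e1.trans (Finset.single_le_sum (f := laterCount r C)
        (fun _ _ => laterCount_nonneg _ _ _) (Finset.mem_univ i))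
    rintro C ⟨i, j, hne, hr⟩
    rcases lt_or_gt_of_ne hne with h | h
    · linarith [key rel C i j h hr, pairCount_nonneg (fun u v => rel v u) C]
    · linarith [key (fun u v => rel v u) C j i h hr, pairCount_nonneg rel C]
  · rw [Finset.expect_add_distrib, expect_pairCount rel hp,
      expect_pairCount (fun u v => rel v u) hp']
    nlinarith [mul_nonneg hp0 (Nat.cast_nonneg (α := ℝ) M)]

/-- The ordered pairs of distinct related codewords. -/
lemma sum_ne_eq_pairCount (rel : Ω → Ω → Prop) (C : Fin M → Ω) :
    (∑ i, ∑ j, if i ≠ j ∧ rel (C i) (C j) then (1 : ℝ) else 0) =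
      pairCount rel C + pairCount (fun u v => rel v u) C := by
  have e : pairCount (fun u v => rel v u) C =
      ∑ i, ∑ j, if j < i ∧ rel (C i) (C j) then (1 : ℝ) else 0 := by
    rw [Finset.sum_comm]; rfl
  rw [e]
  simp only [pairCount, laterCount, ← Finset.sum_add_distrib]
  refine Finset.sum_congr rfl fun i _ => Finset.sum_congr rfl fun j _ => ?_
  by_cases hr : rel (C i) (C j)
  · rcases lt_trichotomy i j with h | h | h
    · simp [hr, h, h.ne, h.not_gt]
    · simp [h]
    · simp [hr, h, h.ne', h.not_gt]
  · simp [hr]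

/-! ### The random codebook as a measure -/

section Ensemble

variable {X : Type*} [Fintype X] [DecidableEq X] [MeasurableSpace X] [DiscreteMeasurableSpace X]

/-- The type class as a finite sample space. -/
noncomputable instance typeClass.instFintype (n : ℕ) (QX : X → ℝ) : Fintype (typeClass n QX) :=
  Fintype.ofFinite _

lemma ensemble_apply (QX : X → ℝ) (M n : ℕ) [Nonempty (typeClass n QX)]
    (S : Set (Codebook X M n)) :
    ensemble QX M n S =
      ENNReal.ofReal (pr fun C : Fin M → typeClass n QX => (fun m => (C m : Fin n → X)) ∈ S) := by
  have h1 : ensemble QX M n = uniformOn (Set.univ.pi fun _ : Fin M => typeClass n QX) :=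
    uniformOn_pi.symm
  set U : Finset (Codebook X M n) :=
    Finset.univ.filter fun C => C ∈ Set.univ.pi fun _ : Fin M => typeClass n QX with hU
  have hUs : (Set.univ.pi fun _ : Fin M => typeClass n QX) = (U : Set (Codebook X M n)) := by
    ext C; simp [hU]
  have hSs : S = ((Finset.univ.filter fun C => C ∈ S : Finset (Codebook X M n)) :
      Set (Codebook X M n)) := by
    ext C; simp
  have hcard : ∀ P : Codebook X M n → Prop, (Finset.univ.filter
      fun C : Fin M → typeClass n QX => P fun m => (C m : Fin n → X)).card =
      (U.filter P).card := by
    intro P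
    refine Finset.card_bij (fun C _ m => (C m : Fin n → X)) ?_ ?_ ?_
    · intro C hC
      simp only [Finset.mem_filter, Finset.mem_univ, true_and] at hC
      simpa [hU] using hC
    · intro C _ C' _ h
      funext m
      exact Subtype.ext (congrFun h m)
    · intro C hC
      simp only [hU, Finset.mem_filter, Finset.mem_univ, true_and, Set.mem_univ_pi] at hC
      exact ⟨fun m => ⟨C m, hC.1 m⟩, by simpa using hC.2, rfl⟩
  have hcardU : Fintype.card (Fin M → typeClass n QX) = U.card := by
    have := hcard fun _ => True
    simpa using this
  rw [h1, hUs]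
  conv_lhs => rw [hSs]
  rw [uniformOn_apply_finset, pr_eq_card_div, hcard fun C => C ∈ S, hcardU]
  have hpos : 0 < U.card := hcardU ▸ Fintype.card_pos
  rw [ENNReal.ofReal_div_of_pos (by exact_mod_cast hpos), ENNReal.ofReal_natCast,
    ENNReal.ofReal_natCast]
  congr 3
  ext C
  simp

end Ensemble

end Prob

/-! ### Type class enumerators -/

section Enumerators

open scoped BigOperators Classical

lemma eventually_mul_le_exp (c : ℝ) {ε : ℝ} (hε : 0 < ε) :
    ∀ᶠ n : ℕ in atTop, c * n ≤ Real.exp (ε * n) := by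
  filter_upwards [eventually_ge_atTop ⌈2 * |c| / ε ^ 2⌉₊] with n hn
  have h1 : 2 * |c| / ε ^ 2 ≤ n := (Nat.le_ceil _).trans (by exact_mod_cast hn)
  rw [div_le_iff₀ (by positivity)] at h1
  have h2 := Real.quadratic_le_exp_of_nonneg (x := ε * n) (by positivity)
  have h3 : 0 ≤ ε * n := by positivity
  have h4 : (0 : ℝ) ≤ n := by positivity
  nlinarith [le_abs_self c, mul_le_mul_of_nonneg_right h1 h4]

lemma eventually_const_le_exp (c : ℝ) {ε : ℝ} (hε : 0 < ε) :
    ∀ᶠ n : ℕ in atTop, c ≤ Real.exp (ε * n) := by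
  filter_upwards [eventually_mul_le_exp |c| hε, eventually_ge_atTop 1] with n hn h1
  have : (1 : ℝ) ≤ n := by exact_mod_cast h1
  nlinarith [le_abs_self c, abs_nonneg c]

lemma eventually_blockLengths {X : Type*} [DecidableEq X] {QX : X → ℝ} {p : ℕ → Prop} :
    (∀ᶠ n in blockLengths QX, p n) ↔ ∀ᶠ n in atTop, (typeClass n QX).Nonempty → p n :=
  eventually_inf_principal

variable {X B : Type*} [Fintype X] [DecidableEq X] [Fintype B] [DecidableEq B]
  {QX : X → ℝ} {R : ℝ}

lemma exp_le_numCodewords (R : ℝ) (n : ℕ) : Real.exp (n * R) ≤ numCodewords R n := Nat.le_ceil _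

lemma numCodewords_le (hR : 0 < R) (n : ℕ) : (numCodewords R n : ℝ) ≤ 2 * Real.exp (n * R) := by
  have h1 := (Nat.ceil_lt_add_one (Real.exp_pos (n * R)).le).le
  have h2 : 1 ≤ Real.exp (n * R) := Real.one_le_exp (by positivity)
  unfold numCodewords
  linarith

lemma two_le_numCodewords (hR : 0 < R) {n : ℕ} (hn : 0 < n) : 2 ≤ numCodewords R n := by
  have h2 : 1 < Real.exp (n * R) := Real.one_lt_exp_iff.2 (by positivity)
  exact Nat.lt_ceil.2 (by exact_mod_cast h2)

lemma mutualInfo_swap (Q : X × B → ℝ) : mutualInfo (Q ∘ Prod.swap) = mutualInfo Q := by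
  unfold mutualInfo
  rw [Finset.sum_comm]
  refine Finset.sum_congr rfl fun a _ => Finset.sum_congr rfl fun b _ => ?_
  simp only [Function.comp_apply, Prod.swap_prod_mk, marg₁, marg₂, mul_comm]

lemma jointEmpirical_swap {n : ℕ} (x : Fin n → X) (y : Fin n → B) :
    jointEmpirical y x = jointEmpirical x y ∘ Prod.swap :=
  empirical_equiv_comp (Equiv.prodComm B X) fun t => (y t, x t)

lemma comp_swap_inj {Q Q' : X × B → ℝ} : Q ∘ Prod.swap = Q' ∘ Prod.swap ↔ Q = Q' :=
  Prod.swap_surjective.injective_comp_right.eq_iff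

lemma card_typeClass {n : ℕ} {x₀ : Fin n → X} (hx₀ : empirical x₀ = QX) :
    Fintype.card (typeClass n QX) = (typeOf x₀).card := by
  rw [← Nat.card_eq_fintype_card, Nat.card_coe_set_eq, ← Set.ncard_coe_finset]
  congr 1
  ext x
  simp [typeClass, mem_typeOf, hx₀]

lemma pr_jointEmpirical {n : ℕ} (x₀ : typeClass n QX) (y₀ : Fin n → B) :
    pr (fun u : typeClass n QX => jointEmpirical (u : Fin n → X) y₀ = jointEmpirical x₀.1 y₀) =
      ((Finset.univ.filter fun x => jointEmpirical x y₀ = jointEmpirical x₀.1 y₀).card : ℝ) /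
        (typeOf x₀.1).card := by
  rw [pr_eq_card_div, card_typeClass x₀.2]
  congr 2
  refine Finset.card_bij (fun u _ => u.1) ?_ ?_ ?_
  · intro u hu
    simpa using hu
  · intro u _ u' _ h
    exact Subtype.ext h
  · intro x hx
    simp only [Finset.mem_filter, Finset.mem_univ, true_and] at hx
    refine ⟨⟨x, ?_⟩, by simpa using hx, rfl⟩
    have := congrArg marg₁ hx
    rw [marg₁_jointEmpirical, marg₁_jointEmpirical] at this
    exact this.trans x₀.2

/-- A random codeword has a given joint type with a fixed sequence with probability
`exp (-n I)`, to first order in the exponent. -/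
lemma eventually_pr_jointEmpirical (B : Type*) [Fintype B] [DecidableEq B] (QX : X → ℝ) {ε : ℝ}
    (hε : 0 < ε) : ∀ᶠ n : ℕ in atTop, ∀ (x₀ : typeClass n QX) (y₀ : Fin n → B),
      Real.exp (n * (-mutualInfo (jointEmpirical x₀.1 y₀) - ε)) ≤
        pr (fun u : typeClass n QX => jointEmpirical (u : Fin n → X) y₀ =
          jointEmpirical x₀.1 y₀) ∧
      pr (fun u : typeClass n QX => jointEmpirical (u : Fin n → X) y₀ =
          jointEmpirical x₀.1 y₀) ≤
        Real.exp (n * (-mutualInfo (jointEmpirical x₀.1 y₀) + ε)) := by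
  filter_upwards [eventually_abs_log_card_cond X B (half_pos hε),
    eventually_abs_log_card_typeOf X (half_pos hε), eventually_gt_atTop 0] with n h1 h2 hn x₀ y₀
  have e1 := abs_le.1 (h1 x₀.1 y₀)
  have e2 := abs_le.1 (h2 x₀.1)
  have hc1 : (0 : ℝ) < (Finset.univ.filter
      fun x => jointEmpirical x y₀ = jointEmpirical x₀.1 y₀).card := by
    exact_mod_cast Finset.card_pos.2 ⟨x₀.1, by simp⟩
  have hc2 : (0 : ℝ) < (typeOf x₀.1).card := by exact_mod_cast card_typeOf_pos _
  have hI : mutualInfo (jointEmpirical x₀.1 y₀) =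
      ent (empirical x₀.1) + ent (empirical y₀) - ent (jointEmpirical x₀.1 y₀) := by
    rw [mutualInfo_eq (jointEmpirical_mem hn _ _).1, marg₁_jointEmpirical, marg₂_jointEmpirical]
  rw [pr_jointEmpirical, ← Real.exp_log (div_pos hc1 hc2), Real.log_div hc1.ne' hc2.ne',
    Real.exp_le_exp, Real.exp_le_exp, hI]
  constructor <;> linarith [e1.1, e1.2, e2.1, e2.2]

lemma pr_jointEmpirical_eq {n : ℕ} (u₀ v₀ v : typeClass n QX) :
    pr (fun u : typeClass n QX => jointEmpirical (u : Fin n → X) v.1 =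
        jointEmpirical u₀.1 v₀.1) =
      ((typeOf fun t => (u₀.1 t, v₀.1 t)).card : ℝ) / (typeOf u₀.1).card ^ 2 := by
  obtain ⟨σ, hσ⟩ := exists_perm_of_empirical_eq (v.2.trans v₀.2.symm : empirical v.1 = _)
  have hu : empirical (u₀.1 ∘ σ) = QX := (empirical_comp_perm _ _).trans u₀.2
  have hj : jointEmpirical (u₀.1 ∘ σ) v.1 = jointEmpirical u₀.1 v₀.1 := by
    rw [hσ]; exact empirical_comp_perm (fun t => (u₀.1 t, v₀.1 t)) σ
  have h1 := pr_jointEmpirical (⟨u₀.1 ∘ σ, hu⟩ : typeClass n QX) v.1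
  simp only [hj] at h1
  have h2 := card_filter_jointEmpirical_mul (u₀.1 ∘ σ) v.1
  rw [hj] at h2
  have h3 : ∀ w : Fin n → X, empirical w = QX → typeOf w = typeOf u₀.1 := fun w hw => by
    ext s; rw [mem_typeOf, mem_typeOf, hw, show empirical u₀.1 = QX from u₀.2]
  have h4 : (typeOf fun t => ((u₀.1 ∘ σ) t, v.1 t)) = typeOf fun t => (u₀.1 t, v₀.1 t) := by
    ext s
    rw [mem_typeOf, mem_typeOf]
    exact Eq.congr_right hj
  rw [h3 v.1 v.2, h4] at h2
  have hc2 : (0 : ℝ) < (typeOf u₀.1).card := by exact_mod_cast card_typeOf_pos _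
  rw [h1, h3 _ hu, ← h2]
  push_cast
  field_simp

/-- Any two codewords have joint type `Q` with the same probability, also given one of them. -/
lemma eventually_exists_pair_prob (QX : X → ℝ) {ε : ℝ} (hε : 0 < ε) :
    ∀ᶠ n : ℕ in atTop, ∀ Q : X × X → ℝ, ∃ p : ℝ, 0 ≤ p ∧
      (∀ v : typeClass n QX, pr (fun u : typeClass n QX => jointEmpirical u.1 v.1 = Q) = p) ∧
      (∀ u : typeClass n QX, pr (fun v : typeClass n QX => jointEmpirical u.1 v.1 = Q) = p) ∧
      p ≤ Real.exp (n * (-mutualInfo Q + ε)) ∧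
      ((∃ u v : typeClass n QX, jointEmpirical u.1 v.1 = Q) →
        Real.exp (n * (-mutualInfo Q - ε)) ≤ p) := by
  filter_upwards [eventually_pr_jointEmpirical X QX hε] with n hn Q
  by_cases hex : ∃ u v : typeClass n QX, jointEmpirical u.1 v.1 = Q
  · obtain ⟨u₀, v₀, rfl⟩ := hex
    refine ⟨_, ?_, fun v => pr_jointEmpirical_eq u₀ v₀ v, fun u => ?_, ?_, fun _ => ?_⟩
    · positivity
    · have h := pr_jointEmpirical_eq v₀ u₀ u
      have h1 : ∀ v : typeClass n QX, (jointEmpirical u.1 v.1 = jointEmpirical u₀.1 v₀.1) =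
          (jointEmpirical v.1 u.1 = jointEmpirical v₀.1 u₀.1) := fun v => by
        rw [jointEmpirical_swap u.1 v.1, jointEmpirical_swap u₀.1 v₀.1, comp_swap_inj]
      simp only [h1]
      rw [h]
      have h3 : typeOf v₀.1 = typeOf u₀.1 := by
        ext s; rw [mem_typeOf, mem_typeOf, show empirical v₀.1 = QX from v₀.2,
          show empirical u₀.1 = QX from u₀.2]
      rw [h3]
      congr 2
      refine Finset.card_bij (fun s _ t => (s t).swap) ?_ ?_ ?_
      · intro s hs
        rw [mem_typeOf] at hs ⊢
        rw [empirical_equiv_comp (Equiv.prodComm X X) s,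
          empirical_equiv_comp (Equiv.prodComm X X) fun t => (v₀.1 t, u₀.1 t)] at hs
        exact (Equiv.prodComm X X).surjective.injective_comp_right hs
      · intro s _ s' _ h
        funext t
        exact Prod.swap_injective (congrFun h t)
      · intro s hs
        refine ⟨fun t => (s t).swap, ?_, by funext t; simp⟩
        rw [mem_typeOf] at hs ⊢
        rw [empirical_equiv_comp (Equiv.prodComm X X) s,
          empirical_equiv_comp (Equiv.prodComm X X) fun t => (u₀.1 t, v₀.1 t)] at hs
        exact (Equiv.prodComm X X).surjective.injective_comp_right hs
    · rw [← pr_jointEmpirical_eq u₀ v₀ v₀]; exact (hn u₀ v₀).2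
    · rw [← pr_jointEmpirical_eq u₀ v₀ v₀]; exact (hn u₀ v₀).1
  · refine ⟨0, le_rfl, fun v => ?_, fun u => ?_, (Real.exp_pos _).le, fun h => absurd h hex⟩
    · have : ∀ u : typeClass n QX, ¬ jointEmpirical u.1 v.1 = Q := fun u h => hex ⟨u, v, h⟩
      simp [pr, this]
    · have : ∀ v : typeClass n QX, ¬ jointEmpirical u.1 v.1 = Q := fun v h => hex ⟨u, v, h⟩
      simp [pr, this]

lemma card_seq_le_exp (B : Type*) [Fintype B] [DecidableEq B] (n : ℕ) :
    ((Finset.univ : Finset (Fin n → B)).card : ℝ) ≤ Real.exp (Fintype.card B * n) := by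
  rw [Finset.card_univ, Fintype.card_fun, Fintype.card_fin, mul_comm, Real.exp_nat_mul]
  push_cast
  gcongr
  linarith [Real.add_one_le_exp (Fintype.card B : ℝ)]

/-- The codebooks of the ensemble of rate `R`. -/
abbrev Book (QX : X → ℝ) (R : ℝ) (n : ℕ) : Type _ := Fin (numCodewords R n) → typeClass n QX

/-- A union bound over all sequences over `B` and all joint types against a doubly exponentially
small probability. -/
lemma eventually_pr_exists_le (B : Type*) [Fintype B] [DecidableEq B] (QX : X → ℝ) (R : ℝ)
    {ε : ℝ} (hε : 0 < ε) (c : ℝ) : ∀ᶠ n : ℕ in atTop,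
      ∀ S : (Fin n → B) → (X × B → ℝ) → Book QX R n → Prop, (∀ y, ∀ Q ∈ allTypes (X × B) n, pr (S y Q) ≤ Real.exp (-Real.exp (ε * n))) →
      pr (fun ω => ∃ y, ∃ Q ∈ allTypes (X × B) n, S y Q ω) ≤ Real.exp (-(c * n)) := by
  filter_upwards [eventually_card_allTypes_le (X × B) one_pos,
    eventually_mul_le_exp (Fintype.card B + 1 + c) hε] with n h1 h2 S hS
  have h3 : pr (fun ω => ∃ y, ∃ Q ∈ allTypes (X × B) n, S y Q ω) ≤
      ∑ q ∈ (Finset.univ : Finset (Fin n → B)) ×ˢ allTypes (X × B) n, pr (S q.1 q.2) := by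
    refine (pr_mono ?_).trans (pr_exists_le
      ((Finset.univ : Finset (Fin n → B)) ×ˢ allTypes (X × B) n) fun q => S q.1 q.2)
    rintro ω ⟨y, Q, hQ, h⟩
    exact ⟨(y, Q), Finset.mem_product.2 ⟨Finset.mem_univ y, hQ⟩, h⟩
  refine h3.trans ((Finset.sum_le_card_nsmul _ _ _ fun q hq =>
    hS q.1 q.2 (Finset.mem_product.1 hq).2).trans ?_)
  rw [Finset.card_product, nsmul_eq_mul, Nat.cast_mul]
  calc _ ≤ Real.exp (Fintype.card B * n) * Real.exp (1 * n) * Real.exp (-Real.exp (ε * n)) := by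
        gcongr; exact card_seq_le_exp B n
    _ ≤ _ := by
        rw [← Real.exp_add, ← Real.exp_add, Real.exp_le_exp]; linarith

/-- Superexponentially few codebooks have, for some sequence `y` and joint type `Q`, more
codewords of joint type `Q` with `y` than `exp (n ([R - I]₊ + ε))`. -/
lemma eventually_pr_count_gt (B : Type*) [Fintype B] [DecidableEq B] (QX : X → ℝ) (hR : 0 < R)
    {ε : ℝ} (hε : 0 < ε) (c : ℝ) : ∀ᶠ n : ℕ in blockLengths QX,
      pr (fun C : Book QX R n => ∃ y : Fin n → B, ∃ Q ∈ allTypes (X × B) n,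
        Real.exp (n * (max 0 (R - mutualInfo Q) + ε)) <
          count (fun u : typeClass n QX => jointEmpirical u.1 y = Q) C) ≤
      Real.exp (-(c * n)) := by
  rw [eventually_blockLengths]
  filter_upwards [eventually_pr_jointEmpirical B QX (half_pos (half_pos hε)),
    eventually_pr_exists_le B QX R (half_pos hε) c,
    eventually_const_le_exp 8 (half_pos hε)] with n h1 h2 h3 hne
  have : Nonempty (typeClass n QX) := hne.to_subtype
  refine h2 (fun y Q (C : Book QX R n) => Real.exp (n * (max 0 (R - mutualInfo Q) + ε)) <
    count (fun u : typeClass n QX => jointEmpirical u.1 y = Q) C) fun y Q _ => ?_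
  have hp : pr (fun u : typeClass n QX => jointEmpirical u.1 y = Q) ≤
      Real.exp (n * (-mutualInfo Q + ε / 2 / 2)) := by
    by_cases hex : ∃ u : typeClass n QX, jointEmpirical u.1 y = Q
    · obtain ⟨u, rfl⟩ := hex
      exact (h1 u y).2
    · push Not at hex
      simp only [pr, hex, if_false, Finset.expect_const_zero]
      exact (Real.exp_pos _).le
  refine (pr_mono fun C hC => le_of_lt hC).trans ((pr_le_count _ _).trans ?_)
  rw [Real.exp_le_exp]
  set d := Real.exp (n * (max 0 (R - mutualInfo Q) + ε)) with hd
  have hn0 : (0 : ℝ) ≤ n := by positivity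
  have e1 : pr (fun u : typeClass n QX => jointEmpirical u.1 y = Q) * numCodewords R n ≤
      2 * Real.exp (n * (max 0 (R - mutualInfo Q) + ε / 2 / 2)) := by
    refine (mul_le_mul hp (numCodewords_le hR n) (by positivity) (Real.exp_pos _).le).trans ?_
    rw [mul_left_comm, ← Real.exp_add]
    gcongr
    have := le_max_right 0 (R - mutualInfo Q)
    nlinarith
  have e2 : 8 * Real.exp (n * (max 0 (R - mutualInfo Q) + ε / 2 / 2)) ≤ d := by
    refine (mul_le_mul_of_nonneg_right h3 (Real.exp_pos _).le).trans ?_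
    rw [← Real.exp_add, hd, Real.exp_le_exp]
    nlinarith
  have e3 : 8 * Real.exp (ε / 2 * n) ≤ d := by
    refine (mul_le_mul_of_nonneg_right h3 (Real.exp_pos _).le).trans ?_
    rw [← Real.exp_add, hd, Real.exp_le_exp]
    have := le_max_left 0 (R - mutualInfo Q)
    nlinarith
  have e4 := Real.exp_pos (ε / 2 * n)
  linarith

/-- Superexponentially few codebooks have, for some `y` and some joint type `Q` with
`I ≤ R - ε`, less than `exp (n (R - I - ε))` codewords of joint type `Q` with `y`. -/
lemma eventually_pr_count_lt (B : Type*) [Fintype B] [DecidableEq B] (QX : X → ℝ)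
    {ε : ℝ} (hε : 0 < ε) (c : ℝ) : ∀ᶠ n : ℕ in blockLengths QX,
      pr (fun C : Book QX R n => ∃ y : Fin n → B, ∃ Q ∈ allTypes (X × B) n,
        (∃ u : typeClass n QX, jointEmpirical u.1 y = Q) ∧ mutualInfo Q ≤ R - ε ∧
        count (fun u : typeClass n QX => jointEmpirical u.1 y = Q) C <
          Real.exp (n * (R - mutualInfo Q - ε))) ≤
      Real.exp (-(c * n)) := by
  rw [eventually_blockLengths]
  filter_upwards [eventually_pr_jointEmpirical B QX (half_pos (half_pos hε)),
    eventually_pr_exists_le B QX R (half_pos hε) c,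
    eventually_const_le_exp 4 (half_pos (half_pos hε))] with n h1 h2 h3 hne
  have : Nonempty (typeClass n QX) := hne.to_subtype
  refine h2 (fun y Q (C : Book QX R n) => (∃ u : typeClass n QX, jointEmpirical u.1 y = Q) ∧
    mutualInfo Q ≤ R - ε ∧ count (fun u : typeClass n QX => jointEmpirical u.1 y = Q) C <
          Real.exp (n * (R - mutualInfo Q - ε))) fun y Q _ => ?_
  by_cases hex : (∃ u : typeClass n QX, jointEmpirical u.1 y = Q) ∧ mutualInfo Q ≤ R - ε
  swap
  · refine le_trans (le_of_eq ?_) (Real.exp_pos _).le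
    refine Finset.expect_eq_zero fun C _ => if_neg fun h => hex ⟨h.1, h.2.1⟩
  obtain ⟨⟨u, rfl⟩, hI⟩ := hex
  have hp := (h1 u y).1
  set Q := jointEmpirical u.1 y
  set p := pr fun u : typeClass n QX => jointEmpirical u.1 y = Q
  have hn0 : (0 : ℝ) ≤ n := by positivity
  have e1 : Real.exp (n * (R - mutualInfo Q - ε / 2 / 2)) ≤ p * numCodewords R n := by
    refine le_trans (le_of_eq ?_) (mul_le_mul hp (exp_le_numCodewords R n) (Real.exp_pos _).le
      ((Real.exp_pos _).le.trans hp))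
    rw [← Real.exp_add]; congr 1; ring
  have e2 : 4 * Real.exp (n * (R - mutualInfo Q - ε)) ≤
      Real.exp (n * (R - mutualInfo Q - ε / 2 / 2)) := by
    refine (mul_le_mul_of_nonneg_right h3 (Real.exp_pos _).le).trans ?_
    rw [← Real.exp_add, Real.exp_le_exp]
    nlinarith
  have e3 : 4 * Real.exp (ε / 2 * n) ≤ Real.exp (n * (R - mutualInfo Q - ε / 2 / 2)) := by
    refine (mul_le_mul_of_nonneg_right h3 (Real.exp_pos _).le).trans ?_
    rw [← Real.exp_add, Real.exp_le_exp]
    nlinarith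
  refine (pr_mono (S' := fun C : Book QX R n => count (fun u : typeClass n QX =>
    jointEmpirical u.1 y = Q) C ≤ p * numCodewords R n / 4) fun C hC => ?_).trans
    ((pr_count_le _).trans ?_)
  · linarith [hC.2.2]
  · rw [Real.exp_le_exp]
    change -(p * numCodewords R n / 4) ≤ _
    linarith

/-- The number of ordered pairs of distinct codewords with joint type `Q`. -/
noncomputable def typePairs {n : ℕ} (Q : X × X → ℝ) (C : Book QX R n) : ℝ :=
  ∑ i, ∑ j, if i ≠ j ∧ jointEmpirical (C i).1 (C j).1 = Q then (1 : ℝ) else 0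

lemma typePairs_eq {n : ℕ} (Q : X × X → ℝ) (C : Book QX R n) :
    typePairs Q C =
      pairCount (fun u v : typeClass n QX => jointEmpirical u.1 v.1 = Q) C +
      pairCount (fun u v : typeClass n QX => jointEmpirical v.1 u.1 = Q) C := by
  unfold typePairs
  convert sum_ne_eq_pairCount (fun u v : typeClass n QX => jointEmpirical u.1 v.1 = Q) C

/-- Superexponentially few codebooks have more than `exp (n ([2R - I]₊ + ε))` pairs of codewords
of some joint type `Q`. -/
lemma eventually_pr_typePairs_gt (QX : X → ℝ) (hR : 0 < R)
    {ε : ℝ} (hε : 0 < ε) (c : ℝ) : ∀ᶠ n : ℕ in blockLengths QX,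
      pr (fun C : Book QX R n => ∃ Q ∈ allTypes (X × X) n,
        Real.exp (n * (max 0 (2 * R - mutualInfo Q) + ε)) < typePairs Q C) ≤
      Real.exp (-(c * n)) := by
  have hε4 : 0 < ε / 4 := by linarith
  have hA := eventually_pr_count_gt (R := R) X QX hR hε4 (c + 1)
  rw [eventually_blockLengths] at hA ⊢
  filter_upwards [hA, eventually_exists_pair_prob QX hε4,
    eventually_card_allTypes_le (X × X) one_pos, eventually_mul_le_exp (3 + c) (half_pos hε),
    eventually_const_le_exp 32 hε4, eventually_const_le_exp 4 (one_pos),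
    eventually_gt_atTop 0] with n hA hp hcard hdecay h32 h4 hn hne
  have : Nonempty (typeClass n QX) := hne.to_subtype
  have hn0 : (0 : ℝ) < n := by exact_mod_cast hn
  set A : Book QX R n → Prop := fun C => ∃ y : Fin n → X, ∃ Q ∈ allTypes (X × X) n,
        Real.exp (n * (max 0 (R - mutualInfo Q) + ε / 4)) <
          count (fun u : typeClass n QX => jointEmpirical u.1 y = Q) C with hAdef
  set D : (X × X → ℝ) → ℝ := fun Q => Real.exp (n * (max 0 (R - mutualInfo Q) + ε / 4)) with hD
  set L : (X × X → ℝ) → ℝ := fun Q => Real.exp (n * (max 0 (2 * R - mutualInfo Q) + ε)) with hL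
  set r₁ : (X × X → ℝ) → typeClass n QX → typeClass n QX → Prop :=
    fun Q u v => jointEmpirical u.1 v.1 = Q with hr₁
  set r₂ : (X × X → ℝ) → typeClass n QX → typeClass n QX → Prop :=
    fun Q u v => jointEmpirical v.1 u.1 = Q with hr₂
  -- Outside of `A` every codeword has few partners, so many pairs are unlikely.
  have hbound : ∀ Q, ∀ r : typeClass n QX → typeClass n QX → Prop,
      (∃ p, 0 ≤ p ∧ (∀ v, pr (fun u => r u v) = p) ∧
        p ≤ Real.exp (n * (-mutualInfo Q + ε / 4))) →
      pr (fun C : Book QX R n => (∀ u, count (r u) C ≤ D Q) ∧ L Q / 2 ≤ pairCount r C) ≤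
        Real.exp (-Real.exp (ε / 2 * n)) := by
    rintro Q r ⟨p, hp0, hpr, hple⟩
    have hDpos : 0 < D Q := Real.exp_pos _
    refine (pr_pairCount_le r hDpos hpr (L Q / 2)).trans (Real.exp_le_exp.2 ?_)
    rw [div_le_iff₀ hDpos]
    have hM := numCodewords_le hR n
    have e1 : p * (numCodewords R n : ℝ) ^ 2 ≤
        4 * Real.exp (n * (max 0 (2 * R - mutualInfo Q) + ε / 4)) := by
      calc p * (numCodewords R n : ℝ) ^ 2
          ≤ Real.exp (n * (-mutualInfo Q + ε / 4)) * (2 * Real.exp (n * R)) ^ 2 := by gcongr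
        _ = 4 * Real.exp (n * (2 * R - mutualInfo Q + ε / 4)) := by
            rw [mul_pow, ← Real.exp_nat_mul, mul_left_comm, ← Real.exp_add]
            push_cast; ring_nf
        _ ≤ _ := by
            have := le_max_right 0 (2 * R - mutualInfo Q)
            gcongr
    have e2 : 32 * Real.exp (n * (max 0 (2 * R - mutualInfo Q) + ε / 4)) ≤ L Q := by
      refine (mul_le_mul_of_nonneg_right h32 (Real.exp_pos _).le).trans ?_
      rw [← Real.exp_add, hL, Real.exp_le_exp]
      nlinarith
    have e3 : 32 * (Real.exp (ε / 2 * n) * D Q) ≤ L Q := by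
      refine (mul_le_mul_of_nonneg_right h32 (by positivity)).trans ?_
      rw [hD, hL, ← Real.exp_add, ← Real.exp_add, Real.exp_le_exp]
      have : max 0 (R - mutualInfo Q) ≤ max 0 (2 * R - mutualInfo Q) :=
        max_le_max le_rfl (by linarith)
      nlinarith
    have e4 : 0 ≤ Real.exp (ε / 2 * n) * D Q := by positivity
    linarith
  have hincl : ∀ C : Book QX R n, (∃ Q ∈ allTypes (X × X) n, L Q < typePairs Q C) →
      A C ∨ ∃ Q ∈ allTypes (X × X) n,
        ((∀ u, count (r₁ Q u) C ≤ D Q) ∧ L Q / 2 ≤ pairCount (r₁ Q) C) ∨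
        ((∀ u, count (r₂ Q u) C ≤ D Q) ∧ L Q / 2 ≤ pairCount (r₂ Q) C) := by
    rintro C ⟨Q, hQ, hlt⟩
    by_cases hAC : A C
    · exact Or.inl hAC
    right
    simp only [hAdef, not_exists, not_and, not_lt] at hAC
    have hc₂ : ∀ u, count (r₂ Q u) C ≤ D Q := fun u => hAC u.1 Q hQ
    have hc₁ : ∀ u, count (r₁ Q u) C ≤ D Q := fun u => by
      have hQ' : Q ∘ Prod.swap ∈ allTypes (X × X) n := by
        obtain ⟨s, rfl⟩ := mem_allTypes.1 hQ
        have := jointEmpirical_swap (fun t => (s t).1) fun t => (s t).2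
        exact mem_allTypes.2 ⟨_, this⟩
      have h := hAC u.1 _ hQ'
      rw [mutualInfo_swap] at h
      refine le_trans (le_of_eq ?_) h
      simp only [count, hr₁]
      refine Finset.sum_congr rfl fun k _ => ?_
      have : (jointEmpirical u.1 (C k).1 = Q) ↔
          jointEmpirical (C k).1 u.1 = Q ∘ Prod.swap := by
        rw [jointEmpirical_swap u.1 (C k).1, comp_swap_inj]
      by_cases hk : jointEmpirical (C k).1 u.1 = Q ∘ Prod.swap
      · rw [if_pos (this.2 hk), if_pos hk]
      · rw [if_neg (this.not.2 hk), if_neg hk]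
    rw [typePairs_eq] at hlt
    by_cases h1 : L Q / 2 ≤ pairCount (r₁ Q) C
    · exact ⟨Q, hQ, Or.inl ⟨hc₁, h1⟩⟩
    · exact ⟨Q, hQ, Or.inr ⟨hc₂, by linarith⟩⟩
  have hsum : pr (fun C : Book QX R n => ∃ Q ∈ allTypes (X × X) n,
        ((∀ u, count (r₁ Q u) C ≤ D Q) ∧ L Q / 2 ≤ pairCount (r₁ Q) C) ∨
        ((∀ u, count (r₂ Q u) C ≤ D Q) ∧ L Q / 2 ≤ pairCount (r₂ Q) C)) ≤
      Real.exp (1 * n) * (2 * Real.exp (-Real.exp (ε / 2 * n))) := by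
    refine (pr_exists_le _ _).trans ((Finset.sum_le_card_nsmul _ _
      (2 * Real.exp (-Real.exp (ε / 2 * n))) fun Q _ => ?_).trans ?_)
    · obtain ⟨p, hp0, hp1, hp2, hp3, -⟩ := hp Q
      refine (pr_or_le _ _).trans ?_
      have b1 := hbound Q (r₁ Q) ⟨p, hp0, hp1, hp3⟩
      have b2 := hbound Q (r₂ Q) ⟨p, hp0, hp2, hp3⟩
      linarith
    · rw [nsmul_eq_mul]; gcongr
  have hfin : Real.exp (1 * n) * (2 * Real.exp (-Real.exp (ε / 2 * n))) ≤
      2 * Real.exp (-((c + 1) * n)) := by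
    rw [mul_left_comm, ← Real.exp_add]
    gcongr
    linarith
  have hfin2 : 4 * Real.exp (-((c + 1) * n)) ≤ Real.exp (-(c * n)) := by
    refine (mul_le_mul_of_nonneg_right h4 (Real.exp_pos _).le).trans ?_
    rw [← Real.exp_add, Real.exp_le_exp]; linarith
  have := (pr_mono hincl).trans (pr_or_le _ _)
  refine this.trans ?_
  have hAA : pr A ≤ Real.exp (-((c + 1) * n)) := hA hne
  have := Real.exp_pos (-((c + 1) * n))
  linarith

/-- A pair of codewords of joint type `Q` exists with probability at most about
`exp (n (2R - I))`. -/
lemma eventually_pr_exists_pair_le (QX : X → ℝ) (hR : 0 < R) {ε : ℝ} (hε : 0 < ε) :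
    ∀ᶠ n : ℕ in blockLengths QX, ∀ Q : X × X → ℝ,
      pr (fun C : Book QX R n => ∃ i j, i ≠ j ∧ jointEmpirical (C i).1 (C j).1 = Q) ≤
        Real.exp (n * (2 * R - mutualInfo Q + ε)) := by
  rw [eventually_blockLengths]
  filter_upwards [eventually_exists_pair_prob QX (half_pos hε),
    eventually_const_le_exp 4 (half_pos hε)] with n hp h4 hne Q
  have : Nonempty (typeClass n QX) := hne.to_subtype
  obtain ⟨p, hp0, hp1, hp2, hp3, -⟩ := hp Q
  have hM := numCodewords_le hR n
  refine (pr_exists_pair_le (fun u v : typeClass n QX => jointEmpirical u.1 v.1 = Q)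
    hp1 hp2).trans ?_
  calc p * (numCodewords R n : ℝ) ^ 2
      ≤ Real.exp (n * (-mutualInfo Q + ε / 2)) * (2 * Real.exp (n * R)) ^ 2 := by gcongr
    _ = 4 * Real.exp (n * (2 * R - mutualInfo Q + ε / 2)) := by
        rw [mul_pow, ← Real.exp_nat_mul, mul_left_comm, ← Real.exp_add]
        push_cast; ring_nf
    _ ≤ Real.exp (ε / 2 * n) * Real.exp (n * (2 * R - mutualInfo Q + ε / 2)) := by gcongr
    _ = _ := by rw [← Real.exp_add]; ring_nf

lemma one_le_pairCount {Ω : Type*} {M : ℕ} [Fintype Ω] (r : Ω → Ω → Prop) (C : Fin M → Ω)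
    (h : 0 < pairCount r C) : 1 ≤ pairCount r C := by
  have : pairCount r C = ((∑ i, ∑ j, if i < j ∧ r (C i) (C j) then 1 else 0 : ℕ) : ℝ) := by
    simp only [pairCount, laterCount, Nat.cast_sum, Nat.cast_ite, Nat.cast_one, Nat.cast_zero]
  rw [this] at h ⊢
  exact_mod_cast h

/-- About `exp (n [2R - I]₊)` pairs of a given joint type occur with probability at least about
`exp (-n [I - 2R]₊)`. -/
lemma eventually_le_pr_typePairs (QX : X → ℝ) (hR : 0 < R) {ε : ℝ} (hε : 0 < ε) :
    ∀ᶠ n : ℕ in atTop, ∀ u v : typeClass n QX,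
      Real.exp (-(n * (max 0 (mutualInfo (jointEmpirical u.1 v.1) - 2 * R) + ε))) ≤
      pr (fun C : Book QX R n =>
        Real.exp (n * (max 0 (2 * R - mutualInfo (jointEmpirical u.1 v.1)) - ε)) ≤
          typePairs (jointEmpirical u.1 v.1) C) := by
  have hε4 : 0 < ε / 4 := by linarith
  filter_upwards [eventually_exists_pair_prob QX hε4, eventually_const_le_exp 32 hε4,
    eventually_gt_atTop 0] with n hp h32 hn u v
  have : Nonempty (typeClass n QX) := ⟨u⟩
  have hn0 : (0 : ℝ) < n := by exact_mod_cast hn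
  obtain ⟨p, hp0, hp1, hp2, -, hp4⟩ := hp (jointEmpirical u.1 v.1)
  replace hp4 := hp4 ⟨u, v, rfl⟩
  set Q := jointEmpirical u.1 v.1
  set M : ℝ := (numCodewords R n : ℝ) with hMdef
  have hM2 : (2 : ℝ) ≤ M := by
    rw [hMdef]; exact_mod_cast two_le_numCodewords hR hn
  have hMe := exp_le_numCodewords R n
  rw [← hMdef] at hMe
  set μ : ℝ := p * (M * (M - 1) / 2) with hμ
  have hppos : 0 < p := (Real.exp_pos _).trans_le hp4
  have hμ0 : 0 < μ := by
    have : 0 < M - 1 := by linarith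
    positivity
  have hμle : Real.exp (n * (2 * R - mutualInfo Q - ε / 4)) ≤ 4 * μ := by
    calc Real.exp (n * (2 * R - mutualInfo Q - ε / 4))
        = Real.exp (n * (-mutualInfo Q - ε / 4)) * Real.exp (n * R) ^ 2 := by
          rw [← Real.exp_nat_mul, ← Real.exp_add]; push_cast; ring_nf
      _ ≤ p * M ^ 2 := by gcongr
      _ ≤ 4 * μ := by rw [hμ]; nlinarith
  have hμle' : 8 * Real.exp (n * (2 * R - mutualInfo Q - ε)) ≤ μ := by
    have : 32 * Real.exp (n * (2 * R - mutualInfo Q - ε)) ≤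
        Real.exp (n * (2 * R - mutualInfo Q - ε / 4)) := by
      refine (mul_le_mul_of_nonneg_right h32 (Real.exp_pos _).le).trans ?_
      rw [← Real.exp_add, Real.exp_le_exp]
      nlinarith
    linarith
  have hPZ := le_pr_le_pairCount (M := numCodewords R n)
    (fun u v : typeClass n QX => jointEmpirical u.1 v.1 = Q) hp1 hp2 hμ hμ0
  refine le_trans ?_ (hPZ.trans (pr_mono fun C hC => ?_))
  · rw [le_div_iff₀ (by positivity)]
    rcases le_total 1 μ with h1 | h1
    · have e1 : 32 * Real.exp (-(n * (max 0 (mutualInfo Q - 2 * R) + ε))) ≤ 1 := by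
        refine (mul_le_mul_of_nonneg_right h32 (Real.exp_pos _).le).trans ?_
        rw [← Real.exp_add, Real.exp_le_one_iff]
        have := le_max_left 0 (mutualInfo Q - 2 * R)
        nlinarith
      nlinarith [Real.exp_pos (-(n * (max 0 (mutualInfo Q - 2 * R) + ε)))]
    · have e1 : Real.exp (-(n * (max 0 (mutualInfo Q - 2 * R) + ε))) ≤
          Real.exp (n * (2 * R - mutualInfo Q - ε)) := by
        rw [Real.exp_le_exp]
        have := le_max_right 0 (mutualInfo Q - 2 * R)
        nlinarith
      nlinarith [Real.exp_pos (-(n * (max 0 (mutualInfo Q - 2 * R) + ε)))]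
  · have hge : pairCount (fun u v : typeClass n QX => jointEmpirical u.1 v.1 = Q) C ≤
        typePairs Q C := by
      rw [typePairs_eq]; linarith [pairCount_nonneg
        (fun u v : typeClass n QX => jointEmpirical v.1 u.1 = Q) C]
    refine le_trans ?_ hge
    rcases le_total 0 (2 * R - mutualInfo Q) with h | h
    · rw [max_eq_right h]; linarith [Real.exp_pos (n * (2 * R - mutualInfo Q - ε))]
    · rw [max_eq_left h]
      refine le_trans ?_ (one_le_pairCount _ C (lt_of_lt_of_le (half_pos hμ0) hC))
      rw [Real.exp_le_one_iff]
      nlinarith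

end Enumerators

/-! ### The decoder on typical codebooks -/

section Decoder

open scoped BigOperators Classical

variable {X Y : Type*} [Fintype X] [DecidableEq X] [Fintype Y] [DecidableEq Y]
  {QX : X → ℝ} {R : ℝ} {W : X → Y → ℝ} {g : (X × Y → ℝ) → ℝ}

/-- The normalization of the decoder. -/
noncomputable def decoderSum (g : (X × Y → ℝ) → ℝ) {M n : ℕ} (C : Codebook X M n)
    (y : Fin n → Y) : ℝ :=
  ∑ k, Real.exp (n * g (jointEmpirical (C k) y))

/-- The codewords of a book, as sequences. -/
def Book.words {n : ℕ} (C : Book QX R n) : Codebook X (numCodewords R n) n := fun m => (C m).1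

lemma exp_le_decoderSum {M n : ℕ} (C : Codebook X M n) (y : Fin n → Y) (k : Fin M) :
    Real.exp (n * g (jointEmpirical (C k) y)) ≤ decoderSum g C y :=
  Finset.single_le_sum (f := fun k => Real.exp (n * g (jointEmpirical (C k) y)))
    (fun _ _ => (Real.exp_pos _).le) (Finset.mem_univ k)

lemma decoderSum_eq {n : ℕ} (C : Book QX R n) (y : Fin n → Y) :
    decoderSum g C.words y = ∑ Q ∈ allTypes (X × Y) n,
      count (fun u : typeClass n QX => jointEmpirical u.1 y = Q) C * Real.exp (n * g Q) := by
  simp only [decoderSum, count, Finset.sum_mul]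
  rw [Finset.sum_comm]
  refine Finset.sum_congr rfl fun k _ => ?_
  rw [Finset.sum_eq_single (jointEmpirical (C k).1 y)]
  · simp [Book.words]
  · intro Q _ hQ
    rw [if_neg (Ne.symm hQ), zero_mul]
  · intro h
    exact absurd (empirical_mem_allTypes _) h

/-- The event that some output sequence has atypically few codewords of some joint type. -/
def FewCodewords (Y : Type*) [Fintype Y] [DecidableEq Y] (η : ℝ) {n : ℕ} (C : Book QX R n) :
    Prop :=
  ∃ y : Fin n → Y, ∃ Q ∈ allTypes (X × Y) n,
    (∃ u : typeClass n QX, jointEmpirical u.1 y = Q) ∧ mutualInfo Q ≤ R - η ∧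
    count (fun u : typeClass n QX => jointEmpirical u.1 y = Q) C <
      Real.exp (n * (R - mutualInfo Q - η))

/-- The event that some output sequence has atypically many codewords of some joint type. -/
def ManyCodewords (Y : Type*) [Fintype Y] [DecidableEq Y] (η : ℝ) {n : ℕ} (C : Book QX R n) :
    Prop :=
  ∃ y : Fin n → Y, ∃ Q ∈ allTypes (X × Y) n,
    Real.exp (n * (max 0 (R - mutualInfo Q) + η)) <
      count (fun u : typeClass n QX => jointEmpirical u.1 y = Q) C

/-- The event that atypically many pairs of codewords have some joint type. -/
def ManyPairs (η : ℝ) {n : ℕ} (C : Book QX R n) : Prop :=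
  ∃ Q ∈ allTypes (X × X) n,
    Real.exp (n * (max 0 (2 * R - mutualInfo Q) + η)) < typePairs Q C

lemma eventually_div_lt (K : ℝ) {δ : ℝ} (hδ : 0 < δ) : ∀ᶠ n : ℕ in atTop, K / n < δ :=
  (tendsto_const_div_atTop_nhds_zero_nat K).eventually (gt_mem_nhds hδ)

/-- On typical codebooks the normalization of the decoder is at least `exp (n (α - ε))`
simultaneously for all outputs. -/
lemma exists_exp_alpha_le_decoderSum (hg : ContinuousOn g (stdSimplex ℝ (X × Y)))
    (hQX : QX ∈ stdSimplex ℝ X) (hR : 0 < R) {ε : ℝ} (hε : 0 < ε) :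
    ∃ η > 0, ∀ᶠ n : ℕ in atTop, ∀ C : Book QX R n, ¬ FewCodewords Y η C → ∀ y : Fin n → Y,
      (typeClass n QX).Nonempty →
      Real.exp (n * (alpha g QX R (empirical y) - ε)) ≤ decoderSum g C.words y := by
  have hε3 : 0 < ε / 3 := by linarith
  obtain ⟨η, hη, hα⟩ := exists_near_alpha hg hQX hR hε3
  obtain ⟨δ₁, hδ₁, h₁⟩ := exists_delta_of_continuousOn (A := X × Y) continuousOn_mutualInfo
    (half_pos hη)
  obtain ⟨δ₂, hδ₂, h₂⟩ := exists_delta_of_continuousOn (continuousOn_sub_mutualInfo hg) hε3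
  refine ⟨min (η / 2) (ε / 3), lt_min (half_pos hη) hε3, ?_⟩
  filter_upwards [eventually_div_lt (Fintype.card (X × Y)) (lt_min hδ₁ hδ₂),
    eventually_gt_atTop 0] with n hn hn0 C hC y ⟨x₀, hx₀⟩
  have hx₀' : empirical x₀ = QX := hx₀
  obtain ⟨Q, hQ, hI, hgQ⟩ := hα _ (empirical_mem hn0 y)
  rw [← hx₀'] at hQ
  obtain ⟨x, hx, hd⟩ := exists_jointEmpirical_dist_le hn0 x₀ y hQ
  have hd' := hd.trans_lt hn
  have hmem := jointEmpirical_mem hn0 x y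
  have e1 := abs_lt.1 (h₁ _ hmem Q hQ.1 (hd'.trans_le (min_le_left _ _)))
  have e2 := abs_lt.1 (h₂ _ hmem Q hQ.1 (hd'.trans_le (min_le_right _ _)))
  simp only [FewCodewords, not_exists, not_and, not_lt] at hC
  have hm1 := min_le_left (η / 2) (ε / 3)
  have hm2 := min_le_right (η / 2) (ε / 3)
  have hcnt := hC y (jointEmpirical x y) (empirical_mem_allTypes _) ⟨⟨x, hx.trans hx₀'⟩, rfl⟩
    (by linarith [e1.2])
  rw [decoderSum_eq]
  refine le_trans ?_ (Finset.single_le_sum (f := fun Q => count (fun u : typeClass n QX =>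
    jointEmpirical u.1 y = Q) C * Real.exp (n * g Q))
    (fun Q _ => mul_nonneg (count_nonneg _ _) (Real.exp_pos _).le)
    (empirical_mem_allTypes (fun t => (x t, y t))))
  refine le_trans ?_ (mul_le_mul_of_nonneg_right hcnt (Real.exp_pos _).le)
  rw [← Real.exp_add, Real.exp_le_exp, ← mul_add]
  refine mul_le_mul_of_nonneg_left ?_ (Nat.cast_nonneg n)
  change _ ≤ _ + g (jointEmpirical x y)
  linarith [e2.1]

/-- On typical codebooks the normalization of the decoder is at most `exp (n (β + ε))`
simultaneously for all outputs. -/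
lemma eventually_decoderSum_le_exp_beta (hg : ContinuousOn g (stdSimplex ℝ (X × Y)))
    {ε : ℝ} (hε : 0 < ε) :
    ∀ᶠ n : ℕ in atTop, ∀ C : Book QX R n, ¬ ManyCodewords Y (ε / 2) C → ∀ y : Fin n → Y,
      decoderSum g C.words y ≤ Real.exp (n * (beta g QX R (empirical y) + ε)) := by
  filter_upwards [eventually_card_allTypes_le (X × Y) (half_pos hε),
    eventually_gt_atTop 0] with n hn hn0 C hC y
  simp only [ManyCodewords, not_exists, not_and, not_lt] at hC
  rw [decoderSum_eq]
  have hterm : ∀ Q ∈ allTypes (X × Y) n, count (fun u : typeClass n QX =>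
      jointEmpirical u.1 y = Q) C * Real.exp (n * g Q) ≤
      Real.exp (n * (beta g QX R (empirical y) + ε / 2)) := by
    intro Q hQ
    by_cases hex : ∃ u : typeClass n QX, jointEmpirical u.1 y = Q
    · obtain ⟨u, rfl⟩ := hex
      refine (mul_le_mul_of_nonneg_right (hC y _ hQ) (Real.exp_pos _).le).trans ?_
      rw [← Real.exp_add, Real.exp_le_exp, ← mul_add]
      refine mul_le_mul_of_nonneg_left ?_ (Nat.cast_nonneg n)
      have hc := jointEmpirical_mem_couplings hn0 u.1 y
      rw [show empirical u.1 = QX from u.2] at hc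
      linarith [le_beta (R := R) hg hc]
    · push Not at hex
      have : count (fun u : typeClass n QX => jointEmpirical u.1 y = Q) C = 0 :=
        Finset.sum_eq_zero fun k _ => if_neg (hex _)
      rw [this, zero_mul]
      exact (Real.exp_pos _).le
  refine (Finset.sum_le_card_nsmul _ _ _ hterm).trans ?_
  rw [nsmul_eq_mul]
  refine (mul_le_mul_of_nonneg_right hn (Real.exp_pos _).le).trans ?_
  rw [← Real.exp_add, Real.exp_le_exp]
  linarith

/-- The probability of the outputs in one joint type with a pair of inputs, the first of which is
sent. -/
lemma eventually_card_mul_prod_channel (hW : ∀ x, W x ∈ stdSimplex ℝ Y) {ε : ℝ} (hε : 0 < ε) :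
    ∀ᶠ n : ℕ in atTop, ∀ (x x' : Fin n → X) (y : Fin n → Y),
      ChannelAC W (jointEmpirical x y) →
      Real.exp (-(n * (transCost W (tripleEmpirical x x' y) + ε))) ≤
        ((Finset.univ.filter fun z =>
          tripleEmpirical x x' z = tripleEmpirical x x' y).card : ℝ) * ∏ t, W (x t) (y t) ∧
      ((Finset.univ.filter fun z =>
          tripleEmpirical x x' z = tripleEmpirical x x' y).card : ℝ) * ∏ t, W (x t) (y t) ≤
        Real.exp (-(n * (transCost W (tripleEmpirical x x' y) - ε))) := by
  filter_upwards [eventually_abs_log_card_triple X Y hε, eventually_gt_atTop 0]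
    with n hn hn0 x x' y hac
  have e := abs_le.1 (hn x x' y)
  have hc : (0 : ℝ) < (Finset.univ.filter fun z =>
      tripleEmpirical x x' z = tripleEmpirical x x' y).card := by
    exact_mod_cast Finset.card_pos.2 ⟨y, by simp⟩
  rw [prod_channel_eq_exp (fun a b => (hW a).1 b) x y hac hn0]
  conv_rhs => rw [← Real.exp_log hc, ← Real.exp_add]
  conv =>
    enter [1, 2]
    rw [← Real.exp_log hc, ← Real.exp_add]
  rw [Real.exp_le_exp, Real.exp_le_exp, transCost, margXX'_tripleEmpirical,
    margXY_tripleEmpirical]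
  constructor <;> linarith [e.1, e.2]

/-- The contribution of a pair of codewords to the error probability of a typical codebook is at
most `exp (-n (Γ - ε))`. -/
lemma eventually_sum_channel_mul_exp_le (hW : ∀ x, W x ∈ stdSimplex ℝ Y) {ε : ℝ} (hε : 0 < ε) :
    ∀ᶠ n : ℕ in atTop, ∀ (x x' : Fin n → X) (γ : ℝ),
      (γ : EReal) ≤ Gam W g QX R (jointEmpirical x x') →
      ∑ y : Fin n → Y, (∏ t, W (x t) (y t)) *
        Real.exp (-(n * gamPenalty g QX R (tripleEmpirical x x' y))) ≤
      Real.exp (-(n * (γ - ε))) := by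
  filter_upwards [eventually_card_mul_prod_channel hW (half_pos hε),
    eventually_card_allTypes_le (X × X × Y) (half_pos hε), eventually_gt_atTop 0]
    with n hn hcard hn0 x x' γ hγ
  rw [← Finset.sum_fiberwise_of_maps_to (s := Finset.univ) (t := allTypes (X × X × Y) n)
    (g := fun y => tripleEmpirical x x' y) (fun y _ => empirical_mem_allTypes _)]
  have hterm : ∀ P ∈ allTypes (X × X × Y) n,
      ∑ y : Fin n → Y with tripleEmpirical x x' y = P, (∏ t, W (x t) (y t)) *
        Real.exp (-(n * gamPenalty g QX R (tripleEmpirical x x' y))) ≤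
      Real.exp (-(n * (γ - ε / 2))) := by
    intro P _
    have hbd : ∀ y ∈ (Finset.univ.filter fun y : Fin n → Y => tripleEmpirical x x' y = P),
        (∏ t, W (x t) (y t)) * Real.exp (-(n * gamPenalty g QX R (tripleEmpirical x x' y))) ≤
        Real.exp (-(n * (γ - ε / 2))) /
          (Finset.univ.filter fun y : Fin n → Y => tripleEmpirical x x' y = P).card := by
      intro y hy
      have hyP := (Finset.mem_filter.1 hy).2
      by_cases hac : ChannelAC W (jointEmpirical x y)
      · have h1 := (hn x x' y hac).2
        have hext : tripleEmpirical x x' y ∈ extensions Y (jointEmpirical x x') :=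
          ⟨tripleEmpirical_mem hn0 x x' y, margXX'_tripleEmpirical x x' y⟩
        have h2 := hγ.trans (Gam_le_of_ac hext (by rw [margXY_tripleEmpirical]; exact hac))
        rw [EReal.coe_le_coe_iff] at h2
        rw [hyP] at h1 h2 ⊢
        have hc : (0 : ℝ) <
            (Finset.univ.filter fun y : Fin n → Y => tripleEmpirical x x' y = P).card := by
          exact_mod_cast Finset.card_pos.2 ⟨y, hy⟩
        rw [le_div_iff₀ hc]
        calc _ = ((Finset.univ.filter fun y : Fin n → Y => tripleEmpirical x x' y = P).card *
              ∏ t, W (x t) (y t)) * Real.exp (-(n * gamPenalty g QX R P)) := by ring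
          _ ≤ Real.exp (-(n * (transCost W P - ε / 2))) *
              Real.exp (-(n * gamPenalty g QX R P)) :=
            mul_le_mul_of_nonneg_right h1 (Real.exp_pos _).le
          _ ≤ _ := by
            rw [← Real.exp_add, Real.exp_le_exp]
            have : (0 : ℝ) ≤ n := Nat.cast_nonneg n
            nlinarith
      · rw [prod_channel_eq_zero hac, zero_mul]
        positivity
    refine (Finset.sum_le_card_nsmul _ _ _ hbd).trans ?_
    rw [nsmul_eq_mul]
    rcases eq_or_ne ((Finset.univ.filter fun y : Fin n → Y =>
        tripleEmpirical x x' y = P).card : ℝ) 0 with h | h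
    · rw [h, zero_mul]; exact (Real.exp_pos _).le
    · rw [mul_div_assoc', mul_div_cancel_left₀ _ h]
  refine (Finset.sum_le_card_nsmul _ _ _ hterm).trans ?_
  rw [nsmul_eq_mul]
  refine (mul_le_mul_of_nonneg_right hcard (Real.exp_pos _).le).trans ?_
  rw [← Real.exp_add, Real.exp_le_exp]
  linarith

/-- If the normalization of the decoder is at least `exp (n (α - ε))`, then the probability of
deciding for a wrong message is governed by the penalty in `Gam`. -/
lemma gld_le_exp_gamPenalty {M n : ℕ} {C : Codebook X M n} {y : Fin n → Y} {ε : ℝ} (hε : 0 < ε)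
    (h : Real.exp (n * (alpha g QX R (empirical y) - ε)) ≤ decoderSum g C y) (m m' : Fin M) :
    gld g C y m' ≤
      Real.exp (-(n * gamPenalty g QX R (tripleEmpirical (C m) (C m') y)) + n * ε) := by
  have hpos : 0 < decoderSum g C y := (Real.exp_pos _).trans_le h
  have hn : (0 : ℝ) ≤ n := Nat.cast_nonneg n
  have h1 := exp_le_decoderSum (g := g) C y m
  have h2 := exp_le_decoderSum (g := g) C y m'
  change Real.exp _ / decoderSum g C y ≤ _
  rw [div_le_iff₀ hpos, gamPenalty, margXY_tripleEmpirical, margX'Y_tripleEmpirical,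
    marg₂_jointEmpirical]
  set a := g (jointEmpirical (C m) y)
  set b := alpha g QX R (empirical y)
  set c := g (jointEmpirical (C m') y)
  have key : ∀ s, Real.exp (n * s) ≤ decoderSum g C y → ∀ r, c ≤ r + s →
      Real.exp (n * c) ≤ Real.exp (n * r) * decoderSum g C y := by
    intro s hs r hr
    refine le_trans ?_ (mul_le_mul_of_nonneg_left hs (Real.exp_pos _).le)
    rw [← Real.exp_add, Real.exp_le_exp]
    nlinarith
  have e : -((n : ℝ) * max 0 (max a b - c)) + n * ε = n * (ε - max 0 (max a b - c)) := by ring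
  rw [e]
  rcases max_cases 0 (max a b - c) with h3 | h3 <;> rw [h3.1]
  · exact key c h2 _ (by linarith)
  · rcases max_cases a b with h4 | h4 <;> rw [h4.1]
    · exact key a h1 _ (by linarith)
    · exact key (b - ε) h _ (by linarith)

lemma sum_pairs_eq_sum_types {n : ℕ} (C : Book QX R n) (φ : (X × X → ℝ) → ℝ) :
    (∑ m, ∑ m' ∈ Finset.univ.filter (fun m' => m' ≠ m), φ (jointEmpirical (C m).1 (C m').1)) =
      ∑ Q ∈ allTypes (X × X) n, typePairs Q C * φ Q := by
  simp only [typePairs, Finset.sum_mul, Finset.sum_filter]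
  rw [Finset.sum_comm (s := allTypes (X × X) n)]
  refine Finset.sum_congr rfl fun m _ => ?_
  rw [Finset.sum_comm (s := allTypes (X × X) n)]
  refine Finset.sum_congr rfl fun m' _ => ?_
  by_cases hm : m = m'
  · simp [hm]
  rw [if_pos (Ne.symm hm), Finset.sum_eq_single (jointEmpirical (C m).1 (C m').1)]
  · simp [hm]
  · intro Q _ hQ
    rw [if_neg fun h => hQ h.2.symm, zero_mul]
  · intro h
    exact absurd (empirical_mem_allTypes _) h

/-- A codebook that is typical and has no pair of codewords with joint type in the set
`setL W g QX R (E₀ + δ)` has error probability below `exp (-n E₀)`. -/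
lemma exists_errorProb_lt (hW : ∀ x, W x ∈ stdSimplex ℝ Y)
    (hg : ContinuousOn g (stdSimplex ℝ (X × Y))) (hQX : QX ∈ stdSimplex ℝ X) (hR : 0 < R)
    (E₀ : ℝ) {δ : ℝ} (hδ : 0 < δ) :
    ∃ η > 0, ∀ᶠ n : ℕ in blockLengths QX, ∀ C : Book QX R n, ¬ FewCodewords Y η C →
      ¬ ManyPairs (δ / 8) C →
      (∀ i j, i ≠ j → jointEmpirical (C i).1 (C j).1 ∉ setL W g QX R (E₀ + δ)) →
      errorProb W g C.words < Real.exp (-(n * E₀)) := by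
  have hε : 0 < δ / 8 := by linarith
  obtain ⟨η, hη, hα⟩ := exists_exp_alpha_le_decoderSum hg hQX hR hε
  refine ⟨η, hη, ?_⟩
  rw [eventually_blockLengths]
  filter_upwards [hα, eventually_sum_channel_mul_exp_le (g := g) (QX := QX) (R := R) hW hε,
    eventually_card_allTypes_le (X × X) hε, eventually_gt_atTop 0]
    with n hα hΓ hcard hn0 hne C hC1 hC2 hC3
  have hn : (0 : ℝ) < n := by exact_mod_cast hn0
  set ε := δ / 8 with hεdef
  set γ : (X × X → ℝ) → ℝ := fun Q => max 0 (2 * R - mutualInfo Q) - R + (E₀ + δ) with hγ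
  have hM : Real.exp (n * R) ≤ numCodewords R n := exp_le_numCodewords R n
  have hM0 : (0 : ℝ) < numCodewords R n := (Real.exp_pos _).trans_le hM
  have hpair : ∀ m m', m' ≠ m → ∑ y : Fin n → Y, (∏ t, W (C.words m t) (y t)) *
      gld g C.words y m' ≤ Real.exp (-(n * (γ (jointEmpirical (C m).1 (C m').1) - 2 * ε))) := by
    intro m m' hmm
    have hnot := hC3 m m' (Ne.symm hmm)
    have hcoup : jointEmpirical (C m).1 (C m').1 ∈ couplings QX QX := by
      have h := jointEmpirical_mem_couplings hn0 (C m).1 (C m').1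
      rwa [show empirical (C m).1 = QX from (C m).2,
        show empirical (C m').1 = QX from (C m').2] at h
    have hΓlt : ((γ (jointEmpirical (C m).1 (C m').1) : ℝ) : EReal) ≤
        Gam W g QX R (jointEmpirical (C m).1 (C m').1) := by
      refine (not_le.1 fun hle => hnot ⟨hcoup, Psi_le_coe_iff.2 hle⟩).le
    have h1 := hΓ (C m).1 (C m').1 _ hΓlt
    calc _ ≤ ∑ y : Fin n → Y, ((∏ t, W ((C m).1 t) (y t)) *
          Real.exp (-(n * gamPenalty g QX R (tripleEmpirical (C m).1 (C m').1 y)))) *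
            Real.exp (n * ε) := by
          refine Finset.sum_le_sum fun y _ => ?_
          have h2 := gld_le_exp_gamPenalty hε (hα C hC1 y hne) m m'
          rw [Real.exp_add] at h2
          rw [mul_assoc]
          exact mul_le_mul_of_nonneg_left h2 (Finset.prod_nonneg fun t _ => (hW _).1 _)
      _ ≤ Real.exp (-(n * (γ (jointEmpirical (C m).1 (C m').1) - ε))) * Real.exp (n * ε) := by
          rw [← Finset.sum_mul]
          exact mul_le_mul_of_nonneg_right h1 (Real.exp_pos _).le
      _ = _ := by rw [← Real.exp_add]; congr 1; ring
  have hsum : (∑ m, ∑ m' ∈ Finset.univ.filter (fun m' => m' ≠ m),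
      ∑ y : Fin n → Y, (∏ t, W (C.words m t) (y t)) * gld g C.words y m') ≤
      Real.exp (n * (R - E₀ - δ + 4 * ε)) := by
    calc _ ≤ ∑ m, ∑ m' ∈ Finset.univ.filter (fun m' => m' ≠ m),
          Real.exp (-(n * (γ (jointEmpirical (C m).1 (C m').1) - 2 * ε))) :=
          Finset.sum_le_sum fun m _ => Finset.sum_le_sum fun m' hm' =>
            hpair m m' (Finset.mem_filter.1 hm').2
      _ = ∑ Q ∈ allTypes (X × X) n, typePairs Q C * Real.exp (-(n * (γ Q - 2 * ε))) :=
          sum_pairs_eq_sum_types C fun Q => Real.exp (-(n * (γ Q - 2 * ε)))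
      _ ≤ (allTypes (X × X) n).card • Real.exp (n * (R - E₀ - δ + 3 * ε)) := by
          refine Finset.sum_le_card_nsmul _ _ _ fun Q hQ => ?_
          simp only [ManyPairs, not_exists, not_and, not_lt] at hC2
          refine (mul_le_mul_of_nonneg_right (hC2 Q hQ) (Real.exp_pos _).le).trans ?_
          rw [← Real.exp_add, Real.exp_le_exp, hγ]
          linarith
      _ ≤ Real.exp (ε * n) * Real.exp (n * (R - E₀ - δ + 3 * ε)) := by
          rw [nsmul_eq_mul]
          exact mul_le_mul_of_nonneg_right hcard (Real.exp_pos _).le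
      _ = _ := by rw [← Real.exp_add]; congr 1; ring
  unfold errorProb
  rw [one_div, inv_mul_lt_iff₀ hM0]
  refine hsum.trans_lt (lt_of_lt_of_le ?_
    (mul_le_mul_of_nonneg_right hM (Real.exp_pos _).le))
  rw [← Real.exp_add, Real.exp_lt_exp]
  nlinarith

/-- A typical codebook with `N` pairs of codewords in the joint type of `(x, x')` has error
probability at least `N` times what these pairs contribute through outputs of the joint type
of `(x, x', y)`. -/
lemma eventually_le_errorProb (hW : ∀ x, W x ∈ stdSimplex ℝ Y)
    (hg : ContinuousOn g (stdSimplex ℝ (X × Y))) (hR : 0 < R) {ε : ℝ} (hε : 0 < ε) :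
    ∀ᶠ n : ℕ in atTop, ∀ C : Book QX R n, ¬ ManyCodewords Y (ε / 2) C →
      ∀ (x x' : Fin n → X) (y : Fin n → Y), ChannelAC W (jointEmpirical x y) →
      typePairs (jointEmpirical x x') C * Real.exp (-(n * (R + transCost W (tripleEmpirical x x' y)
        + beta g QX R (empirical y) - g (jointEmpirical x' y) + 3 * ε))) ≤
        errorProb W g C.words := by
  filter_upwards [eventually_decoderSum_le_exp_beta (QX := QX) (R := R) hg hε,
    eventually_card_mul_prod_channel hW hε, eventually_const_le_exp 2 hε]
    with n hβ hcard h2 C hC x x' y hac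
  have hn : (0 : ℝ) ≤ n := Nat.cast_nonneg n
  set κ : ℝ := transCost W (tripleEmpirical x x' y) + beta g QX R (empirical y) -
    g (jointEmpirical x' y) + 2 * ε with hκ
  have hgld0 : ∀ z m', 0 ≤ gld g C.words z m' := fun z m' =>
    div_nonneg (Real.exp_pos _).le (Finset.sum_nonneg fun _ _ => (Real.exp_pos _).le)
  have hW0 : ∀ m (z : Fin n → Y), 0 ≤ ∏ t, W (C.words m t) (z t) := fun m z =>
    Finset.prod_nonneg fun t _ => (hW _).1 _
  have hM := numCodewords_le hR n
  have hM0 : (0 : ℝ) < numCodewords R n := (Real.exp_pos _).trans_le (exp_le_numCodewords R n)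
  have hpair : ∀ m m', jointEmpirical (C m).1 (C m').1 = jointEmpirical x x' →
      Real.exp (-(n * κ)) ≤
      ∑ z : Fin n → Y, (∏ t, W (C.words m t) (z t)) * gld g C.words z m' := by
    intro m m' hmm
    obtain ⟨σ, hσ⟩ := exists_perm_of_empirical_eq hmm
    have hσ1 : (C m).1 = x ∘ σ := by funext t; exact congrArg Prod.fst (congrFun hσ t)
    have hσ2 : (C m').1 = x' ∘ σ := by funext t; exact congrArg Prod.snd (congrFun hσ t)
    have htrip : tripleEmpirical (C m).1 (C m').1 (y ∘ σ) = tripleEmpirical x x' y := by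
      rw [hσ1, hσ2]; exact empirical_comp_perm (fun t => (x t, x' t, y t)) σ
    -- All quantities depend on the output `z` through its joint type with the pair only.
    have hz : ∀ z : Fin n → Y, tripleEmpirical (C m).1 (C m').1 z = tripleEmpirical x x' y →
        jointEmpirical (C m).1 z = jointEmpirical x y ∧
        jointEmpirical (C m').1 z = jointEmpirical x' y ∧ empirical z = empirical y := by
      intro z h
      refine ⟨?_, ?_, ?_⟩
      · rw [← margXY_tripleEmpirical (C m).1 (C m').1, h, margXY_tripleEmpirical]
      · rw [← margX'Y_tripleEmpirical (C m).1 (C m').1, h, margX'Y_tripleEmpirical]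
      · rw [← marg₂_jointEmpirical (C m).1 z, ← margXY_tripleEmpirical (C m).1 (C m').1, h,
          margXY_tripleEmpirical, marg₂_jointEmpirical]
    have hc := (hcard (C m).1 (C m').1 (y ∘ σ) (by rw [(hz _ htrip).1]; exact hac)).1
    rw [htrip] at hc
    calc Real.exp (-(n * κ))
        = Real.exp (-(n * (transCost W (tripleEmpirical x x' y) + ε))) *
          Real.exp (n * (g (jointEmpirical x' y) - beta g QX R (empirical y) - ε)) := by
          rw [← Real.exp_add, hκ]; congr 1; ring
      _ ≤ _ := mul_le_mul_of_nonneg_right hc (Real.exp_pos _).le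
      _ = ∑ z : Fin n → Y with tripleEmpirical (C m).1 (C m').1 z = tripleEmpirical x x' y,
            (∏ t, W ((C m).1 t) ((y ∘ σ) t)) *
            Real.exp (n * (g (jointEmpirical x' y) - beta g QX R (empirical y) - ε)) := by
          rw [Finset.sum_const, nsmul_eq_mul, mul_assoc]
      _ ≤ ∑ z : Fin n → Y with tripleEmpirical (C m).1 (C m').1 z = tripleEmpirical x x' y,
            (∏ t, W (C.words m t) (z t)) * gld g C.words z m' := by
          refine Finset.sum_le_sum fun z hzf => ?_
          obtain ⟨hz1, hz2, hz3⟩ := hz z (Finset.mem_filter.1 hzf).2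
          obtain ⟨hy1, -, -⟩ := hz _ htrip
          rcases Nat.eq_zero_or_pos n with h0 | h0
          · subst h0
            have hzy : z = y ∘ σ := Subsingleton.elim _ _
            have := hβ C hC z
            simp only [Finset.univ_eq_empty, Finset.prod_empty, one_mul, gld]
            change _ ≤ _ / decoderSum g C.words z
            simp only [Nat.cast_zero, zero_mul, Real.exp_zero] at this ⊢
            exact (one_le_div (lt_of_lt_of_le (by simp)
              (exp_le_decoderSum (g := g) C.words z m'))).2 this
          have hprod : ∏ t, W ((C m).1 t) ((y ∘ σ) t) = ∏ t, W (C.words m t) (z t) := by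
            rw [prod_channel_eq_exp (fun a b => (hW a).1 b) (C m).1 (y ∘ σ)
                (by rw [hy1]; exact hac) h0]
            change _ = ∏ t, W ((C m).1 t) (z t)
            rw [prod_channel_eq_exp (fun a b => (hW a).1 b) (C m).1 z
                (by rw [hz1]; exact hac) h0, hy1, hz1]
          rw [hprod]
          refine mul_le_mul_of_nonneg_left ?_ (hW0 m z)
          change _ ≤ Real.exp (n * g (jointEmpirical (C m').1 z)) / decoderSum g C.words z
          rw [hz2, le_div_iff₀ (lt_of_lt_of_le (Real.exp_pos _)
            (exp_le_decoderSum (g := g) C.words z m'))]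
          refine (mul_le_mul_of_nonneg_left (hβ C hC z) (Real.exp_pos _).le).trans ?_
          rw [← Real.exp_add, Real.exp_le_exp, hz3]
          linarith
      _ ≤ _ := Finset.sum_le_sum_of_subset_of_nonneg (Finset.filter_subset _ _)
          fun z _ _ => mul_nonneg (hW0 m z) (hgld0 z m')
  have hsum : typePairs (jointEmpirical x x') C * Real.exp (-(n * κ)) ≤
      ∑ m, ∑ m' ∈ Finset.univ.filter (fun m' => m' ≠ m),
      ∑ z : Fin n → Y, (∏ t, W (C.words m t) (z t)) * gld g C.words z m' := by
    simp only [typePairs, Finset.sum_mul, Finset.sum_filter]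
    refine Finset.sum_le_sum fun m _ => Finset.sum_le_sum fun m' _ => ?_
    by_cases hm : m = m'
    · simp [hm]
    rw [if_pos (Ne.symm hm)]
    by_cases hj : jointEmpirical (C m).1 (C m').1 = jointEmpirical x x'
    · rw [if_pos ⟨hm, hj⟩, one_mul]; exact hpair m m' hj
    · rw [if_neg fun h => hj h.2, zero_mul]
      exact Finset.sum_nonneg fun z _ => mul_nonneg (hW0 m z) (hgld0 z m')
  have hN0 : 0 ≤ typePairs (jointEmpirical x x') C :=
    Finset.sum_nonneg fun _ _ => Finset.sum_nonneg fun _ _ => by split_ifs <;> norm_num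
  unfold errorProb
  rw [one_div, ← div_eq_inv_mul, le_div_iff₀ hM0]
  refine le_trans ?_ hsum
  rw [mul_assoc]
  refine mul_le_mul_of_nonneg_left ?_ hN0
  calc _ ≤ Real.exp (-(n * (R + transCost W (tripleEmpirical x x' y)
        + beta g QX R (empirical y) - g (jointEmpirical x' y) + 3 * ε))) *
        (Real.exp (ε * n) * Real.exp (n * R)) := by
        refine mul_le_mul_of_nonneg_left (hM.trans ?_) (Real.exp_pos _).le
        exact mul_le_mul_of_nonneg_right h2 (Real.exp_pos _).le
    _ = _ := by rw [← Real.exp_add, ← Real.exp_add, hκ]; congr 1; ring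

end Decoder

/-! ### The lower tail probability on the exponential scale -/

section Tail

open scoped Classical

variable {X Y : Type*} [Fintype X] [DecidableEq X] [Fintype Y] [DecidableEq Y]
  {QX : X → ℝ} {R : ℝ} {W : X → Y → ℝ} {g : (X × Y → ℝ) → ℝ}

lemma log_ofReal_div {a : ℝ} (ha : 0 < a) (n : ℕ) :
    ENNReal.log (ENNReal.ofReal a) / (n : EReal) = ((Real.log a / n : ℝ) : EReal) := by
  rw [ENNReal.log_ofReal_of_pos ha, EReal.coe_div]
  rfl

lemma errorExponent_le_iff {M n : ℕ} (hn : 0 < n) (C : Codebook X M n) (E : ℝ) :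
    errorExponent W g C ≤ (E : EReal) ↔ Real.exp (-(n * E)) ≤ errorProb W g C := by
  have hn' : (0 : ℝ) < n := by exact_mod_cast hn
  unfold errorExponent
  rcases le_or_gt (errorProb W g C) 0 with h | h
  · rw [ENNReal.ofReal_of_nonpos h, ENNReal.log_zero,
      EReal.bot_div_of_pos_ne_top (by exact_mod_cast hn) (EReal.natCast_ne_top n), EReal.neg_bot,
      top_le_iff]
    exact ⟨fun h' => absurd h' (EReal.coe_ne_top E),
      fun h' => absurd ((Real.exp_pos _).trans_le h') h.not_gt⟩
  · rw [log_ofReal_div h, ← EReal.coe_neg, EReal.coe_le_coe_iff, ← Real.le_log_iff_exp_le h,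
      neg_le, le_div_iff₀ hn']
    constructor <;> intro h' <;> linarith

lemma lowerTailProb_eq [MeasurableSpace X] [DiscreteMeasurableSpace X] {n : ℕ} (hn : 0 < n)
    (hne : (typeClass n QX).Nonempty) (E₀ : ℝ) :
    lowerTailProb W g QX R E₀ n = ENNReal.ofReal (pr fun C : Book QX R n =>
      Real.exp (-(n * E₀)) ≤ errorProb W g C.words) := by
  have : Nonempty (typeClass n QX) := hne.to_subtype
  rw [lowerTailProb, ensemble_apply]
  congr 2
  funext C
  exact propext (errorExponent_le_iff hn _ E₀)

/-- The lower tail event has small probability: a typical codebook can only be in it if it has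
a pair of codewords in `setL`. -/
lemma eventually_pr_errorProb_le (hW : ∀ x, W x ∈ stdSimplex ℝ Y)
    (hg : ContinuousOn g (stdSimplex ℝ (X × Y))) (hQX : QX ∈ stdSimplex ℝ X) (hR : 0 < R)
    {E₀ t t₁ : ℝ} (ht : t < t₁) (ht₁ : (t₁ : EReal) < EltUB W g QX R E₀) :
    ∀ᶠ n : ℕ in blockLengths QX, pr (fun C : Book QX R n =>
      Real.exp (-(n * E₀)) ≤ errorProb W g C.words) ≤ Real.exp (-(n * t)) := by
  rcases le_or_gt t₁ 0 with h0 | h0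
  · rw [eventually_blockLengths]
    refine Eventually.of_forall fun n hne => ?_
    have : Nonempty (typeClass n QX) := hne.to_subtype
    refine (pr_le_one _).trans (Real.one_le_exp ?_)
    have : (0 : ℝ) ≤ n := Nat.cast_nonneg n
    nlinarith
  obtain ⟨δ, hδ, hL⟩ := exists_le_of_lt_EltUB hg hQX hR ht₁
  obtain ⟨η, hη, hgood⟩ := exists_errorProb_lt hW hg hQX hR E₀ hδ
  have hε : 0 < (t₁ - t) / 3 := by linarith
  have h1 := eventually_pr_count_lt (R := R) Y QX hη t₁
  have h2 := eventually_pr_typePairs_gt QX hR (by linarith : 0 < δ / 8) t₁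
  have h3 := eventually_pr_exists_pair_le QX hR hε
  rw [eventually_blockLengths] at hgood h1 h2 h3 ⊢
  filter_upwards [hgood, h1, h2, h3, eventually_card_allTypes_le (X × X) hε,
    eventually_const_le_exp 3 hε] with n hgood h1 h2 h3 hcard hthree hne
  have hn : (0 : ℝ) ≤ n := Nat.cast_nonneg n
  set ε := (t₁ - t) / 3 with hεdef
  have hincl : ∀ C : Book QX R n, Real.exp (-(n * E₀)) ≤ errorProb W g C.words →
      (FewCodewords Y η C ∨ ManyPairs (δ / 8) C) ∨
      ∃ Q ∈ (allTypes (X × X) n).filter (fun Q => Q ∈ setL W g QX R (E₀ + δ)),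
        ∃ i j, i ≠ j ∧ jointEmpirical (C i).1 (C j).1 = Q := by
    intro C hC
    by_contra hcon
    simp only [not_or] at hcon
    refine absurd hC (hgood hne C hcon.1.1 hcon.1.2 fun i j hij hmem => hcon.2 ?_).not_ge
    exact ⟨_, Finset.mem_filter.2 ⟨empirical_mem_allTypes _, hmem⟩, i, j, hij, rfl⟩
  have h3' : pr (fun C : Book QX R n =>
      ∃ Q ∈ (allTypes (X × X) n).filter (fun Q => Q ∈ setL W g QX R (E₀ + δ)),
        ∃ i j, i ≠ j ∧ jointEmpirical (C i).1 (C j).1 = Q) ≤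
      Real.exp (ε * n) * Real.exp (n * (-t₁ + ε)) := by
    refine (pr_exists_le _ _).trans ((Finset.sum_le_card_nsmul _ _
      (Real.exp (n * (-t₁ + ε))) fun Q hQ => ?_).trans ?_)
    · refine (h3 hne Q).trans (Real.exp_le_exp.2 (mul_le_mul_of_nonneg_left ?_ hn))
      have := hL Q (Finset.mem_filter.1 hQ).2
      rcases le_max_iff.1 this with h | h <;> linarith
    · rw [nsmul_eq_mul]
      refine mul_le_mul_of_nonneg_right (le_trans ?_ hcard) (Real.exp_pos _).le
      exact_mod_cast Finset.card_filter_le _ _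
  have hF : pr (fun C : Book QX R n => FewCodewords Y η C) ≤ Real.exp (-(t₁ * n)) := h1 hne
  have hP : pr (fun C : Book QX R n => ManyPairs (δ / 8) C) ≤ Real.exp (-(t₁ * n)) := h2 hne
  have hunion := ((pr_mono hincl).trans (pr_or_le _ _)).trans
    (add_le_add (pr_or_le (fun C : Book QX R n => FewCodewords Y η C) _) h3')
  have e1 : Real.exp (-(t₁ * n)) ≤ Real.exp (n * (-t₁ + 2 * ε)) :=
    Real.exp_le_exp.2 (by nlinarith)
  have e2 : Real.exp (ε * n) * Real.exp (n * (-t₁ + ε)) = Real.exp (n * (-t₁ + 2 * ε)) := by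
    rw [← Real.exp_add]; congr 1; ring
  have e3 : 3 * Real.exp (n * (-t₁ + 2 * ε)) ≤ Real.exp (-(n * t)) := by
    refine (mul_le_mul_of_nonneg_right hthree (Real.exp_pos _).le).trans ?_
    rw [← Real.exp_add, Real.exp_le_exp, hεdef]
    linarith
  linarith

/-- The lower tail event has large probability: it occurs on typical codebooks that have many
pairs of codewords in a type near a given member of `setM`. -/
lemma eventually_le_pr_errorProb (hW : ∀ x, W x ∈ stdSimplex ℝ Y)
    (hg : ContinuousOn g (stdSimplex ℝ (X × Y))) (hQX : QX ∈ stdSimplex ℝ X) (hR : 0 < R)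
    {E₀ E₁ : ℝ} (hE : E₁ < E₀) {Q : X × X → ℝ} (hQ : Q ∈ setM W g QX R E₁) {ε : ℝ} (hε : 0 < ε) :
    ∀ᶠ n : ℕ in blockLengths QX, Real.exp (-(n * (max 0 (mutualInfo Q - 2 * R) + ε))) ≤
      pr (fun C : Book QX R n => Real.exp (-(n * E₀)) ≤ errorProb W g C.words) := by
  set ρ : ℝ := min (ε / 4) ((E₀ - E₁) / 16) with hρdef
  have hρ : 0 < ρ := lt_min (by linarith) (by linarith)
  have hρε : ρ ≤ ε / 4 := min_le_left _ _
  have hρE : ρ ≤ (E₀ - E₁) / 16 := min_le_right _ _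
  set K : ℝ := max 0 (mutualInfo Q - 2 * R) with hK
  have hlam := (Xi_le_coe_iff.1 hQ.2).trans_lt (EReal.coe_lt_coe_iff.2 (lt_add_of_pos_right _ hρ))
  obtain ⟨P, hP, hac, hPlt⟩ := exists_of_Lam_lt hlam
  have hPQ : margXX' P = Q := hP.2
  obtain ⟨δ₁, hδ₁, hβ⟩ := beta_le_add (R := R) hg hQX hρ
  -- Near `P` all the quantities in the exponents change by less than `ρ`.
  have hcontI : ∀ᶠ P' in 𝓝[stdSimplex ℝ (X × X × Y)] P,
      |mutualInfo (margXX' P') - mutualInfo Q| < ρ := by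
    have hc : ContinuousWithinAt (fun P' => mutualInfo (margXX' P'))
        (stdSimplex ℝ (X × X × Y)) P := by
      refine ContinuousWithinAt.comp (g := mutualInfo) (f := margXX')
        (t := stdSimplex ℝ (X × X))
        (continuousOn_mutualInfo _ (margXX'_mem hP.1))
        continuous_margXX'.continuousWithinAt fun P' hP' => margXX'_mem hP'
    have := Metric.tendsto_nhds.1 hc ρ hρ
    simpa only [Real.dist_eq, hPQ] using this
  have hcontT : ∀ᶠ P' in 𝓝[stdSimplex ℝ (X × X × Y)] P,
      |transCost W P' - transCost W P| < ρ := by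
    have := Metric.tendsto_nhds.1 ((continuous_transCost W).continuousWithinAt
      (s := stdSimplex ℝ (X × X × Y)) (x := P)) ρ hρ
    simpa only [Real.dist_eq] using this
  have hcontG : ∀ᶠ P' in 𝓝[stdSimplex ℝ (X × X × Y)] P,
      |g (margX'Y P') - g (margX'Y P)| < ρ := by
    have hc : ContinuousWithinAt (fun P' => g (margX'Y P')) (stdSimplex ℝ (X × X × Y)) P := by
      refine ContinuousWithinAt.comp (t := stdSimplex ℝ (X × Y)) (hg _ (margX'Y_mem hP.1))
        continuous_margX'Y.continuousWithinAt fun P' hP' => margX'Y_mem hP'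
    have := Metric.tendsto_nhds.1 hc ρ hρ
    simpa only [Real.dist_eq] using this
  have hcontB : ∀ᶠ P' in 𝓝[stdSimplex ℝ (X × X × Y)] P,
      dist (marg₂ (margXY P')) (marg₂ (margXY P)) < δ₁ :=
    Metric.tendsto_nhds.1 ((continuous_marg₂.comp continuous_margXY).continuousWithinAt
      (s := stdSimplex ℝ (X × X × Y)) (x := P)) δ₁ hδ₁
  obtain ⟨δ, hδ, hnear⟩ := Metric.mem_nhdsWithin_iff.1
    ((hcontI.and hcontT).and (hcontG.and hcontB))
  have hmany := eventually_pr_count_gt (R := R) Y QX hR (half_pos hρ) (K + 3 * ρ)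
  rw [eventually_blockLengths] at hmany ⊢
  filter_upwards [hmany, eventually_le_errorProb (QX := QX) hW hg hR hρ,
    eventually_le_pr_typePairs QX hR hρ,
    eventually_div_lt (Fintype.card (X × X × Y)) hδ, eventually_const_le_exp 2 hρ,
    eventually_gt_atTop 0] with n hmany herr hpairs hdiv htwo hn0 hne
  have hn : (0 : ℝ) < n := by exact_mod_cast hn0
  obtain ⟨x₀, hx₀⟩ := hne
  have hx₀' : empirical x₀ = QX := hx₀
  obtain ⟨x, x', y, hx, hx', hacn, hdist⟩ := exists_tripleEmpirical_dist_le hn0 hW x₀ hP.1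
    (by rw [hPQ, hx₀']; exact hQ.1) hac
  obtain ⟨⟨nI, nT⟩, nG, nB⟩ := hnear ⟨hdist.trans_lt hdiv, tripleEmpirical_mem hn0 x x' y⟩
  rw [margXX'_tripleEmpirical] at nI
  rw [margX'Y_tripleEmpirical] at nG
  rw [margXY_tripleEmpirical, marg₂_jointEmpirical] at nB
  have nβ := hβ _ (empirical_mem hn0 y) _ (marg₂_mem (margXY_mem hP.1)) nB
  rw [abs_lt] at nI nT nG
  have hp := hpairs ⟨x, hx.trans hx₀'⟩ ⟨x', hx'.trans hx₀'⟩
  simp only at hp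
  set Qn := jointEmpirical x x'
  have m1 : max 0 (mutualInfo Qn - 2 * R) ≤ K + ρ :=
    max_le (add_nonneg (le_max_left _ _) hρ.le)
      (by linarith [le_max_right 0 (mutualInfo Q - 2 * R), nI.2])
  have m2 : max 0 (2 * R - mutualInfo Q) ≤ max 0 (2 * R - mutualInfo Qn) + ρ :=
    max_le (add_nonneg (le_max_left _ _) hρ.le)
      (by linarith [le_max_right 0 (2 * R - mutualInfo Qn), nI.2])
  have hincl : ∀ C : Book QX R n,
      Real.exp (n * (max 0 (2 * R - mutualInfo Qn) - ρ)) ≤ typePairs Qn C →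
      Real.exp (-(n * E₀)) ≤ errorProb W g C.words ∨ ManyCodewords Y (ρ / 2) C := by
    intro C hC
    by_cases hm : ManyCodewords Y (ρ / 2) C
    · exact Or.inr hm
    left
    refine le_trans ?_ (herr C hm x x' y hacn)
    refine le_trans ?_ (mul_le_mul_of_nonneg_right hC (Real.exp_pos _).le)
    rw [← Real.exp_add, Real.exp_le_exp]
    have : -E₀ ≤ (max 0 (2 * R - mutualInfo Qn) - ρ) - (R + transCost W (tripleEmpirical x x' y)
        + beta g QX R (empirical y) - g (jointEmpirical x' y) + 3 * ρ) := by
      linarith [nT.2, nG.1]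
    nlinarith
  have hA : pr (fun C : Book QX R n => ManyCodewords Y (ρ / 2) C) ≤
      Real.exp (-((K + 3 * ρ) * n)) := hmany ⟨x₀, hx₀⟩
  have h1 := (hp.trans (pr_mono hincl)).trans (pr_or_le _ _)
  have e1 : Real.exp (-(n * (K + 2 * ρ))) ≤
      Real.exp (-(n * (max 0 (mutualInfo Qn - 2 * R) + ρ))) := by
    rw [Real.exp_le_exp]
    nlinarith
  have e2 : 2 * Real.exp (-((K + 3 * ρ) * n)) ≤ Real.exp (-(n * (K + 2 * ρ))) := by
    refine (mul_le_mul_of_nonneg_right htwo (Real.exp_pos _).le).trans ?_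
    rw [← Real.exp_add, Real.exp_le_exp]
    linarith
  have e3 : Real.exp (-(n * (K + ε))) ≤ Real.exp (-((K + 3 * ρ) * n)) := by
    rw [Real.exp_le_exp]
    nlinarith
  linarith

lemma expScaleGE_lowerTailProb [MeasurableSpace X] [DiscreteMeasurableSpace X]
    (hW : ∀ x, W x ∈ stdSimplex ℝ Y) (hg : ContinuousOn g (stdSimplex ℝ (X × Y)))
    (hQX : QX ∈ stdSimplex ℝ X) (hR : 0 < R) {E₀ E₁ : ℝ} (hE : E₁ < E₀) :
    ExpScaleGE (blockLengths QX) (lowerTailProb W g QX R E₀) (EltLB W g QX R E₁) := by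
  unfold ExpScaleGE
  rw [EReal.neg_le]
  refine le_iInf₂ fun Q hQ => ?_
  rw [EReal.neg_le, ← EReal.coe_neg, ← EReal.ge_of_forall_gt_iff_ge]
  intro z hz
  rw [EReal.coe_lt_coe_iff] at hz
  have hev := eventually_le_pr_errorProb hW hg hQX hR hE hQ (sub_pos.2 hz)
  rw [eventually_blockLengths] at hev
  refine le_liminf_of_le (by isBoundedDefault) (eventually_blockLengths.2 ?_)
  filter_upwards [hev, eventually_gt_atTop 0] with n hev hn0 hne
  have hn : (0 : ℝ) < n := by exact_mod_cast hn0
  rw [lowerTailProb_eq hn0 hne]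
  have h := hev hne
  have hpos := (Real.exp_pos _).trans_le h
  rw [log_ofReal_div hpos, EReal.coe_le_coe_iff, le_div_iff₀ hn]
  have := (Real.le_log_iff_exp_le hpos).2 h
  linarith

lemma expScaleLE_lowerTailProb [MeasurableSpace X] [DiscreteMeasurableSpace X]
    (hW : ∀ x, W x ∈ stdSimplex ℝ Y) (hg : ContinuousOn g (stdSimplex ℝ (X × Y)))
    (hQX : QX ∈ stdSimplex ℝ X) (hR : 0 < R) (E₀ : ℝ) :
    ExpScaleLE (blockLengths QX) (lowerTailProb W g QX R E₀) (EltUB W g QX R E₀) := by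
  unfold ExpScaleLE
  rw [EReal.le_neg, ← EReal.ge_of_forall_gt_iff_ge]
  intro t ht
  obtain ⟨t₁, ht₁, ht₁'⟩ := EReal.lt_iff_exists_real_btwn.1 ht
  rw [EReal.coe_lt_coe_iff] at ht₁
  have hev := eventually_pr_errorProb_le hW hg hQX hR ht₁ ht₁'
  rw [eventually_blockLengths] at hev
  rw [EReal.le_neg, ← EReal.coe_neg]
  refine limsup_le_of_le (by isBoundedDefault) (eventually_blockLengths.2 ?_)
  filter_upwards [hev, eventually_gt_atTop 0] with n hev hn0 hne
  have hn : (0 : ℝ) < n := by exact_mod_cast hn0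
  rw [lowerTailProb_eq hn0 hne]
  rcases (pr_nonneg fun C : Book QX R n =>
    Real.exp (-(n * E₀)) ≤ errorProb W g C.words).eq_or_lt with h0 | hpos
  · rw [← h0, ENNReal.ofReal_zero, ENNReal.log_zero,
      EReal.bot_div_of_pos_ne_top (by exact_mod_cast hn0) (EReal.natCast_ne_top n)]
    exact bot_le
  · rw [log_ofReal_div hpos, EReal.coe_le_coe_iff, div_le_iff₀ hn]
    have := (Real.log_le_iff_le_exp hpos).2 (hev hne)
    linarith

end Tail

end LowerTail

open LowerTail
theorem theorem1 {X Y : Type*} [Fintype X] [DecidableEq X] [MeasurableSpace X]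
    [DiscreteMeasurableSpace X] [Fintype Y] [DecidableEq Y]
    (W : X → Y → ℝ) (hW : ∀ x, W x ∈ stdSimplex ℝ Y)
    (g : (X × Y → ℝ) → ℝ) (hg : ContinuousOn g (stdSimplex ℝ (X × Y)))
    (QX : X → ℝ) (hQX : QX ∈ stdSimplex ℝ X) (hType : ∃ n, 0 < n ∧ (typeClass n QX).Nonempty)
    (R : ℝ) (hR : 0 < R) (E₀ : ℝ) :
    ExpScaleLE (blockLengths QX) (lowerTailProb W g QX R E₀) (EltUB W g QX R E₀) ∧
    (∀ E₁ < E₀, ExpScaleGE (blockLengths QX) (lowerTailProb W g QX R E₀) (EltLB W g QX R E₁)) ∧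
    (ContinuousWithinAt (fun E => EltLB W g QX R E) (Set.Iic E₀) E₀ →
      ExpScaleGE (blockLengths QX) (lowerTailProb W g QX R E₀) (EltLB W g QX R E₀)) := by
  refine ⟨expScaleLE_lowerTailProb hW hg hQX hR E₀,
    fun E₁ hE => expScaleGE_lowerTailProb hW hg hQX hR hE, fun hcont => ?_⟩
  have h1 : Tendsto (fun E => -EltLB W g QX R E) (𝓝[<] E₀) (𝓝 (-EltLB W g QX R E₀)) :=
    (continuous_neg.tendsto _).comp
      (hcont.tendsto.mono_left (nhdsWithin_mono _ Set.Iio_subset_Iic_self))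
  exact le_of_tendsto h1 (eventually_mem_nhdsWithin.mono fun E₁ hE =>
    expScaleGE_lowerTailProb hW hg hQX hR hE)
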